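/- Let $\mathbb{K}$ be a commutative $\mathbb{Q}$-algebra with a $\mathbb{Z}$-grading concentrated in even degrees, and let $V$ be a unital, associative, strictly graded commutative $\mathbb{K}$-algebra (no differential, no higher products; $xy=(-1)^{|x||y|}yx$ for homogeneous $x,y$) which is free as a graded $\mathbb{K}$-module, with a homogeneous basis $(x_k)_{k\in I}$ (possibly infinite, in arbitrary integral degrees). Let $(\Sigma V)^i=V^{i+1}$, let $W=\Sigma V^*:=\mathrm{Hom}_{\mathbb{K}}(\Sigma V,\mathbb{K})$ be the graded dual with dual topological basis $(t_k)$, $|t_k|=1-|x_k|$, and let $\widehat{L}W$ be the pro-free graded Lie algebra on $W$, i.e. the module of all convergent infinite linear combinations of Lie monomials in the completed tensor algebra $\widehat{T}W=\mathbb{K}\langle\langle t_k\rangle\rangle$. The multiplication of $V$ is encoded by the continuous derivation $m$ of degree one of $\widehat{L}W$ with $$m(t_c)=\sum_{k,l}(-1)^{|x_k|(|x_l|+1)}\,\mu_{kl}^{c}\;t_kt_l,\qquad x_kx_l=\sum_c\mu_{kl}^c\,x_c,\qquad m^2=0 .$$ Let $\Omega=\Omega_{\mathrm{Lie}}(\widehat{L}W)$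 be the differential envelope of $\widehat{L}W$, that is, the pro-free graded Lie algebra on the $t_k$ and the symbols $dt_k$ (of total degree $|t_k|+1$ and form degree $1$), with the derivation $d$ given by $t_k\mapsto dt_k$, $dt_k\mapsto 0$. Let $DR_{\mathrm{Lie}}$ be the quotient of the completed tensor square $\Omega\,\hat\otimes\,\Omega$ by the closed submodule generated by all $$x\otimes y-(-1)^{|x||y|}y\otimes x,\qquad x\otimes[y,z]-[x,y]\otimes z ,$$ let $DR^p_{\mathrm{Lie}}$ be its part of form degree $p$, graded by internal degree (in which $dt_k$ has degree $|t_k|$), and let $L_m$ be the Lie operator, the operator induced on $DR_{\mathrm{Lie}}$ by the derivation of $\Omega$ with $L_m(t_k)=m(t_k)$, $L_m(dt_k)=-d(m(t_k))$. The cyclic Harrison cohomology $HC_{\mathrm{Harr}}(V)$ is the cohomology of $(\Sigma DR^0_{\mathrm{Lie}},L_m)$, and the Harrison cohomology $H_{\mathrm{Harr}}(V,V^*)$ is the cohomology of $(\Sigma DR^1_{\mathrm{Lie}},L_m)$. Both are bigraded: a $p$-form has bidegree $(i,j)$ if it has order $i$ (it is a combination of tensors with $i+p$ letters, $p$ of which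 are of the form $dt_k$) and degree $j$ in $\Sigma DR^p_{\mathrm{Lie}}$ (internal degree $j+1$); the differential $L_m$ has bidegree $(1,1)$. Then for all integers $i,j$ the de Rham differential $d:DR^0_{\mathrm{Lie}}\to DR^1_{\mathrm{Lie}}$ (which corresponds to the cyclic norm operator $N$) induces a well-defined map $$I:HC_{\mathrm{Harr}}^{i+1,j}(V)\longrightarrow H_{\mathrm{Harr}}^{ij}(V,V^*),\qquad I[\alpha]=[d\alpha],$$ and $I$ is (i) a monomorphism if $i=1$, (ii) an epimorphism if $i=2$, (iii) an isomorphism if $i\ge 3$. -/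

import Mathlib

open scoped Classical

noncomputable section

namespace Harrison

/-- Letters of the alphabet on which the free differential graded Lie algebra is built, for a
homogeneous basis `x k` (`k : ι`) of `V`: `(k, false)` is the element `t k` of the topological basis
of `(ΣV)^*` dual to `Σ (x k)`, and `(k, true)` is its differential `d(t k)`. -/
abbrev Letter (ι : Type*) := ι × Bool

/-- Noncommutative formal power series with coefficients in `K` in the letters `t k` and `d(t k)`:
`f` stands for the convergent sum `∑ w, f w • w` over all words `w`. -/
abbrev Series (ι K : Type*) := List (Letter ι) → K

/-- The completed tensor square of `Series ι K`: `F` stands for `∑ u v, F (u, v) • (u ⊗ v)`. -/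
abbrev Series₂ (ι K : Type*) := List (Letter ι) × List (Letter ι) → K

section Degrees

variable {ι : Type*} (deg : ι → ℤ)

/-- Internal degree: `t k` has degree `1 - deg k` because `Σ (x k)` has degree `deg k - 1`;
`d` does not change the internal degree. -/
def internalDeg (w : List (Letter ι)) : ℤ := (w.map fun a => 1 - deg a.1).sum

/-- Form degree: the number of letters `d(t k)`. -/
def formDeg (w : List (Letter ι)) : ℕ := w.countP fun a => a.2

/-- Total degree, the sum of the internal degree and of the form degree. All Koszul signs below are
taken with respect to it. -/
def totalDeg (w : List (Letter ι)) : ℤ := internalDeg deg w + formDeg w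

end Degrees

section Closure

variable {X K : Type*} [CommRing K]

/-- The closed `K`-submodule generated by a set `S`, for the profinite topology (the topology of
coefficientwise convergence, `K` being discrete). -/
def closedSpan (S : Set (X → K)) : Submodule K (X → K) where
  carrier := {f | ∀ s : Finset X, ∃ g ∈ Submodule.span K S, ∀ x ∈ s, g x = f x}
  zero_mem' := fun _ => ⟨0, Submodule.zero_mem _, fun _ _ => rfl⟩
  add_mem' := by
    intro f g hf hg s
    obtain ⟨f', hf', hf''⟩ := hf s
    obtain ⟨g', hg', hg''⟩ := hg s
    exact ⟨f' + g', Submodule.add_mem _ hf' hg', fun x hx => by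
      simp [hf'' x hx, hg'' x hx]⟩
  smul_mem' := by
    intro c f hf s
    obtain ⟨f', hf', hf''⟩ := hf s
    exact ⟨c • f', Submodule.smul_mem _ c hf', fun x hx => by simp [hf'' x hx]⟩

end Closure

section DeRham

variable {ι : Type*} (K : Type*) [CommRing K] (deg : ι → ℤ)

/-- A letter as a power series. -/
def letter (a : Letter ι) : Series ι K := fun w => if w = [a] then 1 else 0

variable {K}

/-- The graded commutator, `[u, v] = u v - (-1)^(|u| |v|) v u` on words, extended bilinearly and
continuously. The coefficients have even degree and cause no signs. -/
def bracket (f g : Series ι K) : Series ι K := fun w =>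
  ∑ k ∈ Finset.range (w.length + 1),
    (f (w.take k) * g (w.drop k)
      - (totalDeg deg (w.take k) * totalDeg deg (w.drop k)).negOnePow •
          (g (w.take k) * f (w.drop k)))

/-- The tensor product of two power series. -/
def tmul (f g : Series ι K) : Series₂ ι K := fun p => f p.1 * g p.2

/-- The graded flip, `u ⊗ v ↦ (-1)^(|u| |v|) v ⊗ u` on words. -/
def flip (F : Series₂ ι K) : Series₂ ι K := fun p =>
  (totalDeg deg p.1 * totalDeg deg p.2).negOnePow • F (p.2, p.1)

variable (K) in
/-- Lie monomials in the letters. -/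
inductive IsLieMonomial : Series ι K → Prop
  | of (a : Letter ι) : IsLieMonomial (letter K a)
  | bracket {f g : Series ι K} (hf : IsLieMonomial f) (hg : IsLieMonomial g) :
      IsLieMonomial (bracket deg f g)

variable (K) in
/-- The pro-free graded Lie algebra `Ω` on the letters `t k`, `d(t k)`. With the derivation `deRham`
below it is the differential envelope `Ω_Lie(L̂(ΣV)^*)` of the pro-free graded Lie algebra
`L̂(ΣV)^*`: the Lie forms. -/
def lieForms : Submodule K (Series ι K) := closedSpan {f | IsLieMonomial K deg f}

variable (K) in
/-- The completed tensor square `Ω ⊗ Ω` of the Lie forms. -/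
def lieForms₂ : Submodule K (Series₂ ι K) :=
  closedSpan {F | ∃ f ∈ lieForms K deg, ∃ g ∈ lieForms K deg, F = tmul f g}

variable (K) in
/-- The closed submodule of `Ω ⊗ Ω` generated by all `x ⊗ y - (-1)^(|x| |y|) y ⊗ x` and all
`x ⊗ [y, z] - [x, y] ⊗ z`. The Lie de Rham complex `DR_Lie` is `Ω ⊗ Ω` modulo these relations. -/
def relations : Submodule K (Series₂ ι K) :=
  closedSpan
    ({F | ∃ f ∈ lieForms K deg, ∃ g ∈ lieForms K deg, F = tmul f g - flip deg (tmul f g)} ∪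
     {F | ∃ f ∈ lieForms K deg, ∃ g ∈ lieForms K deg, ∃ h ∈ lieForms K deg,
        F = tmul f (bracket deg g h) - tmul (bracket deg f g) h})

/-- The continuous derivation of odd degree of the algebra of power series that sends a letter `a` to
`∑ x, (ξ x a) • x`. The coefficient of a word `w` in the image of `f` is obtained by summing over the
factorisations `w = u x v` and over the letters `a`. -/
def oddDer (ξ : List (Letter ι) → Letter ι →₀ K) : Series ι K →ₗ[K] Series ι K :=
  LinearMap.pi fun w =>
    ∑ k ∈ Finset.range (w.length + 1), ∑ l ∈ Finset.range (w.length - k + 1),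
      ∑ a ∈ (ξ ((w.drop k).take l)).support,
        (((totalDeg deg (w.take k)).negOnePow : ℤ) : K) • ξ ((w.drop k).take l) a •
          (LinearMap.proj (w.take k ++ a :: (w.drop k).drop l) : Series ι K →ₗ[K] K)

/-- The extension of `oddDer` to the tensor square,
`x ⊗ y ↦ D x ⊗ y + (-1)^|x| x ⊗ D y`. -/
def oddDer₂ (ξ : List (Letter ι) → Letter ι →₀ K) : Series₂ ι K →ₗ[K] Series₂ ι K :=
  LinearMap.pi fun p =>
    LinearMap.proj p.1 ∘ₗ oddDer deg ξ ∘ₗ LinearMap.funLeft K K (fun u => (u, p.2)) +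
    (((totalDeg deg p.1).negOnePow : ℤ) : K) •
      (LinearMap.proj p.2 ∘ₗ oddDer deg ξ ∘ₗ LinearMap.funLeft K K (fun v => (p.1, v)))

variable (K) in
/-- The de Rham differential on letters: `t k ↦ d(t k)`, `d(t k) ↦ 0`. -/
def deRhamCoeff : List (Letter ι) → Letter ι →₀ K
  | [(k, true)] => Finsupp.single (k, false) 1
  | _ => 0

variable (K) in
/-- The de Rham differential `d`. -/
def deRham : Series₂ ι K →ₗ[K] Series₂ ι K := oddDer₂ deg (deRhamCoeff K)

end DeRham

section Algebra

variable {ι K V : Type*} [CommRing K] [Ring V] [Algebra K V] (b : Module.Basis ι K V) (deg : ι → ℤ)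

/-- The coefficients of the quadratic part of the vector field: `∑ c, structureCoeff k l c • x c` is
`(-1)^(|x k| (|x l| + 1)) x k * x l`. -/
def structureCoeff (k l : ι) : ι →₀ K :=
  (deg k * (deg l + 1)).negOnePow • b.repr (b k * b l)

/-- The Lie operator `L_m` on letters, where `m` is the homological vector field that corresponds to
the multiplication of `V`,
`m (t c) = ∑ k l, (-1)^(|x k| (|x l| + 1)) (coefficient of x c in x k * x l) • t k t l`.
One has `L_m (t c) = m (t c)` and `L_m (d(t c)) = - d (m (t c))`. -/
def lieOpCoeff : List (Letter ι) → Letter ι →₀ K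
  | [(k, false), (l, false)] => (structureCoeff b deg k l).mapDomain fun c => (c, false)
  | [(k, true), (l, false)] => -(structureCoeff b deg k l).mapDomain fun c => (c, true)
  | [(k, false), (l, true)] =>
      -((1 - deg k).negOnePow • (structureCoeff b deg k l).mapDomain fun c => (c, true))
  | _ => 0

/-- The Lie operator `L_m`. -/
def lieOp : Series₂ ι K →ₗ[K] Series₂ ι K := oddDer₂ deg (lieOpCoeff b deg)

end Algebra

section Cohomology

variable {ι K V : Type*} [CommRing K] [Algebra ℚ K] [Ring V] [Algebra K V]
  (𝒦 : ℤ → Submodule ℚ K) (b : Module.Basis ι K V) (deg : ι → ℤ)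

/-- The part of `Ω ⊗ Ω` of form degree `p`, of order `i` (the number of letters minus the form degree),
and of degree `j` after one suspension, i.e. of internal degree `j + 1`. Its image in `DR_Lie` is the
component of bidegree `(i, j)` of the module of suspended `p`-forms `Σ DR^p_Lie`. -/
def forms (p : ℕ) (i j : ℤ) : Submodule ℚ (Series₂ ι K) where
  carrier := {F | F ∈ lieForms₂ K deg ∧
    (∀ u v, F (u, v) ≠ 0 →
      formDeg u + formDeg v = p ∧ (u.length : ℤ) + v.length = i + p) ∧
    ∀ u v, F (u, v) ∈ 𝒦 (j + 1 - (internalDeg deg u + internalDeg deg v))}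
  zero_mem' := ⟨Submodule.zero_mem _, by simp, fun _ _ => Submodule.zero_mem _⟩
  add_mem' := by
    rintro F G ⟨hF, hF', hF''⟩ ⟨hG, hG', hG''⟩
    refine ⟨Submodule.add_mem _ hF hG, fun u v h => ?_,
      fun u v => Submodule.add_mem _ (hF'' u v) (hG'' u v)⟩
    by_cases h0 : F (u, v) = 0
    · exact hG' u v fun h1 => h (by simp [h0, h1])
    · exact hF' u v h0
  smul_mem' := by
    rintro c F ⟨hF, hF', hF''⟩
    refine ⟨?_, fun u v h => hF' u v fun h0 => h (by simp [h0]),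
      fun u v => Submodule.smul_mem _ c (hF'' u v)⟩
    exact ((lieForms₂ K deg).restrictScalars ℚ).smul_mem c hF

/-- Representatives of the cocycles of bidegree `(i, j)` of `(Σ DR^p_Lie, L_m)`. -/
def cocycles (p : ℕ) (i j : ℤ) : Submodule ℚ (Series₂ ι K) :=
  forms 𝒦 deg p i j ⊓
    ((relations K deg).restrictScalars ℚ).comap ((lieOp b deg).restrictScalars ℚ)

/-- Representatives of the coboundaries of bidegree `(i, j)` of `(Σ DR^p_Lie, L_m)`. The differential
`L_m` has bidegree `(1, 1)`. -/
def coboundaries (p : ℕ) (i j : ℤ) : Submodule ℚ (Series₂ ι K) :=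
  forms 𝒦 deg p i j ⊓
    ((relations K deg).restrictScalars ℚ ⊔
      (forms 𝒦 deg p (i - 1) (j - 1)).map ((lieOp b deg).restrictScalars ℚ))

/-- The cohomology in bidegree `(i, j)` of the complex of suspended Lie `p`-forms
`(Σ DR^p_Lie(L̂(ΣV)^*), L_m)`. -/
abbrev Cohomology (p : ℕ) (i j : ℤ) : Type _ :=
  cocycles 𝒦 b deg p i j ⧸
    (coboundaries 𝒦 b deg p i j).submoduleOf (cocycles 𝒦 b deg p i j)

/-- The class of a cocycle. -/
abbrev classOf {p : ℕ} {i j : ℤ} (z : cocycles 𝒦 b deg p i j) : Cohomology 𝒦 b deg p i j :=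
  Submodule.Quotient.mk z

/-- The cyclic Harrison cohomology `HC_Harr^{i,j}(V)`: the cohomology of the suspended Lie 0-forms. -/
abbrev HCHarr (i j : ℤ) : Type _ := Cohomology 𝒦 b deg 0 i j

/-- The Harrison cohomology `H_Harr^{i,j}(V, V^*)`: the cohomology of the suspended Lie 1-forms. -/
abbrev HHarr (i j : ℤ) : Type _ := Cohomology 𝒦 b deg 1 i j

end Cohomology

end Harrison

end

/-!
The proof compares the Lie zero-forms and the Lie one-forms through explicit normal forms.

*Normal forms.* By invariance of the tensors every one-form is equivalent modulo the relations to a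
unique `∑ k, d(t k) ⊗ X k` with Lie series `X k` in the letters `t k`, and is thus described by the
series `g = ∑ k, (t k) (X k)` (`normalForm_spec`). The series `g` is read off from the cyclic trace
`x ⊗ y ↦ N (x y)`, which kills the relations (`trace_relations`). On normal forms the Lie operator
`L_m` becomes, up to sign, a Hochschild differential `b` (`normalForm_lieOp_ofNormalForm`), and the
normal form of `dF` for a zero-form `F` is the cyclic trace of `F` (`normalForm_deRham`). Hence the
normal forms of exact one-forms are the normal forms that are invariant under the signed rotation `t`
of words (`exists_normalForm_deRham_eq`). Moreover `d` is injective on zero-forms with at least one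
letter, by Cartan's formula for the Euler vector field (`mem_relations_of_deRham`).

*The quotient by the exact forms.* The operator `1 - t` sends a normal form `∑ k, (t k) (X k)` to the
Lie series `∑ k, [t k, X k]`. Its kernel consists of the exact forms, and by the Dynkin–Specht–Wever
theorem it is onto the Lie series without linear part (`exists_sub_rot`). It satisfies
`(1 - t) b = b' (1 - t)`, where `b'` is the derivation `m` (`hoch_sub_rot`). So, in length at least
two, one-forms modulo exact forms form the complex of Lie series with the differential `b'`.

*Acyclicity.* As `V` has a unit, contracting the first letter with the unit is a homotopy for `b'` on
all series (`oddDer_unitContr`). It does not preserve Lie series, so its values are corrected: because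
`V` is graded commutative, `b'` is compatible with the unshuffle coproduct (`unshuffle_oddDer`), and
therefore commutes with the Adams operation `ψ`, the coproduct followed by the product. As `ψ` acts by
`2 ^ q` on the `q`-th layer of the Poincaré–Birkhoff–Witt filtration (`adams_pbw`), the components of
a primitive in the layers `q ≥ 2` can be removed one after another (`exists_lie_primitive`). The
complex of Lie series is thus exact in length at least two (`exists_lie_oddDer_eq`).

*Conclusion.* Let `g` be a normal form with at least three letters such that `b g` is invariant under
`t`. Then `(1 - t) g = b' y` for a Lie series `y = (1 - t) g'` of length at least two, so that `g - b g'`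
is invariant, i.e. exact (`exists_deRham_sub_mem`). Applied to a cocycle this gives surjectivity in
order `i ≥ 2`; applied to a one-form `G` with `dF = L_m G` it gives injectivity in order `i ≥ 3`. In
order `i = 1` such a `G` consists of tensors with a single letter, and there are none.
-/


noncomputable section

namespace Harrison

/-! ### Signs and the profinite topology -/

section Sign

variable (K : Type*) [CommRing K]

/-- The sign `(-1)^n` as an element of `K`. -/
def sgn (n : ℤ) : K := ((n.negOnePow : ℤ) : K)

variable {K}

theorem sgn_add (m n : ℤ) : sgn K (m + n) = sgn K m * sgn K n := by
  simp [sgn, Int.negOnePow_add]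

theorem sgn_congr {m n : ℤ} (h : Even (m - n)) : sgn K m = sgn K n := by
  rw [sgn, sgn, (Int.negOnePow_eq_iff m n).2 h]

theorem sgn_even {m : ℤ} (h : Even m) : sgn K m = 1 := by
  simp [sgn, Int.negOnePow_even m h]

theorem sgn_odd {m : ℤ} (h : Odd m) : sgn K m = -1 := by
  simp [sgn, Int.negOnePow_odd m h]

@[simp] theorem sgn_zero : sgn K 0 = 1 := sgn_even (by simp)

theorem sgn_mul_self (m : ℤ) : sgn K m * sgn K m = 1 := by
  rw [← sgn_add]; exact sgn_even ⟨m, rfl⟩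

theorem negOnePow_smul (n : ℤ) (x : K) : n.negOnePow • x = sgn K n * x := by
  rw [Units.smul_def, zsmul_eq_mul, sgn]

theorem sgn_eq_or (n : ℤ) : sgn K n = 1 ∨ sgn K n = -1 := by
  rcases Int.even_or_odd n with h | h
  · exact Or.inl (sgn_even h)
  · exact Or.inr (sgn_odd h)

end Sign

section Topology

variable {X Y K : Type*} [CommRing K] [TopologicalSpace K] [DiscreteTopology K]

/-- For a discrete coefficient ring `closedSpan` is the topological closure of the span. -/
theorem mem_closedSpan_iff {S : Set (X → K)} {f : X → K} :
    f ∈ closedSpan S ↔ f ∈ closure (Submodule.span K S : Set (X → K)) := by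
  rw [mem_closure_iff]
  constructor
  · intro h o ho hf
    obtain ⟨I, u, hu, hI⟩ := isOpen_pi_iff.1 ho f hf
    obtain ⟨g, hg, hgf⟩ := h I
    exact ⟨g, hI fun i hi => by rw [hgf i hi]; exact (hu i hi).2, hg⟩
  · intro h s
    obtain ⟨g, hg, hgs⟩ := h ((s : Set X).pi fun x => {f x})
      (isOpen_set_pi s.finite_toSet fun x _ => isOpen_discrete _) (fun x _ => rfl)
    exact ⟨g, hgs, fun x hx => hg x hx⟩

theorem isClosed_closedSpan (S : Set (X → K)) : IsClosed (closedSpan S : Set (X → K)) := by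
  have : (closedSpan S : Set (X → K)) = closure (Submodule.span K S : Set (X → K)) := by
    ext f; exact mem_closedSpan_iff
  rw [this]; exact isClosed_closure

theorem closedSpan_le {S : Set (X → K)} {N : Submodule K (X → K)} (hN : IsClosed (N : Set (X → K)))
    (h : S ⊆ N) : closedSpan S ≤ N := fun _ hf =>
  closure_minimal (Submodule.span_le.2 h) hN (mem_closedSpan_iff.1 hf)

theorem subset_closedSpan {K : Type*} [CommRing K] (S : Set (X → K)) : S ⊆ closedSpan S :=
  fun f hf _ => ⟨f, Submodule.subset_span hf, fun _ _ => rfl⟩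

/-- A continuous linear map that sends generators into a closed submodule sends the closed span
there. -/
theorem map_mem_of_mem_closedSpan {S : Set (X → K)} {N : Submodule K (Y → K)}
    (hN : IsClosed (N : Set (Y → K))) (Φ : (X → K) →ₗ[K] (Y → K)) (hΦ : Continuous Φ)
    (h : ∀ f ∈ S, Φ f ∈ N) {f : X → K} (hf : f ∈ closedSpan S) : Φ f ∈ N :=
  closedSpan_le (N := N.comap Φ) (hN.preimage hΦ) h hf

theorem closedSpan_single {K : Type*} [CommRing K] [DecidableEq X] :
    closedSpan (Set.range fun x : X => (Pi.single x 1 : X → K)) = ⊤ := by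
  refine eq_top_iff.2 fun f _ s => ⟨∑ x ∈ s, f x • Pi.single x 1, Submodule.sum_mem _ fun x _ =>
    Submodule.smul_mem _ _ (Submodule.subset_span ⟨x, rfl⟩), fun x hx => ?_⟩
  simp [Finset.sum_apply, Pi.single_apply, hx]

/-- The finitely supported series are dense. -/
theorem map_mem_of_single [DecidableEq X] {N : Submodule K (Y → K)}
    (hN : IsClosed (N : Set (Y → K))) (Φ : (X → K) →ₗ[K] (Y → K)) (hΦ : Continuous Φ)
    (h : ∀ x, Φ (Pi.single x 1) ∈ N) (f : X → K) : Φ f ∈ N := by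
  refine map_mem_of_mem_closedSpan (S := Set.range fun x : X => (Pi.single x 1 : X → K)) hN Φ hΦ ?_
    (by rw [closedSpan_single]; trivial)
  rintro _ ⟨x, rfl⟩
  exact h x

theorem isClosed_bot : IsClosed ((⊥ : Submodule K (Y → K)) : Set (Y → K)) := by
  simp

/-- A continuous linear map is determined by its values on words. -/
theorem eq_of_single [DecidableEq X] (Φ Ψ : (X → K) →ₗ[K] (Y → K)) (hΦ : Continuous Φ)
    (hΨ : Continuous Ψ)
    (h : ∀ x, Φ (Pi.single x 1) = Ψ (Pi.single x 1)) (f : X → K) : Φ f = Ψ f := by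
  have := map_mem_of_single (N := ⊥) isClosed_bot (Φ - Ψ) (hΦ.sub hΨ)
    (fun x => by simp [h x]) f
  simpa [sub_eq_zero] using this

end Topology

/-! ### Concatenation, flip and rotation -/

section Ops

variable {ι K : Type*} [CommRing K] (deg : ι → ℤ)

@[simp] theorem totalDeg_nil : totalDeg deg ([] : List (Letter ι)) = 0 := by
  simp [totalDeg, internalDeg, formDeg]

theorem totalDeg_append (u v : List (Letter ι)) :
    totalDeg deg (u ++ v) = totalDeg deg u + totalDeg deg v := by
  simp [totalDeg, internalDeg, formDeg, List.countP_append]; ring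

theorem totalDeg_cons (a : Letter ι) (v : List (Letter ι)) :
    totalDeg deg (a :: v) = totalDeg deg [a] + totalDeg deg v := by
  rw [← totalDeg_append]; rfl

/-- `f = ∑ a, a * slice a f` up to the constant term. -/
def slice (a : Letter ι) : Series ι K →ₗ[K] Series ι K := LinearMap.funLeft K K (a :: ·)

@[simp] theorem slice_apply (a : Letter ι) (f : Series ι K) (w) : slice a f w = f (a :: w) := rfl

/-- Removing the first letter of the left tensor factor. -/
def slice₂ (a : Letter ι) : Series₂ ι K →ₗ[K] Series₂ ι K :=
  LinearMap.funLeft K K fun p => (a :: p.1, p.2)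

@[simp] theorem slice₂_apply (a : Letter ι) (F : Series₂ ι K) (p) :
    slice₂ a F p = F (a :: p.1, p.2) := rfl

/-- The concatenation product `u ⊗ v ↦ u v`. -/
def mult : Series₂ ι K →ₗ[K] Series ι K :=
  LinearMap.pi fun w => ∑ k ∈ Finset.range (w.length + 1), LinearMap.proj (w.take k, w.drop k)

theorem mult_apply (F : Series₂ ι K) (w) :
    mult F w = ∑ k ∈ Finset.range (w.length + 1), F (w.take k, w.drop k) := by
  simp [mult]

@[simp] theorem mult_nil (F : Series₂ ι K) : mult F [] = F ([], []) := by simp [mult_apply]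

theorem mult_cons (F : Series₂ ι K) (a w) :
    mult F (a :: w) = F ([], a :: w) + mult (slice₂ a F) w := by
  rw [mult_apply, List.length_cons, Finset.sum_range_succ', add_comm]
  simp [mult_apply]

theorem continuous_mult [TopologicalSpace K] [DiscreteTopology K] :
    Continuous (mult : Series₂ ι K →ₗ[K] Series ι K) := by
  refine continuous_pi fun w => ?_
  simp only [mult_apply]
  fun_prop

/-- `flip` as a linear map. -/
def flipL : Series₂ ι K →ₗ[K] Series₂ ι K where
  toFun := flip deg
  map_add' F G := by ext p; simp [flip]
  map_smul' c F := by ext p; simp [flip, negOnePow_smul]; ring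

theorem flipL_apply (F : Series₂ ι K) (u v) :
    flipL deg F (u, v) = sgn K (totalDeg deg u * totalDeg deg v) * F (v, u) :=
  negOnePow_smul _ _

theorem flip_eq (F : Series₂ ι K) : flip deg F = flipL deg F := rfl

theorem continuous_flipL [TopologicalSpace K] [DiscreteTopology K] :
    Continuous (flipL deg : Series₂ ι K →ₗ[K] Series₂ ι K) := by
  refine continuous_pi fun ⟨u, v⟩ => ?_
  simp only [flipL_apply]
  fun_prop

theorem bracket_eq (f g : Series ι K) :
    bracket deg f g = mult (tmul f g - flipL deg (tmul f g)) := by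
  ext w
  simp only [mult_apply, bracket, Pi.sub_apply, flipL_apply, tmul, negOnePow_smul]
  exact Finset.sum_congr rfl fun k _ => by ring

/-- `tmul` as a bilinear map. -/
def tmulL : Series ι K →ₗ[K] Series ι K →ₗ[K] Series₂ ι K :=
  LinearMap.mk₂ K tmul (fun f f' g => by ext; simp [tmul, add_mul])
    (fun c f g => by ext; simp [tmul, mul_assoc]) (fun f g g' => by ext; simp [tmul, mul_add])
    (fun c f g => by ext; simp [tmul]; ring)

theorem tmulL_apply (f g : Series ι K) : tmulL f g = tmul f g := rfl

theorem continuous_tmul_left [TopologicalSpace K] [DiscreteTopology K] (g : Series ι K) :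
    Continuous (fun f => tmul f g) := by
  unfold tmul; fun_prop

theorem continuous_tmul_right [TopologicalSpace K] [DiscreteTopology K] (f : Series ι K) :
    Continuous (fun g => tmul f g) := by
  unfold tmul; fun_prop

/-- The graded commutator as a bilinear map. -/
def bracketL : Series ι K →ₗ[K] Series ι K →ₗ[K] Series ι K :=
  tmulL.compr₂ (mult ∘ₗ (LinearMap.id - flipL deg))

theorem bracketL_apply (f g : Series ι K) : bracketL deg f g = bracket deg f g := by
  rw [bracket_eq]; rfl

theorem continuous_bracket_left [TopologicalSpace K] [DiscreteTopology K] (g : Series ι K) :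
    Continuous (fun f => bracket deg f g) := by
  simp only [bracket_eq]
  exact continuous_mult.comp ((continuous_tmul_left g).sub
    ((continuous_flipL deg).comp (continuous_tmul_left g)))

theorem continuous_bracket_right [TopologicalSpace K] [DiscreteTopology K] (f : Series ι K) :
    Continuous (fun g => bracket deg f g) := by
  simp only [bracket_eq]
  exact continuous_mult.comp ((continuous_tmul_right f).sub
    ((continuous_flipL deg).comp (continuous_tmul_right f)))

/-- The concatenation product of two series. -/
def conc (f g : Series ι K) : Series ι K := mult (tmul f g)

theorem conc_cons (f g : Series ι K) (a w) :
    conc f g (a :: w) = f [] * g (a :: w) + conc (slice a f) g w := mult_cons _ _ _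

@[simp] theorem conc_nil (f g : Series ι K) : conc f g [] = f [] * g [] := mult_nil _

/-- `conc` as a bilinear map. -/
def concL : Series ι K →ₗ[K] Series ι K →ₗ[K] Series ι K := tmulL.compr₂ mult

theorem concL_apply (f g : Series ι K) : concL f g = conc f g := rfl

theorem slice_conc (f g : Series ι K) (a) :
    slice a (conc f g) = f [] • slice a g + conc (slice a f) g := by
  ext w; simp [conc_cons]

theorem conc_assoc (f g h : Series ι K) : conc (conc f g) h = conc f (conc g h) := by
  ext w
  induction w generalizing f g h with
  | nil => simp [mul_assoc]
  | cons a w ih =>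
    rw [conc_cons, conc_cons, slice_conc, ← concL_apply (_ + _), map_add, map_smul,
      LinearMap.add_apply, Pi.add_apply, concL_apply (conc _ _), ih, conc_cons]
    simp [concL_apply]
    ring

theorem continuous_conc_left [TopologicalSpace K] [DiscreteTopology K] (g : Series ι K) :
    Continuous (fun f => conc f g) := continuous_mult.comp (continuous_tmul_left g)

theorem continuous_conc_right [TopologicalSpace K] [DiscreteTopology K] (f : Series ι K) :
    Continuous (fun g => conc f g) := continuous_mult.comp (continuous_tmul_right f)

/-- Rotation of words with the Koszul sign: the coefficient of `u c` is, up to sign, that of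
`c u`. -/
def rot : Series ι K →ₗ[K] Series ι K :=
  LinearMap.pi fun w => match w.reverse with
    | [] => LinearMap.proj []
    | c :: r => sgn K (totalDeg deg [c] * totalDeg deg r.reverse) • LinearMap.proj (c :: r.reverse)

@[simp] theorem rot_nil (f : Series ι K) : rot deg f [] = f [] := by simp [rot]

theorem rot_append (f : Series ι K) (u c) :
    rot deg f (u ++ [c]) = sgn K (totalDeg deg [c] * totalDeg deg u) * f (c :: u) := by
  have : (u ++ [c]).reverse = c :: u.reverse := by simp
  simp only [rot, LinearMap.pi_apply]
  rw [this]
  simp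

theorem continuous_rot [TopologicalSpace K] [DiscreteTopology K] :
    Continuous (rot deg : Series ι K →ₗ[K] Series ι K) := by
  refine continuous_pi fun w => ?_
  induction w using List.reverseRecOn with
  | nil => simp only [rot_nil]; fun_prop
  | append_singleton u c _ => simp only [rot_append]; fun_prop

theorem rot_pow_append (f : Series ι K) (v u) :
    ((rot deg) ^ v.length) f (u ++ v) =
      sgn K (totalDeg deg u * totalDeg deg v) * f (v ++ u) := by
  induction v using List.reverseRecOn generalizing u with
  | nil => simp
  | append_singleton v c ih =>
    rw [List.length_append, List.length_singleton, pow_succ', Module.End.mul_apply,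
      ← List.append_assoc, rot_append, ← List.cons_append, ih, totalDeg_cons deg c u,
      totalDeg_append, totalDeg_append, ← mul_assoc, ← sgn_add, List.append_assoc]
    congr 1
    refine sgn_congr ?_
    simp only [Int.even_sub, Int.even_add, Int.even_mul]; tauto

theorem rot_pow_length (f : Series ι K) (w) : ((rot deg) ^ w.length) f w = f w := by
  simpa using rot_pow_append deg f w []

theorem continuous_rot_pow [TopologicalSpace K] [DiscreteTopology K] (r : ℕ) :
    Continuous ((rot deg ^ r : Module.End K (Series ι K))) := by
  induction r with
  | zero => exact continuous_id
  | succ r ih => rw [pow_succ]; exact ih.comp (continuous_rot deg)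

/-- Cyclic symmetrisation. -/
def cyc : Series ι K →ₗ[K] Series ι K :=
  LinearMap.pi fun w => ∑ r ∈ Finset.range w.length, LinearMap.proj w ∘ₗ (rot deg ^ r)

theorem cyc_apply (f : Series ι K) (w) :
    cyc deg f w = ∑ r ∈ Finset.range w.length, (rot deg ^ r) f w := by
  simp [cyc]

theorem continuous_cyc [TopologicalSpace K] [DiscreteTopology K] :
    Continuous (cyc deg : Series ι K →ₗ[K] Series ι K) := by
  refine continuous_pi fun w => ?_
  simp only [cyc_apply]
  exact continuous_finsetSum _ fun r _ =>
    (continuous_apply w).comp (continuous_rot_pow deg r)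

theorem cyc_rot (f : Series ι K) : cyc deg (rot deg f) = cyc deg f := by
  ext w
  have h1 := Finset.sum_range_succ (fun r => (rot deg ^ r) f w) w.length
  have h2 := Finset.sum_range_succ' (fun r => (rot deg ^ r) f w) w.length
  rw [h1, rot_pow_length] at h2
  simp only [cyc_apply]
  simpa [pow_succ] using h2.symm

theorem cyc_rot_pow (r : ℕ) (f : Series ι K) : cyc deg ((rot deg ^ r) f) = cyc deg f := by
  induction r with
  | zero => rfl
  | succ r ih => rw [pow_succ', Module.End.mul_apply, cyc_rot, ih]

theorem rot_cyc (f : Series ι K) : rot deg (cyc deg f) = cyc deg f := by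
  ext w
  induction w using List.reverseRecOn with
  | nil => simp [cyc_apply]
  | append_singleton u c _ =>
    conv_rhs => rw [← cyc_rot deg f]
    rw [rot_append, cyc_apply, cyc_apply, Finset.mul_sum]
    refine Finset.sum_congr (by simp) fun r _ => ?_
    rw [← Module.End.mul_apply, ← pow_succ, pow_succ', Module.End.mul_apply, rot_append]

theorem cyc_of_rot_eq {f : Series ι K} (h : rot deg f = f) (w) :
    cyc deg f w = w.length * f w := by
  have (r : ℕ) : (rot deg ^ r) f = f := by
    induction r with
    | zero => rfl
    | succ r ih => rw [pow_succ, Module.End.mul_apply, h, ih]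
  simp [cyc_apply, this]

end Ops

/-! ### Odd derivations -/

section Derivations

variable {ι K : Type*} [CommRing K] (deg : ι → ℤ) (ξ : List (Letter ι) → Letter ι →₀ K)

/-- The contraction of the first letter with the coefficients `ξ x`: it replaces the word `x` at the
front by a letter. -/
def contr (x : List (Letter ι)) : Series ι K →ₗ[K] Series ι K :=
  ∑ a ∈ (ξ x).support, ξ x a • slice a

theorem contr_apply (x : List (Letter ι)) (f : Series ι K) (w) :
    contr ξ x f w = ∑ a ∈ (ξ x).support, ξ x a * f (a :: w) := by
  simp [contr]

theorem contr_eq_zero {x : List (Letter ι)} (h : ξ x = 0) : contr ξ x = 0 := by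
  simp [contr, h]

/-- The analogue of `contr` for the left tensor factor. -/
def contr₂ (x : List (Letter ι)) : Series₂ ι K →ₗ[K] Series₂ ι K :=
  ∑ a ∈ (ξ x).support, ξ x a • slice₂ a

theorem contr₂_apply (x : List (Letter ι)) (F : Series₂ ι K) (p) :
    contr₂ ξ x F p = ∑ a ∈ (ξ x).support, ξ x a * F (a :: p.1, p.2) := by
  simp [contr₂]

theorem oddDer_apply (f : Series ι K) (w) :
    oddDer deg ξ f w = ∑ k ∈ Finset.range (w.length + 1), ∑ l ∈ Finset.range (w.length - k + 1),
      ∑ a ∈ (ξ ((w.drop k).take l)).support,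
        sgn K (totalDeg deg (w.take k)) * (ξ ((w.drop k).take l) a *
          f (w.take k ++ a :: (w.drop k).drop l)) := by
  simp [oddDer, sgn]

theorem continuous_oddDer [TopologicalSpace K] [DiscreteTopology K] :
    Continuous (oddDer deg ξ) := by
  refine continuous_pi fun w => ?_
  simp only [oddDer_apply]
  fun_prop

theorem oddDer₂_apply (F : Series₂ ι K) (u v) :
    oddDer₂ deg ξ F (u, v) = oddDer deg ξ (fun u' => F (u', v)) u +
      sgn K (totalDeg deg u) * oddDer deg ξ (fun v' => F (u, v')) v := by
  rfl

theorem continuous_oddDer₂ [TopologicalSpace K] [DiscreteTopology K] :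
    Continuous (oddDer₂ deg ξ) := by
  refine continuous_pi fun ⟨u, v⟩ => ?_
  simp only [oddDer₂_apply]
  refine Continuous.add ?_ (continuous_const.mul ?_)
  · exact (continuous_apply u).comp ((continuous_oddDer deg ξ).comp (by fun_prop))
  · exact (continuous_apply v).comp ((continuous_oddDer deg ξ).comp (by fun_prop))

/-- The recursion for an odd derivation on the first letter of a word. -/
theorem oddDer_cons_general (f : Series ι K) (a w) :
    oddDer deg ξ f (a :: w) = sgn K (totalDeg deg [a]) * oddDer deg ξ (slice a f) w +
      ∑ l ∈ Finset.range (w.length + 2), contr ξ ((a :: w).take l) f ((a :: w).drop l) := by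
  rw [oddDer_apply, List.length_cons, Finset.sum_range_succ']
  congr 1
  · rw [oddDer_apply, Finset.mul_sum]
    refine Finset.sum_congr rfl fun k _ => ?_
    rw [Finset.mul_sum]
    simp only [List.drop_succ_cons, List.take_succ_cons, Nat.add_sub_add_right]
    refine Finset.sum_congr rfl fun l _ => ?_
    rw [Finset.mul_sum]
    refine Finset.sum_congr rfl fun b _ => ?_
    rw [totalDeg_cons, sgn_add]
    simp [mul_assoc]
  · simp [contr_apply]

variable {ξ}

/-- The coefficients are those of a derivation with a linear and a quadratic part. -/
def LinQuad (ξ : List (Letter ι) → Letter ι →₀ K) : Prop :=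
  ∀ x, x.length ≠ 1 → x.length ≠ 2 → ξ x = 0

theorem oddDer_nil (hξ : LinQuad ξ) (f : Series ι K) : oddDer deg ξ f [] = 0 := by
  simp [oddDer_apply, hξ [] (by simp) (by simp)]

theorem oddDer_singleton (hξ : LinQuad ξ) (f : Series ι K) (a) :
    oddDer deg ξ f [a] = contr ξ [a] f [] := by
  rw [oddDer_cons_general, oddDer_nil deg hξ]
  simp [Finset.sum_range_succ, contr_eq_zero ξ (hξ [] (by simp) (by simp))]

theorem oddDer_cons_cons (hξ : LinQuad ξ) (f : Series ι K) (a c w) :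
    oddDer deg ξ f (a :: c :: w) = sgn K (totalDeg deg [a]) * oddDer deg ξ (slice a f) (c :: w) +
      contr ξ [a] f (c :: w) + contr ξ [a, c] f w := by
  rw [oddDer_cons_general, add_assoc]
  congr 1
  rw [List.length_cons, Finset.sum_range_succ', Finset.sum_range_succ', Finset.sum_range_succ',
    Finset.sum_eq_zero fun l hl => ?_]
  · simp [contr_eq_zero ξ (hξ [] (by simp) (by simp))]
    ring
  · rw [contr_eq_zero ξ (hξ _ _ _)]
    · rfl
    all_goals
      simp only [List.length_take, List.length_cons, Finset.mem_range] at hl ⊢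
      omega

/-- The Leibniz rule. -/
theorem mult_oddDer₂ (hξ : LinQuad ξ) (F : Series₂ ι K) :
    mult (oddDer₂ deg ξ F) = oddDer deg ξ (mult F) := by
  ext w
  induction w generalizing F with
  | nil => simp [oddDer₂_apply, oddDer_nil deg hξ]
  | cons a w ih =>
    have hs : slice a (mult F) = (fun w => F ([], a :: w)) + mult (slice₂ a F) := by
      ext w; simp [mult_cons]
    have hc (x w) : contr ξ x (mult F) w =
        contr ξ x (fun w => F ([], w)) w + mult (contr₂ ξ x F) w := by
      simp only [contr_apply, mult_cons, mul_add, Finset.sum_add_distrib, contr₂]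
      simp
    cases w with
    | nil =>
      rw [oddDer_singleton deg hξ, hc, mult_cons]
      simp [oddDer₂_apply, oddDer_nil deg hξ, oddDer_singleton deg hξ, contr_apply, contr₂_apply]
    | cons c w =>
      have h2 : slice₂ a (oddDer₂ deg ξ F) =
          sgn K (totalDeg deg [a]) • oddDer₂ deg ξ (slice₂ a F) + contr₂ ξ [a] F +
          (fun p => match p.1 with
            | [] => 0
            | c :: u => contr₂ ξ [a, c] F (u, p.2)) := by
        ext ⟨u, v⟩
        cases u with
        | nil =>
          simp only [slice₂_apply, oddDer₂_apply, oddDer_singleton deg hξ, Pi.add_apply,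
            Pi.smul_apply, oddDer_nil deg hξ, smul_eq_mul, totalDeg_nil, sgn_zero]
          simp [contr_apply, contr₂_apply]; ring
        | cons c u =>
          simp only [slice₂_apply, oddDer₂_apply, oddDer_cons_cons deg hξ, Pi.add_apply,
            Pi.smul_apply, smul_eq_mul, totalDeg_cons deg a (c :: u), sgn_add]
          have : slice a (fun u' => F (u', v)) = fun u' => slice₂ a F (u', v) := rfl
          rw [this]
          simp [contr_apply, contr₂_apply]; ring
      have h3 : mult (fun p : List (Letter ι) × List (Letter ι) => match p.1 with
            | [] => 0
            | c :: u => contr₂ ξ [a, c] F (u, p.2)) (c :: w) = mult (contr₂ ξ [a, c] F) w := by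
        rw [mult_cons, zero_add]; rfl
      rw [oddDer_cons_cons deg hξ, hs, hc, hc, mult_cons, h2, map_add, map_add, map_smul,
        Pi.add_apply, Pi.add_apply, Pi.smul_apply, ih, h3, oddDer₂_apply,
        oddDer_nil deg hξ, oddDer_cons_cons deg hξ, map_add]
      have : slice a (fun v' => F ([], v')) = fun w => F ([], a :: w) := rfl
      rw [this]
      simp
      ring

/-- The degree condition for `oddDer` to be an odd operator. -/
def OddCoeff (ξ : List (Letter ι) → Letter ι →₀ K) : Prop :=
  ∀ x a, ξ x a ≠ 0 → Odd (totalDeg deg x - totalDeg deg [a])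

variable {deg}

/-- An odd derivation turns a sign depending on the degree into the sign of the opposite parity. -/
theorem oddDer_sgn_mul (hd : OddCoeff deg ξ) (m : ℤ) (f : Series ι K) (w) :
    oddDer deg ξ (fun w => sgn K (m * totalDeg deg w) * f w) w =
      sgn K (m * (totalDeg deg w + 1)) * oddDer deg ξ f w := by
  simp only [oddDer_apply, Finset.mul_sum]
  refine Finset.sum_congr rfl fun k _ => Finset.sum_congr rfl fun l _ =>
    Finset.sum_congr rfl fun a ha => ?_
  have h1 := hd _ _ (Finsupp.mem_support_iff.1 ha)
  have h2 : totalDeg deg w = totalDeg deg (w.take k) + (totalDeg deg ((w.drop k).take l) +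
      totalDeg deg ((w.drop k).drop l)) := by
    rw [← totalDeg_append, ← totalDeg_append, List.take_append_drop, List.take_append_drop]
  have : sgn K (m * totalDeg deg (w.take k ++ a :: (w.drop k).drop l)) =
      sgn K (m * (totalDeg deg w + 1)) := by
    refine sgn_congr ?_
    rw [← mul_sub]
    refine Even.mul_left ?_ _
    rw [totalDeg_append, totalDeg_cons, h2]
    obtain ⟨z, hz⟩ := h1
    exact ⟨-z - 1, by linarith⟩
  rw [this]; ring

theorem flipL_oddDer₂ (hd : OddCoeff deg ξ) (F : Series₂ ι K) :
    flipL deg (oddDer₂ deg ξ F) = oddDer₂ deg ξ (flipL deg F) := by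
  ext ⟨u, v⟩
  simp only [flipL_apply, oddDer₂_apply, mul_add]
  rw [add_comm]
  congr 1
  · have := oddDer_sgn_mul hd (totalDeg deg v) (fun v' => F (v, v')) u
    simp only [mul_comm (totalDeg deg v)] at this
    rw [this, ← mul_assoc, ← sgn_add]
    congr 1
    exact sgn_congr ⟨0, by ring⟩
  · have := oddDer_sgn_mul hd (totalDeg deg u) (fun v' => F (v', u)) v
    rw [this, ← mul_assoc, ← sgn_add]
    congr 1
    refine sgn_congr ?_
    simp only [Int.even_sub, Int.even_add, Int.even_mul]; tauto

variable (deg) in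
/-- The parity involution `w ↦ (-1)^|w| w`. -/
def par : Series ι K →ₗ[K] Series ι K :=
  LinearMap.pi fun w => sgn K (totalDeg deg w) • LinearMap.proj w

variable (deg) in
theorem par_apply (f : Series ι K) (w) : par deg f w = sgn K (totalDeg deg w) * f w := rfl

variable (deg) in
theorem continuous_par [TopologicalSpace K] [DiscreteTopology K] :
    Continuous (par deg : Series ι K →ₗ[K] Series ι K) :=
  continuous_pi fun w => by simp only [par_apply]; fun_prop

theorem oddDer_par (hd : OddCoeff deg ξ) (f : Series ι K) :
    oddDer deg ξ (par deg f) = -par deg (oddDer deg ξ f) := by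
  ext w
  have := oddDer_sgn_mul hd 1 f w
  simp only [one_mul] at this
  rw [Pi.neg_apply, par_apply, ← neg_mul]
  refine this.trans ?_
  rw [sgn_add, sgn_odd odd_one, mul_neg_one]

variable (deg) in
theorem par_par (f : Series ι K) : par deg (par deg f) = f := by
  ext w; rw [par_apply, par_apply, ← mul_assoc, sgn_mul_self, one_mul]

theorem oddDer₂_tmul (f g : Series ι K) :
    oddDer₂ deg ξ (tmul f g) =
      tmul (oddDer deg ξ f) g + tmul (par deg f) (oddDer deg ξ g) := by
  ext ⟨u, v⟩
  have h1 : (fun u' => tmul f g (u', v)) = g v • f := by ext; simp [tmul, mul_comm]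
  have h2 : (fun v' => tmul f g (u, v')) = f u • g := by ext; simp [tmul]
  rw [oddDer₂_apply, h1, h2, map_smul, map_smul]
  simp [tmul, par_apply]; ring

theorem oddDer_bracket (hξ : LinQuad ξ) (hd : OddCoeff deg ξ) (f g : Series ι K) :
    oddDer deg ξ (bracket deg f g) =
      bracket deg (oddDer deg ξ f) g + bracket deg (par deg f) (oddDer deg ξ g) := by
  rw [bracket_eq, ← mult_oddDer₂ deg hξ, map_sub, ← flipL_oddDer₂ hd, oddDer₂_tmul, map_add,
    bracket_eq, bracket_eq]
  simp only [map_add, map_sub]; abel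

theorem oddDer_conc (hξ : LinQuad ξ) (f g : Series ι K) :
    oddDer deg ξ (conc f g) =
      conc (oddDer deg ξ f) g + conc (par deg f) (oddDer deg ξ g) := by
  rw [conc, ← mult_oddDer₂ deg hξ, oddDer₂_tmul, map_add]; rfl

end Derivations

/-! ### Lie series -/

section Words

variable {ι K : Type*} [CommRing K] (deg : ι → ℤ)

theorem letter_eq (a : Letter ι) : letter K a = Pi.single [a] 1 := by
  ext w; simp [letter, Pi.single_apply]

theorem tmul_single (u v : List (Letter ι)) :
    tmul (Pi.single u 1 : Series ι K) (Pi.single v 1) = Pi.single (u, v) 1 := by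
  ext ⟨u', v'⟩
  simp [tmul, Pi.single_apply, ite_and]
  split_ifs <;> simp_all

theorem mult_single (u v : List (Letter ι)) :
    mult (Pi.single (u, v) 1 : Series₂ ι K) = Pi.single (u ++ v) 1 := by
  ext w
  induction w generalizing u with
  | nil => simp [Pi.single_apply]
  | cons a w ih =>
    rw [mult_cons]
    cases u with
    | nil =>
      have : slice₂ a (Pi.single ([], v) 1 : Series₂ ι K) = 0 := by ext; simp
      simp [this, Pi.single_apply]
    | cons b u =>
      by_cases h : a = b
      · subst h
        have : slice₂ a (Pi.single (a :: u, v) 1 : Series₂ ι K) = Pi.single (u, v) 1 := by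
          ext ⟨x, y⟩; simp [Pi.single_apply]
        rw [this, ih]; simp [Pi.single_apply]
      · have : slice₂ a (Pi.single (b :: u, v) 1 : Series₂ ι K) = 0 := by
          ext ⟨x, y⟩; simp [h]
        rw [this]; simp [h]

theorem conc_single (u v : List (Letter ι)) :
    conc (Pi.single u 1 : Series ι K) (Pi.single v 1) = Pi.single (u ++ v) 1 := by
  rw [conc, tmul_single, mult_single]

theorem one_conc (f : Series ι K) : conc (Pi.single [] 1) f = f := by
  ext w
  cases w with
  | nil => simp
  | cons a w =>
    have : slice a (Pi.single [] 1 : Series ι K) = 0 := by ext; simp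
    rw [conc_cons, this, ← concL_apply]; simp

theorem conc_one (f : Series ι K) : conc f (Pi.single [] 1) = f := by
  ext w
  induction w generalizing f with
  | nil => simp
  | cons a w ih => rw [conc_cons, ih]; simp

theorem letter_conc_cons (a : Letter ι) (f : Series ι K) (b w) :
    conc (letter K a) f (b :: w) = if b = a then f w else 0 := by
  rw [conc_cons]
  have : slice b (letter K a) = if b = a then Pi.single [] 1 else 0 := by
    ext w; split_ifs with h <;> simp [letter, Pi.single_apply, h]
  rw [this]
  split_ifs
  · simp [one_conc, letter]
  · simp [letter, ← concL_apply]

@[simp] theorem letter_conc_nil (a : Letter ι) (f : Series ι K) : conc (letter K a) f [] = 0 := by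
  simp [letter]

/-- A series all of whose words have total degree `n`. -/
def Homog (n : ℤ) (f : Series ι K) : Prop := ∀ w, f w ≠ 0 → totalDeg deg w = n

variable {deg}

theorem flipL_tmul {f g : Series ι K} {m n : ℤ} (hf : Homog deg m f)
    (hg : Homog deg n g) : flipL deg (tmul f g) = sgn K (m * n) • tmul g f := by
  ext ⟨u, v⟩
  rw [flipL_apply, Pi.smul_apply, smul_eq_mul]
  by_cases hu : g u = 0
  · simp [tmul, hu]
  by_cases hv : f v = 0
  · simp [tmul, hv]
  rw [hf v hv, hg u hu, mul_comm n]; simp [tmul, mul_comm]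

theorem bracket_of_homog {f g : Series ι K} {m n : ℤ} (hf : Homog deg m f) (hg : Homog deg n g) :
    bracket deg f g = conc f g - sgn K (m * n) • conc g f := by
  rw [bracket_eq, map_sub, flipL_tmul hf hg, map_smul]
  rfl

theorem Homog.conc {f g : Series ι K} {m n : ℤ} (hf : Homog deg m f) (hg : Homog deg n g) :
    Homog deg (m + n) (conc f g) := by
  intro w hw
  rw [Harrison.conc, mult_apply] at hw
  obtain ⟨k, -, hk⟩ := Finset.exists_ne_zero_of_sum_ne_zero hw
  rw [← List.take_append_drop k w, totalDeg_append, hf _ (left_ne_zero_of_mul hk),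
    hg _ (right_ne_zero_of_mul hk)]

theorem Homog.sub {f g : Series ι K} {n : ℤ} (hf : Homog deg n f) (hg : Homog deg n g) :
    Homog deg n (f - g) := by
  intro w hw
  by_cases h : f w = 0
  · exact hg w fun h' => hw (by simp [h, h'])
  · exact hf w h

theorem Homog.smul {f : Series ι K} {n : ℤ} (hf : Homog deg n f) (c : K) :
    Homog deg n (c • f) := fun w hw => hf w fun h => hw (by simp [h])

theorem Homog.bracket {f g : Series ι K} {m n : ℤ} (hf : Homog deg m f) (hg : Homog deg n g) :
    Homog deg (m + n) (bracket deg f g) := by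
  rw [bracket_of_homog hf hg]
  exact (hf.conc hg).sub ((add_comm m n ▸ hg.conc hf).smul _)

theorem homog_letter (a : Letter ι) : Homog deg (totalDeg deg [a]) (letter K a) := by
  intro w hw
  have : w = [a] := by by_contra h; simp [letter, h] at hw
  rw [this]

theorem IsLieMonomial.homog {f : Series ι K} (hf : IsLieMonomial K deg f) :
    ∃ n, Homog deg n f := by
  induction hf with
  | of a => exact ⟨_, homog_letter a⟩
  | bracket _ _ ihf ihg =>
    obtain ⟨m, hm⟩ := ihf
    obtain ⟨n, hn⟩ := ihg
    exact ⟨_, hm.bracket hn⟩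

theorem par_of_homog {f : Series ι K} {n : ℤ} (hf : Homog deg n f) : par deg f = sgn K n • f := by
  ext w
  rw [par_apply, Pi.smul_apply, smul_eq_mul]
  by_cases h : f w = 0
  · simp [h]
  · rw [hf w h]

/-- An additive weight on words is constant on each Lie monomial. -/
theorem IsLieMonomial.weight {M : Type*} [AddCommMonoid M] (φ : List (Letter ι) → M)
    (hφ : ∀ u v, φ (u ++ v) = φ u + φ v) {f : Series ι K} (hf : IsLieMonomial K deg f) :
    ∃ m, ∀ w, f w ≠ 0 → φ w = m := by
  induction hf with
  | of a =>
    refine ⟨φ [a], fun w hw => ?_⟩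
    have : w = [a] := by by_contra h; simp [letter, h] at hw
    rw [this]
  | @bracket f g hf hg ihf ihg =>
    obtain ⟨m, hm⟩ := ihf
    obtain ⟨n, hn⟩ := ihg
    refine ⟨m + n, fun w hw => ?_⟩
    rw [bracket_eq, mult_apply] at hw
    obtain ⟨k, -, hk⟩ := Finset.exists_ne_zero_of_sum_ne_zero hw
    rw [← List.take_append_drop k w, hφ]
    rw [Pi.sub_apply, flipL_apply] at hk
    by_cases h : tmul f g (w.take k, w.drop k) = 0
    · rw [h, zero_sub, neg_ne_zero] at hk
      have := right_ne_zero_of_mul hk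
      rw [hm _ (left_ne_zero_of_mul this), hn _ (right_ne_zero_of_mul this), add_comm]
    · rw [hm _ (left_ne_zero_of_mul h), hn _ (right_ne_zero_of_mul h)]

end Words

section Lie

variable {ι K : Type*} [CommRing K] {deg : ι → ℤ} [TopologicalSpace K] [DiscreteTopology K]

theorem IsLieMonomial.mem {K : Type*} [CommRing K] {f : Series ι K} (hf : IsLieMonomial K deg f) :
    f ∈ lieForms K deg := subset_closedSpan _ hf

theorem isClosed_lieForms : IsClosed (lieForms K deg : Set (Series ι K)) := isClosed_closedSpan _

theorem isClosed_lieForms₂ : IsClosed (lieForms₂ K deg : Set (Series₂ ι K)) :=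
  isClosed_closedSpan _

theorem isClosed_relations : IsClosed (relations K deg : Set (Series₂ ι K)) :=
  isClosed_closedSpan _

theorem tmul_mem {K : Type*} [CommRing K] {f g : Series ι K}
    (hf : f ∈ lieForms K deg) (hg : g ∈ lieForms K deg) :
    tmul f g ∈ lieForms₂ K deg := subset_closedSpan _ ⟨f, hf, g, hg, rfl⟩

/-- A continuous linear map on Lie series may be tested on Lie monomials. -/
theorem lieForms_induction {Y : Type*} {N : Submodule K (Y → K)} (hN : IsClosed (N : Set (Y → K)))
    (Φ : Series ι K →ₗ[K] (Y → K)) (hΦ : Continuous Φ)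
    (h : ∀ f, IsLieMonomial K deg f → Φ f ∈ N) {f : Series ι K} (hf : f ∈ lieForms K deg) :
    Φ f ∈ N := map_mem_of_mem_closedSpan hN Φ hΦ h hf

/-- A continuous linear map on the tensor square may be tested on tensors of Lie monomials. -/
theorem lieForms₂_induction {Y : Type*} {N : Submodule K (Y → K)} (hN : IsClosed (N : Set (Y → K)))
    (Φ : Series₂ ι K →ₗ[K] (Y → K)) (hΦ : Continuous Φ)
    (h : ∀ f g, IsLieMonomial K deg f → IsLieMonomial K deg g → Φ (tmul f g) ∈ N)
    {F : Series₂ ι K} (hF : F ∈ lieForms₂ K deg) : Φ F ∈ N := by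
  refine map_mem_of_mem_closedSpan hN Φ hΦ ?_ hF
  rintro _ ⟨f, hf, g, hg, rfl⟩
  refine lieForms_induction hN (Φ ∘ₗ tmulL.flip g) (hΦ.comp (continuous_tmul_left g)) ?_ hf
  intro f hf
  exact lieForms_induction hN (Φ ∘ₗ tmulL f) (hΦ.comp (continuous_tmul_right f))
    (fun g hg => h f g hf hg) hg

theorem bracket_mem {f g : Series ι K} (hf : f ∈ lieForms K deg) (hg : g ∈ lieForms K deg) :
    bracket deg f g ∈ lieForms K deg := by
  rw [← bracketL_apply]
  refine lieForms_induction isClosed_lieForms ((bracketL deg).flip g)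
    ((continuous_bracket_left deg g).congr fun f => (bracketL_apply deg f g).symm) (fun f hf => ?_) hf
  refine lieForms_induction isClosed_lieForms (bracketL deg f)
    ((continuous_bracket_right deg f).congr fun g => (bracketL_apply deg f g).symm) (fun g hg => ?_) hg
  rw [bracketL_apply]
  exact (IsLieMonomial.bracket hf hg).mem

theorem par_mem {f : Series ι K} (hf : f ∈ lieForms K deg) : par deg f ∈ lieForms K deg := by
  refine lieForms_induction isClosed_lieForms (par deg) (continuous_par deg) (fun f hf => ?_) hf
  obtain ⟨n, hn⟩ := hf.homog
  rw [par_of_homog hn]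
  exact Submodule.smul_mem _ _ hf.mem

theorem slice_left_mem {F : Series₂ ι K} (hF : F ∈ lieForms₂ K deg) (v) :
    (fun u => F (u, v)) ∈ lieForms K deg := by
  refine lieForms₂_induction isClosed_lieForms (LinearMap.funLeft K K fun u => (u, v))
    (by unfold LinearMap.funLeft; simp; fun_prop) (fun f g hf hg => ?_) hF
  have : (LinearMap.funLeft K K fun u => (u, v)) (tmul f g) = g v • f := by
    ext; simp [LinearMap.funLeft, tmul, mul_comm]
  rw [this]
  exact Submodule.smul_mem _ _ hf.mem

theorem slice_right_mem {F : Series₂ ι K} (hF : F ∈ lieForms₂ K deg) (u) :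
    (fun v => F (u, v)) ∈ lieForms K deg := by
  refine lieForms₂_induction isClosed_lieForms (LinearMap.funLeft K K fun v => (u, v))
    (by unfold LinearMap.funLeft; simp; fun_prop) (fun f g hf hg => ?_) hF
  have : (LinearMap.funLeft K K fun v => (u, v)) (tmul f g) = f u • g := by
    ext; simp [LinearMap.funLeft, tmul]
  rw [this]
  exact Submodule.smul_mem _ _ hg.mem

theorem lieForms_apply_nil {f : Series ι K} (hf : f ∈ lieForms K deg) : f [] = 0 := by
  have := lieForms_induction (Y := Unit) (N := ⊥) isClosed_bot
    (LinearMap.funLeft K K fun _ => []) (by unfold LinearMap.funLeft; simp; fun_prop)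
    (fun f hf => ?_) hf
  · simpa using congrFun this ()
  · ext
    simp only [LinearMap.funLeft_apply, Pi.zero_apply]
    cases hf with
    | of a => simp [letter]
    | bracket _ _ => simp [bracket_eq, flipL_apply]

/-- A tensor that is a sum of terms `a ⊗ X a`, with letters `a` and Lie series `X a`, lies in the
tensor square of the Lie series. -/
theorem mem_lieForms₂_of_letters {K : Type*} [CommRing K] {F : Series₂ ι K}
    (h0 : ∀ u v, u.length ≠ 1 → F (u, v) = 0)
    (h : ∀ a, (fun v => F ([a], v)) ∈ lieForms K deg) : F ∈ lieForms₂ K deg := by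
  intro s
  let A : Finset (Letter ι) := s.biUnion fun p => p.1.toFinset
  have hmem : ∑ a ∈ A, tmul (letter K a) (fun v => F ([a], v)) ∈ lieForms₂ K deg :=
    Submodule.sum_mem _ fun a _ => tmul_mem (IsLieMonomial.of a).mem (h a)
  obtain ⟨g, hg, hgs⟩ := hmem s
  refine ⟨g, hg, fun ⟨u, v⟩ hx => ?_⟩
  rw [hgs _ hx, Finset.sum_apply]
  by_cases hu : u.length = 1
  · obtain ⟨a, rfl⟩ := List.length_eq_one_iff.1 hu
    have ha : a ∈ A := Finset.mem_biUnion.2 ⟨_, hx, by simp⟩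
    rw [Finset.sum_eq_single_of_mem a ha]
    · simp [tmul, letter]
    · intro b _ hb; simp [tmul, letter, hb.symm]
  · rw [h0 u v hu]
    refine Finset.sum_eq_zero fun a _ => ?_
    have : u ≠ [a] := fun h => hu (by simp [h])
    simp [tmul, letter, this]

/-- Graded antisymmetric quadratic series are Lie series. -/
theorem mem_lieForms_of_antisymm [Algebra ℚ K] {f : Series ι K}
    (h0 : ∀ w, w.length ≠ 2 → f w = 0)
    (h : ∀ a c, f [c, a] = -(sgn K (totalDeg deg [a] * totalDeg deg [c]) * f [a, c])) :
    f ∈ lieForms K deg := by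
  let P : Series ι K →ₗ[K] Series ι K :=
    LinearMap.pi fun w => if w.length = 2 then LinearMap.proj w else 0
  have hP (f : Series ι K) (w) : P f w = if w.length = 2 then f w else 0 := by
    simp only [P, LinearMap.pi_apply]; split_ifs <;> rfl
  have hPc : Continuous P := continuous_pi fun w => by
    simp only [hP]; split_ifs <;> fun_prop
  have key : ∀ f, (P ∘ₗ (LinearMap.id - rot deg)) f ∈ lieForms K deg := by
    refine map_mem_of_single isClosed_lieForms _
      (hPc.comp (continuous_id.sub (continuous_rot deg))) fun x => ?_
    by_cases hx : x.length = 2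
    · obtain ⟨a, c, rfl⟩ := List.length_eq_two.1 hx
      convert (IsLieMonomial.bracket (K := K) (deg := deg) (.of a) (.of c)).mem
      rw [bracket_of_homog (homog_letter a) (homog_letter c), letter_eq, letter_eq, conc_single,
        conc_single]
      ext w
      rw [LinearMap.comp_apply, hP]
      split_ifs with hw
      · obtain ⟨e, e', rfl⟩ := List.length_eq_two.1 hw
        have := rot_append deg (Pi.single [a, c] 1 : Series ι K) [e] e'
        simp only [List.cons_append, List.nil_append] at this
        simp only [LinearMap.sub_apply, LinearMap.id_apply, Pi.sub_apply, Pi.smul_apply, this,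
          List.cons_append, List.nil_append, smul_eq_mul, Pi.single_apply, List.cons.injEq,
          and_true]
        by_cases h1 : e' = a ∧ e = c
        · simp [h1]
        · simp [h1, show ¬ (e = c ∧ e' = a) by tauto]
      · have h1 : w ≠ [a, c] := by rintro rfl; simp at hw
        have h2 : w ≠ [c, a] := by rintro rfl; simp at hw
        simp [h1, h2]
    · convert Submodule.zero_mem _
      ext w
      rw [LinearMap.comp_apply, hP]
      split_ifs with hw
      · obtain ⟨e, e', rfl⟩ := List.length_eq_two.1 hw
        have := rot_append deg (Pi.single x 1 : Series ι K) [e] e'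
        simp only [List.cons_append, List.nil_append] at this
        have h1 : [e, e'] ≠ x := by rintro rfl; simp at hx
        have h2 : [e', e] ≠ x := by rintro rfl; simp at hx
        simp [this, h1, h2]
      · rfl
  have : f = (2⁻¹ : ℚ) • (P ∘ₗ (LinearMap.id - rot deg)) f := by
    ext w
    rw [Pi.smul_apply, LinearMap.comp_apply, hP]
    split_ifs with hw
    · obtain ⟨e, e', rfl⟩ := List.length_eq_two.1 hw
      have h1 := rot_append deg f [e] e'
      simp only [List.cons_append, List.nil_append] at h1
      rw [LinearMap.sub_apply, Pi.sub_apply, h1, h e e', LinearMap.id_apply, mul_neg, ← mul_assoc,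
        mul_comm (totalDeg deg [e']), sgn_mul_self, one_mul, sub_neg_eq_add, ← two_smul ℚ (f _),
        smul_smul]
      simp
    · rw [h0 w hw]; simp
  rw [this]
  exact Submodule.smul_of_tower_mem _ _ (key f)

end Lie

/-! ### Odd derivations of the Lie forms -/

section LieDer

variable {ι K : Type*} [CommRing K] {deg : ι → ℤ}
  {ξ : List (Letter ι) → Letter ι →₀ K}

theorem oddDer_one (hξ : LinQuad ξ) : oddDer deg ξ (Pi.single [] 1) = 0 := by
  have hc (x w) : contr ξ x (Pi.single [] 1 : Series ι K) w = 0 := by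
    simp [contr_apply]
  have hs (a) : slice a (Pi.single [] 1 : Series ι K) = 0 := by ext; simp
  ext w
  match w with
  | [] => simp [oddDer_nil deg hξ]
  | [a] => simp [oddDer_singleton deg hξ, hc]
  | a :: c :: w => simp [oddDer_cons_cons deg hξ, hc, hs]

theorem oddDer_letter (hξ : LinQuad ξ) (a : Letter ι) :
    oddDer deg ξ (letter K a) = fun w => ξ w a := by
  have hc (x) : contr ξ x (letter K a) [] = ξ x a := by
    simp only [contr_apply, letter, List.cons.injEq, and_true, mul_ite, mul_one, mul_zero]
    rw [Finset.sum_ite_eq']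
    split_ifs with h
    · rfl
    · simpa using (Finsupp.notMem_support_iff.1 h).symm
  have hc' (x c w) : contr ξ x (letter K a) (c :: w) = 0 := by
    simp [contr_apply, letter]
  ext w
  match w with
  | [] => simp [oddDer_nil deg hξ, hξ [] (by simp) (by simp)]
  | [b] => simp [oddDer_singleton deg hξ, hc]
  | b :: c :: w =>
    have hs : slice b (letter K a) = if b = a then Pi.single [] 1 else 0 := by
      ext w; split_ifs with h <;> simp [letter, Pi.single_apply, h]
    have hz : oddDer deg ξ (slice b (letter K a)) = 0 := by
      rw [hs]; split_ifs <;> simp [oddDer_one hξ]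
    rw [oddDer_cons_cons deg hξ, hz, hc']
    cases w with
    | nil => simp [hc]
    | cons e w => rw [hc', hξ (b :: c :: e :: w) (by simp) (by simp)]; simp

variable (deg ξ) in
/-- The coefficients of an odd derivation of the pro-free Lie algebra. -/
structure IsLieDer : Prop where
  linQuad : LinQuad ξ
  odd : OddCoeff deg ξ
  mem : ∀ a, (fun w => ξ w a) ∈ lieForms K deg

variable [TopologicalSpace K] [DiscreteTopology K]

theorem oddDer_mem (hξ : IsLieDer deg ξ) {f : Series ι K} (hf : f ∈ lieForms K deg) :
    oddDer deg ξ f ∈ lieForms K deg := by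
  refine lieForms_induction isClosed_lieForms (oddDer deg ξ) (continuous_oddDer deg ξ)
    (fun f hf => ?_) hf
  induction hf with
  | of a => rw [oddDer_letter hξ.linQuad]; exact hξ.mem a
  | bracket hf hg ihf ihg =>
    rw [oddDer_bracket hξ.linQuad hξ.odd]
    exact Submodule.add_mem _ (bracket_mem ihf hg.mem) (bracket_mem (par_mem hf.mem) ihg)

theorem oddDer₂_mem (hξ : IsLieDer deg ξ) {F : Series₂ ι K} (hF : F ∈ lieForms₂ K deg) :
    oddDer₂ deg ξ F ∈ lieForms₂ K deg := by
  refine lieForms₂_induction isClosed_lieForms₂ (oddDer₂ deg ξ) (continuous_oddDer₂ deg ξ)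
    (fun f g hf hg => ?_) hF
  rw [oddDer₂_tmul]
  exact Submodule.add_mem _ (tmul_mem (oddDer_mem hξ hf.mem) hg.mem)
    (tmul_mem (par_mem hf.mem) (oddDer_mem hξ hg.mem))

theorem symm_mem_relations {K : Type*} [CommRing K] {f g : Series ι K} (hf : f ∈ lieForms K deg)
    (hg : g ∈ lieForms K deg) :
    tmul f g - flipL deg (tmul f g) ∈ relations K deg :=
  subset_closedSpan _ (Or.inl ⟨f, hf, g, hg, rfl⟩)

theorem invariance_mem_relations {K : Type*} [CommRing K] {f g h : Series ι K}
    (hf : f ∈ lieForms K deg)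
    (hg : g ∈ lieForms K deg) (hh : h ∈ lieForms K deg) :
    tmul f (bracket deg g h) - tmul (bracket deg f g) h ∈ relations K deg :=
  subset_closedSpan _ (Or.inr ⟨f, hf, g, hg, h, hh, rfl⟩)

theorem oddDer₂_mem_relations (hξ : IsLieDer deg ξ) {F : Series₂ ι K}
    (hF : F ∈ relations K deg) : oddDer₂ deg ξ F ∈ relations K deg := by
  have hc := oddDer_bracket hξ.linQuad hξ.odd
  refine map_mem_of_mem_closedSpan isClosed_relations (oddDer₂ deg ξ) (continuous_oddDer₂ deg ξ)
    ?_ hF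
  rintro _ (⟨f, hf, g, hg, rfl⟩ | ⟨f, hf, g, hg, h, hh, rfl⟩)
  · rw [flip_eq, map_sub, ← flipL_oddDer₂ hξ.odd, oddDer₂_tmul, map_add, add_sub_add_comm]
    exact Submodule.add_mem _ (symm_mem_relations (oddDer_mem hξ hf) hg)
      (symm_mem_relations (par_mem hf) (oddDer_mem hξ hg))
  · have hp : par deg (bracket deg f g) = bracket deg (par deg f) (par deg g) := by
      ext w
      rw [par_apply, bracket_eq, bracket_eq, mult_apply, mult_apply, Finset.mul_sum]
      refine Finset.sum_congr rfl fun k _ => ?_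
      have : totalDeg deg w = totalDeg deg (w.take k) + totalDeg deg (w.drop k) := by
        rw [← totalDeg_append, List.take_append_drop]
      rw [this, sgn_add]
      simp only [Pi.sub_apply, flipL_apply, tmul, par_apply]
      ring
    have h1 := invariance_mem_relations (oddDer_mem hξ hf) hg hh
    have h2 := invariance_mem_relations (par_mem hf) (oddDer_mem hξ hg) hh
    have h3 := invariance_mem_relations (par_mem hf) (par_mem hg) (oddDer_mem hξ hh)
    convert Submodule.add_mem _ (Submodule.add_mem _ h1 h2) h3 using 1
    rw [map_sub, oddDer₂_tmul, oddDer₂_tmul, hc, hc, hp]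
    simp only [← tmulL_apply, map_add, LinearMap.add_apply]
    abel

end LieDer

/-! ### The cyclic trace and the normal form of one-forms -/

section Trace

variable {ι K : Type*} [CommRing K] (deg : ι → ℤ)

/-- A rotation does not change the length of words. -/
theorem rot_pow_eq_zero {f : Series ι K} {n : ℕ} (h : ∀ w, w.length = n → f w = 0) (r : ℕ) :
    ∀ w, w.length = n → (rot deg ^ r) f w = 0 := by
  induction r with
  | zero => exact h
  | succ r ih =>
    intro w hw
    rw [pow_succ', Module.End.mul_apply]
    induction w using List.reverseRecOn with
    | nil => rw [rot_nil]; exact ih _ hw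
    | append_singleton u c _ =>
      rw [rot_append, ih _ (by simpa using hw), mul_zero]

theorem single_append_eq (u v : List (Letter ι)) :
    (Pi.single (u ++ v) 1 : Series ι K) = sgn K (totalDeg deg u * totalDeg deg v) •
      (rot deg ^ v.length) (Pi.single (v ++ u) 1) := by
  ext w
  rw [Pi.smul_apply, smul_eq_mul]
  by_cases hw : w.length = u.length + v.length
  · obtain ⟨w₁, w₂, rfl, h1, h2⟩ : ∃ w₁ w₂, w = w₁ ++ w₂ ∧ w₁.length = u.length ∧
        w₂.length = v.length :=
      ⟨w.take u.length, w.drop u.length, by simp, by simp; omega, by simp; omega⟩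
    have := rot_pow_append deg (Pi.single (v ++ u) 1 : Series ι K) w₂ w₁
    rw [h2] at this
    rw [this, Pi.single_apply, Pi.single_apply]
    by_cases h : w₁ = u ∧ w₂ = v
    · obtain ⟨rfl, rfl⟩ := h
      simp [sgn_mul_self]
    · rw [if_neg fun h' => h (List.append_inj h' h1),
        if_neg fun h' => h (List.append_inj h' h2).symm]
      simp
  · rw [rot_pow_eq_zero deg (n := w.length) _ _ _ rfl, mul_zero, Pi.single_apply, if_neg]
    · rintro rfl; simp at hw
    · intro w' hw'
      rw [Pi.single_apply, if_neg]
      rintro rfl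
      simp at hw'; omega

theorem cyc_mult_flipL [TopologicalSpace K] [DiscreteTopology K] (F : Series₂ ι K) :
    cyc deg (mult (flipL deg F)) = cyc deg (mult F) := by
  refine eq_of_single (cyc deg ∘ₗ mult ∘ₗ flipL deg) (cyc deg ∘ₗ mult)
    ((continuous_cyc deg).comp (continuous_mult.comp (continuous_flipL deg)))
    ((continuous_cyc deg).comp continuous_mult) (fun ⟨u, v⟩ => ?_) F
  have : flipL deg (Pi.single (u, v) 1 : Series₂ ι K) =
      sgn K (totalDeg deg u * totalDeg deg v) • Pi.single (v, u) 1 := by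
    ext ⟨x, y⟩
    rw [flipL_apply, Pi.smul_apply, smul_eq_mul, Pi.single_apply, Pi.single_apply]
    by_cases h : x = v ∧ y = u
    · obtain ⟨rfl, rfl⟩ := h
      simp [mul_comm]
    · rw [if_neg (by simpa [and_comm] using h), if_neg (by simpa using h)]; simp
  rw [LinearMap.comp_apply, LinearMap.comp_apply, LinearMap.comp_apply, this, map_smul, map_smul,
    mult_single, mult_single, single_append_eq deg u v, map_smul, cyc_rot_pow]

variable {deg} [TopologicalSpace K] [DiscreteTopology K]

theorem cyc_conc {f g : Series ι K} {m n : ℤ} (hf : Homog deg m f) (hg : Homog deg n g) :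
    cyc deg (conc f g) = sgn K (m * n) • cyc deg (conc g f) := by
  rw [conc, ← cyc_mult_flipL, flipL_tmul hf hg, map_smul, map_smul]; rfl

/-- The cyclic trace `x ⊗ y ↦ N (x y)` vanishes on the relations of the Lie de Rham complex. -/
theorem trace_relations {F : Series₂ ι K} (hF : F ∈ relations K deg) :
    cyc deg (mult F) = 0 := by
  have hΦ : Continuous (cyc deg ∘ₗ (mult : Series₂ ι K →ₗ[K] Series ι K)) :=
    (continuous_cyc deg).comp continuous_mult
  suffices (cyc deg ∘ₗ mult) F ∈ (⊥ : Submodule K (Series ι K)) by simpa using this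
  refine map_mem_of_mem_closedSpan isClosed_bot _ hΦ ?_ hF
  rintro _ (⟨f, hf, g, hg, rfl⟩ | ⟨f, hf, g, hg, h, hh, rfl⟩)
  · simp [flip_eq, cyc_mult_flipL]
  · have hl (g : Series ι K) : Continuous (tmulL (K := K) g) := continuous_tmul_right g
    have hr (g : Series ι K) : Continuous (tmulL.flip (R := K) g) := continuous_tmul_left g
    have hbl (g : Series ι K) : Continuous ((bracketL deg).flip g) :=
      (continuous_bracket_left deg g).congr fun f => (bracketL_apply deg f g).symm
    have hbr (f : Series ι K) : Continuous (bracketL deg f) :=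
      (continuous_bracket_right deg f).congr fun g => (bracketL_apply deg f g).symm
    rw [← bracketL_apply, ← bracketL_apply]
    refine lieForms_induction isClosed_bot ((cyc deg ∘ₗ mult) ∘ₗ
      (tmulL.flip (bracketL deg g h) - tmulL.flip h ∘ₗ (bracketL deg).flip g))
      (hΦ.comp ((hr _).sub ((hr h).comp (hbl g)))) (fun f hf => ?_) hf
    refine lieForms_induction isClosed_bot ((cyc deg ∘ₗ mult) ∘ₗ
      (tmulL f ∘ₗ (bracketL deg).flip h - tmulL.flip h ∘ₗ (bracketL deg f)))
      (hΦ.comp (((hl f).comp (hbl h)).sub ((hr h).comp (hbr f)))) (fun g hg => ?_) hg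
    refine lieForms_induction isClosed_bot ((cyc deg ∘ₗ mult) ∘ₗ
      (tmulL f ∘ₗ (bracketL deg g) - tmulL (bracketL deg f g)))
      (hΦ.comp (((hl f).comp (hbr g)).sub (hl _))) (fun h hh => ?_) hh
    obtain ⟨m, hm⟩ := hf.homog
    obtain ⟨n, hn⟩ := hg.homog
    obtain ⟨p, hp⟩ := hh.homog
    have h1 : mult ((tmulL f ∘ₗ (bracketL deg g) - tmulL (bracketL deg f g)) h) =
        sgn K (m * n) • conc g (conc f h) - sgn K (n * p) • conc (conc f h) g := by
      simp only [LinearMap.sub_apply, LinearMap.comp_apply, bracketL_apply,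
        bracket_of_homog hn hp, bracket_of_homog hm hn, tmulL_apply, map_sub, map_smul]
      rw [show mult (tmul f (conc g h)) = conc (conc f g) h from (conc_assoc _ _ _).symm,
        show mult (tmul f (conc h g)) = conc (conc f h) g from (conc_assoc _ _ _).symm,
        LinearMap.smul_apply, map_smul, tmulL_apply,
        show mult (tmul (conc f g) h) = conc (conc f g) h from rfl,
        show mult (tmul (conc g f) h) = conc g (conc f h) from conc_assoc _ _ _]
      abel
    rw [LinearMap.comp_apply, LinearMap.comp_apply, h1, map_sub, map_smul, map_smul,
      cyc_conc hn (hm.conc hp), smul_smul, ← sgn_add]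
    have : sgn K (m * n + n * (m + p)) = sgn K (n * p) := by
      refine sgn_congr ?_
      simp only [Int.even_sub, Int.even_add, Int.even_mul]; tauto
    simp [this]

end Trace

section OneForms

variable {ι K : Type*} [CommRing K] (deg : ι → ℤ)

/-- Replacing a letter `d(t k)` at the front of a word by `t k`. -/
def undiff : Series ι K →ₗ[K] Series ι K :=
  LinearMap.pi fun w => match w with
    | (k, false) :: u => LinearMap.proj ((k, true) :: u)
    | _ => 0

@[simp] theorem undiff_nil (f : Series ι K) : undiff f [] = 0 := rfl
@[simp] theorem undiff_true (f : Series ι K) (k u) : undiff f ((k, true) :: u) = 0 := rfl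
@[simp] theorem undiff_false (f : Series ι K) (k u) :
    undiff f ((k, false) :: u) = f ((k, true) :: u) := rfl

theorem continuous_undiff [TopologicalSpace K] [DiscreteTopology K] :
    Continuous (undiff : Series ι K →ₗ[K] Series ι K) := by
  refine continuous_pi fun w => ?_
  match w with
  | [] => simp only [undiff_nil]; fun_prop
  | (k, true) :: u => simp only [undiff_true]; fun_prop
  | (k, false) :: u => simp only [undiff_false]; fun_prop

/-- The normal form of a one-form: `F` is equivalent to `∑ k, d(t k) ⊗ X k` for unique Lie series
`X k` in the letters `t k`, and the normal form is `∑ k, (t k) (X k)`. The coefficient of `X k` at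
`u` is the coefficient of `d(t k) u` in the cyclic trace of `F`. -/
def normalForm : Series₂ ι K →ₗ[K] Series ι K := undiff ∘ₗ cyc deg ∘ₗ mult

theorem continuous_normalForm [TopologicalSpace K] [DiscreteTopology K] :
    Continuous (normalForm deg : Series₂ ι K →ₗ[K] Series ι K) :=
  continuous_undiff.comp ((continuous_cyc deg).comp continuous_mult)

/-- The one-form `∑ k, d(t k) ⊗ X k` with the normal form `∑ k, (t k) (X k)`. -/
def ofNormalForm : Series ι K →ₗ[K] Series₂ ι K :=
  LinearMap.pi fun p => match p.1 with
    | [(k, true)] => LinearMap.proj ((k, false) :: p.2)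
    | _ => 0

theorem ofNormalForm_true (g : Series ι K) (k v) :
    ofNormalForm g ([(k, true)], v) = g ((k, false) :: v) := rfl

theorem ofNormalForm_eq_zero (g : Series ι K) {u} (hu : ∀ k, u ≠ [(k, true)]) (v) :
    ofNormalForm g (u, v) = 0 := by
  match u with
  | [] => rfl
  | [(k, true)] => exact absurd rfl (hu k)
  | [(k, false)] => rfl
  | (k, true) :: b :: u => rfl
  | (k, false) :: b :: u => rfl

theorem continuous_ofNormalForm [TopologicalSpace K] [DiscreteTopology K] :
    Continuous (ofNormalForm : Series ι K →ₗ[K] Series₂ ι K) := by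
  refine continuous_pi fun ⟨u, v⟩ => ?_
  by_cases h : ∃ k, u = [(k, true)]
  · obtain ⟨k, rfl⟩ := h
    simp only [ofNormalForm_true]; fun_prop
  · push Not at h
    simp only [ofNormalForm_eq_zero _ h]; fun_prop

/-- A series without constant term in the letters `t k` only. -/
structure Pure (g : Series ι K) : Prop where
  nil : g [] = 0
  formDeg : ∀ w, g w ≠ 0 → formDeg w = 0

theorem mult_of_left_nil {F : Series₂ ι K} (h : ∀ u v, u ≠ [] → F (u, v) = 0) (w) :
    mult F w = F ([], w) := by
  cases w with
  | nil => simp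
  | cons a w =>
    have : slice₂ a F = 0 := by ext p; exact h _ _ (by simp)
    simp [mult_cons, this]

theorem mult_ofNormalForm_true (g : Series ι K) (k u) :
    mult (ofNormalForm g) ((k, true) :: u) = g ((k, false) :: u) := by
  rw [mult_cons, ofNormalForm_eq_zero _ (by simp), zero_add, mult_of_left_nil]
  · rfl
  · intro u v hu
    exact ofNormalForm_eq_zero _ (by simpa using hu) _

theorem mult_ofNormalForm_false (g : Series ι K) (k u) :
    mult (ofNormalForm g) ((k, false) :: u) = 0 := by
  rw [mult_cons, ofNormalForm_eq_zero _ (by simp), zero_add]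
  have : slice₂ (k, false) (ofNormalForm g) = 0 := by
    ext p; exact ofNormalForm_eq_zero _ (u := (k, false) :: p.1) (by simp) p.2
  simp [this]

theorem formDeg_append (u v : List (Letter ι)) : formDeg (u ++ v) = formDeg u + formDeg v :=
  List.countP_append

theorem formDeg_cons_true (k : ι) (u) : formDeg ((k, true) :: u) = formDeg u + 1 := by
  simp [formDeg]

theorem formDeg_cons_false (k : ι) (u) : formDeg ((k, false) :: u) = formDeg u := by
  simp [formDeg]

theorem cyc_cons (f : Series ι K) (a u) :
    cyc deg f (a :: u) = f (a :: u) + ∑ r ∈ Finset.range u.length,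
      sgn K (totalDeg deg (a :: u.take (u.length - (r + 1))) *
        totalDeg deg (u.drop (u.length - (r + 1)))) *
        f (u.drop (u.length - (r + 1)) ++ a :: u.take (u.length - (r + 1))) := by
  rw [cyc_apply, List.length_cons, Finset.sum_range_succ', add_comm]
  congr 1
  refine Finset.sum_congr rfl fun r hr => ?_
  have h := rot_pow_append deg f (u.drop (u.length - (r + 1))) (a :: u.take (u.length - (r + 1)))
  have hl : (u.drop (u.length - (r + 1))).length = r + 1 := by
    have := Finset.mem_range.1 hr
    simp; omega
  rw [hl, List.cons_append, List.take_append_drop] at h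
  rw [h]

theorem normalForm_ofNormalForm {g : Series ι K} (hg : Pure g) :
    normalForm deg (ofNormalForm g) = g := by
  ext w
  match w with
  | [] => simp [normalForm, hg.nil]
  | (k, true) :: u =>
    refine Eq.symm ?_
    by_contra h
    have := hg.formDeg _ h
    simp [formDeg_cons_true] at this
  | (k, false) :: u =>
    rw [normalForm, LinearMap.comp_apply, undiff_false, LinearMap.comp_apply, cyc_cons,
      mult_ofNormalForm_true, Finset.sum_eq_zero, add_zero]
    intro r hr
    -- a nontrivial rotation moves `d(t k)` away from the front, where `d` is required
    have hl : (u.drop (u.length - (r + 1))) ≠ [] := by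
      have := Finset.mem_range.1 hr
      simp; omega
    obtain ⟨c, v, hv⟩ := List.exists_cons_of_ne_nil hl
    rw [hv]
    obtain ⟨l, _ | _⟩ := c
    · rw [List.cons_append, mult_ofNormalForm_false, mul_zero]
    · rw [List.cons_append, mult_ofNormalForm_true]
      by_contra h
      have := hg.formDeg _ (right_ne_zero_of_mul h)
      simp [formDeg_cons_false, formDeg_append, formDeg_cons_true] at this

/-- The projection to form degree one. -/
def projOne : Series₂ ι K →ₗ[K] Series₂ ι K :=
  LinearMap.pi fun p => if formDeg p.1 + formDeg p.2 = 1 then LinearMap.proj p else 0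

theorem projOne_apply (F : Series₂ ι K) (p) :
    projOne F p = if formDeg p.1 + formDeg p.2 = 1 then F p else 0 := by
  simp only [projOne, LinearMap.pi_apply]; split_ifs <;> rfl

theorem continuous_projOne [TopologicalSpace K] [DiscreteTopology K] :
    Continuous (projOne : Series₂ ι K →ₗ[K] Series₂ ι K) := by
  refine continuous_pi fun p => ?_
  simp only [projOne_apply]
  split_ifs <;> fun_prop

variable {deg}

theorem exists_bracket_eq_smul {f g : Series ι K} (hf : IsLieMonomial K deg f)
    (hg : IsLieMonomial K deg g) : ∃ c : K, bracket deg f g = c • bracket deg g f := by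
  obtain ⟨m, hm⟩ := hf.homog
  obtain ⟨n, hn⟩ := hg.homog
  refine ⟨-sgn K (m * n), ?_⟩
  rw [bracket_of_homog hm hn, bracket_of_homog hn hm, smul_sub, smul_smul, neg_mul,
    mul_comm n m, sgn_mul_self, neg_smul, neg_smul]
  module

/-- By invariance a Lie one-form can be moved off its letter `d(t k)`. -/
theorem exists_normal_monomial {f : Series ι K} (hf : IsLieMonomial K deg f)
    (hf1 : ∀ w, f w ≠ 0 → formDeg w = 1) {g : Series ι K} (hg : IsLieMonomial K deg g)
    (hg0 : ∀ w, g w ≠ 0 → formDeg w = 0) :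
    tmul f g ∈ relations K deg ∨ ∃ (k : ι) (c : K) (h : Series ι K), IsLieMonomial K deg h ∧
      (∀ w, h w ≠ 0 → formDeg w = 0) ∧
      tmul f g - c • tmul (letter K (k, true)) h ∈ relations K deg := by
  have hw {f g : Series ι K} {m n : ℕ} (hf : ∀ w, f w ≠ 0 → formDeg w = m)
      (hg : ∀ w, g w ≠ 0 → formDeg w = n) :
      ∀ w, bracket deg f g w ≠ 0 → formDeg w = m + n := by
    intro w hw
    rw [bracket_eq, mult_apply] at hw
    obtain ⟨k, -, hk⟩ := Finset.exists_ne_zero_of_sum_ne_zero hw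
    rw [← List.take_append_drop k w, formDeg_append]
    rw [Pi.sub_apply, flipL_apply] at hk
    by_cases h : tmul f g (w.take k, w.drop k) = 0
    · rw [h, zero_sub, neg_ne_zero] at hk
      have := right_ne_zero_of_mul hk
      rw [hf _ (left_ne_zero_of_mul this), hg _ (right_ne_zero_of_mul this), add_comm]
    · rw [hf _ (left_ne_zero_of_mul h), hg _ (right_ne_zero_of_mul h)]
  have key {f₁ f₂ g : Series ι K} (h₁ : IsLieMonomial K deg f₁) (h₂ : IsLieMonomial K deg f₂)
      (h₂0 : ∀ w, f₂ w ≠ 0 → formDeg w = 0)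
      (ih : ∀ {g : Series ι K}, IsLieMonomial K deg g → (∀ w, g w ≠ 0 → formDeg w = 0) →
        tmul f₁ g ∈ relations K deg ∨ ∃ (k : ι) (c : K) (h : Series ι K), IsLieMonomial K deg h ∧
          (∀ w, h w ≠ 0 → formDeg w = 0) ∧
          tmul f₁ g - c • tmul (letter K (k, true)) h ∈ relations K deg)
      (hg : IsLieMonomial K deg g) (hg0 : ∀ w, g w ≠ 0 → formDeg w = 0) :
      tmul (bracket deg f₁ f₂) g ∈ relations K deg ∨ ∃ (k : ι) (c : K) (h : Series ι K),
        IsLieMonomial K deg h ∧ (∀ w, h w ≠ 0 → formDeg w = 0) ∧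
          tmul (bracket deg f₁ f₂) g - c • tmul (letter K (k, true)) h ∈ relations K deg := by
    have h3 := invariance_mem_relations h₁.mem h₂.mem hg.mem
    rcases ih (.bracket h₂ hg) (hw h₂0 hg0) with h | ⟨k, c, h, h4, h5, h6⟩
    · left; simpa using Submodule.sub_mem _ h h3
    · exact Or.inr ⟨k, c, h, h4, h5, by
        convert Submodule.sub_mem _ h6 h3 using 1; abel⟩
  induction hf generalizing g with
  | of a =>
    obtain ⟨k, _ | _⟩ := a
    · have := hf1 [(k, false)]
      left
      by_cases h1 : (1 : K) = 0
      · have : tmul (letter K (k, false)) g = 0 := by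
          ext; rw [← one_mul (tmul _ _ _), h1]; simp
        rw [this]; exact Submodule.zero_mem _
      · simp [letter, formDeg, h1] at this
    · exact Or.inr ⟨k, 1, g, hg, hg0, by simp⟩
  | @bracket f₁ f₂ h₁ h₂ ih₁ ih₂ =>
    obtain ⟨m, hm⟩ := h₁.weight formDeg formDeg_append
    obtain ⟨n, hn⟩ := h₂.weight formDeg formDeg_append
    by_cases h0 : bracket deg f₁ f₂ = 0
    · left
      rw [h0, ← tmulL_apply]; simp
    obtain ⟨w, hw0⟩ := Function.ne_iff.1 h0
    have hmn := (hw hm hn w hw0).symm.trans (hf1 w hw0)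
    obtain ⟨rfl, rfl⟩ | ⟨rfl, rfl⟩ : m = 1 ∧ n = 0 ∨ m = 0 ∧ n = 1 := by omega
    · exact key h₁ h₂ hn (ih₁ hm) hg hg0
    · obtain ⟨c, hc⟩ := exists_bracket_eq_smul h₁ h₂
      have h7 : tmul (bracket deg f₁ f₂) g = c • tmul (bracket deg f₂ f₁) g := by
        rw [hc, ← tmulL_apply, map_smul]; rfl
      rw [h7]
      rcases key h₂ h₁ hm (ih₂ hn) hg hg0 with h | ⟨k, c', h, h4, h5, h6⟩
      · exact Or.inl (Submodule.smul_mem _ _ h)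
      · refine Or.inr ⟨k, c * c', h, h4, h5, ?_⟩
        rw [mul_smul, ← smul_sub]
        exact Submodule.smul_mem _ _ h6

variable [TopologicalSpace K] [DiscreteTopology K]

theorem normalForm_relations {F : Series₂ ι K} (hF : F ∈ relations K deg) :
    normalForm deg F = 0 := by
  rw [normalForm, LinearMap.comp_apply, LinearMap.comp_apply, trace_relations hF, map_zero]

theorem normalForm_monomial {f g : Series ι K} (hf : IsLieMonomial K deg f)
    (hg : IsLieMonomial K deg g) :
    (∀ a, slice a (normalForm deg (projOne (tmul f g))) ∈ lieForms K deg) ∧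
      projOne (tmul f g) - ofNormalForm (normalForm deg (projOne (tmul f g))) ∈
        relations K deg := by
  -- it suffices to treat a one-form times a zero-form
  have key {f g : Series ι K} (hf : IsLieMonomial K deg f)
      (hf1 : ∀ w, f w ≠ 0 → formDeg w = 1) (hg : IsLieMonomial K deg g)
      (hg0 : ∀ w, g w ≠ 0 → formDeg w = 0) :
      (∀ a, slice a (normalForm deg (tmul f g)) ∈ lieForms K deg) ∧
      tmul f g - ofNormalForm (normalForm deg (tmul f g)) ∈ relations K deg := by
    rcases exists_normal_monomial hf hf1 hg hg0 with h | ⟨k, c, h, hh, hh0, h1⟩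
    · simpa [normalForm_relations h] using h
    · have h2 : tmul (letter K (k, true)) h =
          ofNormalForm (conc (letter K (k, false)) h) := by
        ext ⟨u, v⟩
        by_cases hu : ∃ l, u = [(l, true)]
        · obtain ⟨l, rfl⟩ := hu
          rw [ofNormalForm_true, letter_conc_cons]
          simp [tmul, letter]
        · push Not at hu
          rw [ofNormalForm_eq_zero _ hu]
          simp [tmul, letter, hu k]
      have h3 : Pure (conc (letter K (k, false)) h) := by
        refine ⟨by simp [letter], fun w hw => ?_⟩
        cases w with
        | nil => simp [letter] at hw
        | cons b w =>
          rw [letter_conc_cons] at hw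
          split_ifs at hw with hb
          · rw [hb, formDeg_cons_false]; exact hh0 _ hw
          · exact absurd rfl hw
      have h4 : normalForm deg (tmul f g) = c • conc (letter K (k, false)) h := by
        have := normalForm_relations h1
        rw [map_sub, map_smul, h2, normalForm_ofNormalForm deg h3, sub_eq_zero] at this
        exact this
      refine ⟨fun a => ?_, ?_⟩
      · rw [h4, map_smul]
        refine Submodule.smul_mem _ _ ?_
        have : slice a (conc (letter K (k, false)) h) = if a = (k, false) then h else 0 := by
          ext w; rw [slice_apply, letter_conc_cons]; split_ifs <;> rfl
        rw [this]
        split_ifs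
        · exact hh.mem
        · exact Submodule.zero_mem _
      · rw [h4, map_smul, ← h2]; exact h1
  obtain ⟨m, hm⟩ := hf.weight formDeg formDeg_append
  obtain ⟨n, hn⟩ := hg.weight formDeg formDeg_append
  by_cases hmn : m + n = 1
  · have h1 : projOne (tmul f g) = tmul f g := by
      ext ⟨u, v⟩
      rw [projOne_apply]
      split_ifs with h
      · rfl
      · by_contra h0
        have := Ne.symm h0
        exact h (by rw [hm _ (left_ne_zero_of_mul this), hn _ (right_ne_zero_of_mul this), hmn])
    rw [h1]
    obtain ⟨rfl, rfl⟩ | ⟨rfl, rfl⟩ : m = 1 ∧ n = 0 ∨ m = 0 ∧ n = 1 := by omega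
    · exact key hf hm hg hn
    · obtain ⟨p, hp⟩ := hf.homog
      obtain ⟨q, hq⟩ := hg.homog
      have h2 := symm_mem_relations hf.mem hg.mem
      rw [flipL_tmul hp hq] at h2
      have h3 := key hg hn hf hm
      have h4 : normalForm deg (tmul f g) = sgn K (p * q) • normalForm deg (tmul g f) := by
        have := normalForm_relations h2
        rwa [map_sub, map_smul, sub_eq_zero] at this
      rw [h4]
      refine ⟨fun a => ?_, ?_⟩
      · rw [map_smul]; exact Submodule.smul_mem _ _ (h3.1 a)
      · convert Submodule.add_mem _ h2 (Submodule.smul_mem _ (sgn K (p * q)) h3.2) using 1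
        rw [map_smul, smul_sub]; abel
  · have h1 : projOne (tmul f g) = 0 := by
      ext ⟨u, v⟩
      rw [projOne_apply]
      split_ifs with h
      · by_contra h0
        refine hmn ?_
        rw [← hm _ (left_ne_zero_of_mul h0), ← hn _ (right_ne_zero_of_mul h0), h]
      · rfl
    simp [h1]

/-- Every one-form is equivalent to its normal form, whose coefficients are Lie series. -/
theorem normalForm_spec {F : Series₂ ι K} (hF : F ∈ lieForms₂ K deg)
    (h1 : ∀ u v, F (u, v) ≠ 0 → formDeg u + formDeg v = 1) :
    (∀ a, slice a (normalForm deg F) ∈ lieForms K deg) ∧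
      F - ofNormalForm (normalForm deg F) ∈ relations K deg := by
  have hp : projOne F = F := by
    ext ⟨u, v⟩
    rw [projOne_apply]
    split_ifs with h
    · rfl
    · by_contra h0; exact h (h1 u v (Ne.symm h0))
  have hc := (continuous_normalForm (K := K) deg).comp continuous_projOne
  constructor
  · intro a
    have := lieForms₂_induction isClosed_lieForms (slice a ∘ₗ normalForm deg ∘ₗ projOne)
      ((by unfold slice LinearMap.funLeft; simp; fun_prop : Continuous (slice a)).comp hc)
      (fun f g hf hg => (normalForm_monomial hf hg).1 a) hF
    simpa [hp] using this
  · have := lieForms₂_induction isClosed_relations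
      (projOne - ofNormalForm ∘ₗ normalForm deg ∘ₗ projOne)
      (continuous_projOne.sub (continuous_ofNormalForm.comp hc))
      (fun f g hf hg => (normalForm_monomial hf hg).2) hF
    simpa [hp] using this

end OneForms

/-! ### The de Rham differential, the Euler contraction and the Lie operator -/

section Anticommutator

variable {ι K : Type*} [CommRing K] {deg : ι → ℤ} {ξ η : List (Letter ι) → Letter ι →₀ K}

theorem contr_eq (x : List (Letter ι)) (f : Series ι K) (w) :
    contr ξ x f w = Finsupp.linearCombination K (fun a => f (a :: w)) (ξ x) := by
  rw [contr_apply]; rfl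

/-- The coefficients are those of a quadratic derivation. -/
def Quad (ξ : List (Letter ι) → Letter ι →₀ K) : Prop := ∀ x, x.length ≠ 2 → ξ x = 0

theorem Quad.linQuad {ξ : List (Letter ι) → Letter ι →₀ K} (h : Quad ξ) : LinQuad ξ :=
  fun x _ h2 => h x h2

/-- A coefficient of `oddDer deg ξ f` lies in every group that contains the terms it is a sum of. -/
theorem oddDer_apply_mem (S : AddSubgroup K) {f : Series ι K} {w : List (Letter ι)}
    (h : ∀ u x v a, w = u ++ x ++ v → ξ x a ≠ 0 → ξ x a * f (u ++ a :: v) ∈ S) :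
    oddDer deg ξ f w ∈ S := by
  rw [oddDer_apply]
  refine S.sum_mem fun k _ => S.sum_mem fun l _ => S.sum_mem fun a ha => ?_
  have := h (w.take k) ((w.drop k).take l) ((w.drop k).drop l) a
    (by simp) (Finsupp.mem_support_iff.1 ha)
  rcases sgn_eq_or (K := K) (totalDeg deg (w.take k)) with h' | h' <;> rw [h']
  · simpa using this
  · simpa using S.neg_mem this

theorem oddDer_apply_eq_zero {f : Series ι K} {w : List (Letter ι)}
    (h : ∀ u x v a, w = u ++ x ++ v → ξ x a ≠ 0 → f (u ++ a :: v) = 0) :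
    oddDer deg ξ f w = 0 := by
  have := oddDer_apply_mem (deg := deg) (ξ := ξ) (⊥ : AddSubgroup K) (f := f) (w := w)
    fun u x v a h1 h2 => by simp [h u x v a h1 h2]
  simpa using this

variable (deg ξ η) in
/-- The anticommutator of two odd derivations, an even derivation. -/
def anti : Series ι K →ₗ[K] Series ι K :=
  oddDer deg ξ ∘ₗ oddDer deg η + oddDer deg η ∘ₗ oddDer deg ξ

theorem anti_apply (f : Series ι K) :
    anti deg ξ η f = oddDer deg ξ (oddDer deg η f) + oddDer deg η (oddDer deg ξ f) := rfl

theorem anti_conc (hξ : LinQuad ξ) (hξ' : OddCoeff deg ξ) (hη : LinQuad η)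
    (hη' : OddCoeff deg η) (f g : Series ι K) :
    anti deg ξ η (conc f g) = conc (anti deg ξ η f) g + conc f (anti deg ξ η g) := by
  simp only [anti_apply, oddDer_conc hξ, oddDer_conc hη, map_add, oddDer_par hξ', oddDer_par hη',
    par_par]
  simp only [← concL_apply, map_add, map_neg, LinearMap.add_apply, LinearMap.neg_apply]
  abel

theorem anti_single (hξ : LinQuad ξ) (hξ' : OddCoeff deg ξ) (hη : LinQuad η)
    (hη' : OddCoeff deg η) (e : K) (h : ∀ a, anti deg ξ η (letter K a) = e • letter K a)
    (w : List (Letter ι)) :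
    anti deg ξ η (Pi.single w 1) = (w.length * e) • (Pi.single w 1 : Series ι K) := by
  induction w with
  | nil => rw [anti_apply, oddDer_one hξ, oddDer_one hη]; simp
  | cons a w ih =>
    have h1 : (Pi.single (a :: w) 1 : Series ι K) = conc (letter K a) (Pi.single w 1) := by
      rw [letter_eq, conc_single]; rfl
    rw [h1, anti_conc hξ hξ' hη hη', h, ih]
    simp only [← concL_apply, map_smul, LinearMap.smul_apply, List.length_cons]
    rw [← add_smul]
    congr 1
    push_cast; ring

variable [TopologicalSpace K] [DiscreteTopology K]

/-- An anticommutator of odd derivations that multiplies every letter by `e` multiplies every word by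
`e` times its length. -/
theorem anti_eq (hξ : LinQuad ξ) (hξ' : OddCoeff deg ξ) (hη : LinQuad η)
    (hη' : OddCoeff deg η) (e : K) (h : ∀ a, anti deg ξ η (letter K a) = e • letter K a)
    (f : Series ι K) : anti deg ξ η f = fun w => (w.length * e) * f w := by
  refine eq_of_single (anti deg ξ η)
    (LinearMap.pi fun w => ((w.length : K) * e) • LinearMap.proj w)
    (((continuous_oddDer deg ξ).comp (continuous_oddDer deg η)).add
      ((continuous_oddDer deg η).comp (continuous_oddDer deg ξ)))
    (continuous_pi fun w => by simp; fun_prop) (fun w => ?_) f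
  rw [anti_single hξ hξ' hη hη' e h]
  ext v
  by_cases hv : v = w
  · subst hv; simp
  · simp [hv]

/-- An anticommutator of odd derivations that multiplies every letter by `e` multiplies every tensor by
`e` times its number of letters. -/
theorem anti₂_eq (hξ : LinQuad ξ) (hξ' : OddCoeff deg ξ) (hη : LinQuad η)
    (hη' : OddCoeff deg η) (e : K) (h : ∀ a, anti deg ξ η (letter K a) = e • letter K a)
    (F : Series₂ ι K) :
    oddDer₂ deg ξ (oddDer₂ deg η F) + oddDer₂ deg η (oddDer₂ deg ξ F) =
      fun p => ((p.1.length + p.2.length : ℕ) * e) * F p := by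
  refine eq_of_single (oddDer₂ deg ξ ∘ₗ oddDer₂ deg η + oddDer₂ deg η ∘ₗ oddDer₂ deg ξ)
    (LinearMap.pi fun p => (((p.1.length + p.2.length : ℕ) : K) * e) • LinearMap.proj p)
    (((continuous_oddDer₂ deg ξ).comp (continuous_oddDer₂ deg η)).add
      ((continuous_oddDer₂ deg η).comp (continuous_oddDer₂ deg ξ)))
    (continuous_pi fun w => by simp; fun_prop) (fun ⟨u, v⟩ => ?_) F
  have h1 := anti_single hξ hξ' hη hη' e h u
  have h2 := anti_single hξ hξ' hη hη' e h v
  rw [anti_apply] at h1 h2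
  have h3 : (oddDer₂ deg ξ ∘ₗ oddDer₂ deg η + oddDer₂ deg η ∘ₗ oddDer₂ deg ξ)
      (Pi.single (u, v) 1) = (((u.length + v.length : ℕ) : K) * e) • Pi.single (u, v) 1 := by
    rw [← tmul_single]
    simp only [LinearMap.add_apply, LinearMap.comp_apply, oddDer₂_tmul, map_add, oddDer_par hξ',
      oddDer_par hη', par_par]
    rw [Nat.cast_add, add_mul, add_smul]
    conv_rhs => rw [← tmulL_apply, ← LinearMap.smul_apply, ← map_smul, ← map_smul, ← h1, ← h2]
    simp only [← tmulL_apply, map_add, map_neg, LinearMap.add_apply, LinearMap.neg_apply]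
    abel
  rw [h3]
  ext p
  by_cases hv : p = (u, v)
  · subst hv; simp
  · simp [hv]

end Anticommutator

section DeRham

variable {ι : Type*} (K : Type*) [CommRing K] (deg : ι → ℤ)

/-- The contraction with the Euler vector field on letters: `d(t k) ↦ t k`, `t k ↦ 0`. -/
def eulerCoeff : List (Letter ι) → Letter ι →₀ K
  | [(k, false)] => Finsupp.single (k, true) 1
  | _ => 0

variable {K}

theorem totalDeg_false (k : ι) : totalDeg deg [(k, false)] = 1 - deg k := by
  simp [totalDeg, internalDeg, formDeg]

theorem totalDeg_true (k : ι) : totalDeg deg [(k, true)] = 1 - deg k + 1 := by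
  simp [totalDeg, internalDeg, formDeg]

theorem deRhamCoeff_cases (x : List (Letter ι)) :
    (∃ k, x = [(k, true)]) ∨ deRhamCoeff K x = 0 := by
  match x with
  | [] => exact Or.inr rfl
  | [(k, true)] => exact Or.inl ⟨k, rfl⟩
  | [(k, false)] => exact Or.inr rfl
  | (k, true) :: b :: u => exact Or.inr rfl
  | (k, false) :: b :: u => exact Or.inr rfl

theorem eulerCoeff_cases (x : List (Letter ι)) :
    (∃ k, x = [(k, false)]) ∨ eulerCoeff K x = 0 := by
  match x with
  | [] => exact Or.inr rfl
  | [(k, false)] => exact Or.inl ⟨k, rfl⟩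
  | [(k, true)] => exact Or.inr rfl
  | (k, true) :: b :: u => exact Or.inr rfl
  | (k, false) :: b :: u => exact Or.inr rfl

theorem deRhamCoeff_ne_zero {x : List (Letter ι)} {a} (h : deRhamCoeff K x a ≠ 0) :
    ∃ k, x = [(k, true)] ∧ a = (k, false) := by
  rcases deRhamCoeff_cases (K := K) x with ⟨k, rfl⟩ | h'
  · refine ⟨k, rfl, ?_⟩
    by_contra ha
    exact h (Finsupp.single_eq_of_ne ha)
  · simp [h'] at h

theorem eulerCoeff_ne_zero {x : List (Letter ι)} {a} (h : eulerCoeff K x a ≠ 0) :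
    ∃ k, x = [(k, false)] ∧ a = (k, true) := by
  rcases eulerCoeff_cases (K := K) x with ⟨k, rfl⟩ | h'
  · refine ⟨k, rfl, ?_⟩
    by_contra ha
    exact h (Finsupp.single_eq_of_ne ha)
  · simp [h'] at h

theorem isLieDer_deRham : IsLieDer deg (deRhamCoeff K) where
  linQuad x h1 _ := by
    rcases deRhamCoeff_cases (K := K) x with ⟨k, rfl⟩ | h'
    · simp at h1
    · exact h'
  odd x a h := by
    obtain ⟨k, rfl, rfl⟩ := deRhamCoeff_ne_zero h
    rw [totalDeg_false, totalDeg_true]; exact ⟨0, by ring⟩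
  mem a := by
    obtain ⟨k, _ | _⟩ := a
    · convert (IsLieMonomial.of (K := K) (deg := deg) (k, true)).mem using 1
      ext w
      by_cases h : w = [(k, true)]
      · subst h; simp [letter, deRhamCoeff]
      · rw [letter, if_neg h]
        by_contra h'
        obtain ⟨l, h1, h2⟩ := deRhamCoeff_ne_zero h'
        simp at h2; simp [h1, h2] at h
    · have : (fun w => deRhamCoeff K w (k, true)) = 0 := by
        ext w
        by_contra h'
        obtain ⟨l, h1, h2⟩ := deRhamCoeff_ne_zero h'
        simp at h2
      rw [this]; exact Submodule.zero_mem _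

theorem deRham_mem_relations {deg : ι → ℤ} [TopologicalSpace K] [DiscreteTopology K]
    {F : Series₂ ι K} (hF : F ∈ relations K deg) :
    deRham K deg F ∈ relations K deg := oddDer₂_mem_relations (isLieDer_deRham deg) hF

theorem isLieDer_euler : IsLieDer deg (eulerCoeff K) where
  linQuad x h1 _ := by
    rcases eulerCoeff_cases (K := K) x with ⟨k, rfl⟩ | h'
    · simp at h1
    · exact h'
  odd x a h := by
    obtain ⟨k, rfl, rfl⟩ := eulerCoeff_ne_zero h
    rw [totalDeg_false, totalDeg_true]; exact ⟨-1, by ring⟩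
  mem a := by
    obtain ⟨k, _ | _⟩ := a
    · have : (fun w => eulerCoeff K w (k, false)) = 0 := by
        ext w
        by_contra h'
        obtain ⟨l, h1, h2⟩ := eulerCoeff_ne_zero h'
        simp at h2
      rw [this]; exact Submodule.zero_mem _
    · convert (IsLieMonomial.of (K := K) (deg := deg) (k, false)).mem using 1
      ext w
      by_cases h : w = [(k, false)]
      · subst h; simp [letter, eulerCoeff]
      · rw [letter, if_neg h]
        by_contra h'
        obtain ⟨l, h1, h2⟩ := eulerCoeff_ne_zero h'
        simp at h2; simp [h1, h2] at h

theorem deRham_letter_false (k : ι) :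
    oddDer deg (deRhamCoeff K) (letter K (k, false)) = letter K (k, true) := by
  rw [oddDer_letter (isLieDer_deRham deg).linQuad]
  ext w
  by_cases h : w = [(k, true)]
  · subst h; simp [letter, deRhamCoeff]
  · rw [letter, if_neg h]
    by_contra h'
    obtain ⟨l, h1, h2⟩ := deRhamCoeff_ne_zero h'
    simp at h2; simp [h1, h2] at h

theorem deRham_letter_true (k : ι) :
    oddDer deg (deRhamCoeff K) (letter K (k, true)) = 0 := by
  rw [oddDer_letter (isLieDer_deRham deg).linQuad]
  ext w
  by_contra h'
  obtain ⟨l, h1, h2⟩ := deRhamCoeff_ne_zero h'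
  simp at h2

theorem euler_letter_true (k : ι) :
    oddDer deg (eulerCoeff K) (letter K (k, true)) = letter K (k, false) := by
  rw [oddDer_letter (isLieDer_euler deg).linQuad]
  ext w
  by_cases h : w = [(k, false)]
  · subst h; simp [letter, eulerCoeff]
  · rw [letter, if_neg h]
    by_contra h'
    obtain ⟨l, h1, h2⟩ := eulerCoeff_ne_zero h'
    simp at h2; simp [h1, h2] at h

theorem euler_letter_false (k : ι) :
    oddDer deg (eulerCoeff K) (letter K (k, false)) = 0 := by
  rw [oddDer_letter (isLieDer_euler deg).linQuad]
  ext w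
  by_contra h'
  obtain ⟨l, h1, h2⟩ := eulerCoeff_ne_zero h'
  simp at h2

variable {deg} [TopologicalSpace K] [DiscreteTopology K]

/-- Cartan's formula for the Euler vector field. -/
theorem deRham_euler (F : Series₂ ι K) :
    deRham K deg (oddDer₂ deg (eulerCoeff K) F) + oddDer₂ deg (eulerCoeff K) (deRham K deg F) =
      fun p => ((p.1.length + p.2.length : ℕ) : K) * F p := by
  have := anti₂_eq (isLieDer_deRham (K := K) deg).linQuad (isLieDer_deRham deg).odd
    (isLieDer_euler deg).linQuad (isLieDer_euler deg).odd 1 (fun a => ?_) F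
  · simpa [deRham] using this
  · obtain ⟨k, _ | _⟩ := a
    · rw [anti_apply, euler_letter_false, deRham_letter_false, euler_letter_true]; simp
    · rw [anti_apply, deRham_letter_true, euler_letter_true, deRham_letter_false]; simp

theorem oddDer_deRham_deRham [Algebra ℚ K] (f : Series ι K) :
    oddDer deg (deRhamCoeff K) (oddDer deg (deRhamCoeff K) f) = 0 := by
  have := anti_eq (isLieDer_deRham (K := K) deg).linQuad (isLieDer_deRham deg).odd
    (isLieDer_deRham deg).linQuad (isLieDer_deRham deg).odd 0 (fun a => ?_) f
  · rw [anti_apply] at this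
    have h2 : (2 : ℚ) • oddDer deg (deRhamCoeff K) (oddDer deg (deRhamCoeff K) f) = 0 := by
      rw [two_smul, this]; ext; simp
    simpa using congrArg ((2⁻¹ : ℚ) • ·) h2
  · obtain ⟨k, _ | _⟩ := a
    · rw [anti_apply, deRham_letter_false, deRham_letter_true]; simp
    · rw [anti_apply, deRham_letter_true]; simp

/-- A zero-form with `n ≠ 0` letters whose de Rham differential vanishes in `DR_Lie` vanishes there: by
Cartan's formula it is `n⁻¹` times the Euler contraction of its differential. -/
theorem mem_relations_of_deRham [Algebra ℚ K] {F : Series₂ ι K} {n : ℕ} (hn : n ≠ 0)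
    (h0 : ∀ u v, F (u, v) ≠ 0 → formDeg u + formDeg v = 0 ∧ u.length + v.length = n)
    (h : deRham K deg F ∈ relations K deg) : F ∈ relations K deg := by
  have h1 : oddDer₂ deg (eulerCoeff K) F = 0 := by
    ext ⟨u, v⟩
    rw [oddDer₂_apply, oddDer_apply_eq_zero, oddDer_apply_eq_zero]
    · simp
    all_goals
      rintro u' x v' a rfl hx
      obtain ⟨k, rfl, rfl⟩ := eulerCoeff_ne_zero hx
      by_contra h'
      have := (h0 _ _ h').1
      rw [formDeg_append, formDeg_cons_true] at this; omega
  have h2 := deRham_euler (deg := deg) F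
  rw [h1, map_zero, zero_add] at h2
  have h3 : F = (n : ℚ)⁻¹ • oddDer₂ deg (eulerCoeff K) (deRham K deg F) := by
    rw [h2]
    ext ⟨u, v⟩
    by_cases h' : F (u, v) = 0
    · simp [h']
    · rw [Pi.smul_apply, (h0 _ _ h').2, ← nsmul_eq_mul, ← Nat.cast_smul_eq_nsmul ℚ, smul_smul,
        inv_mul_cancel₀ (by exact_mod_cast hn), one_smul]
  rw [h3]
  exact Submodule.smul_of_tower_mem _ _ (oddDer₂_mem_relations (isLieDer_euler deg) h)

end DeRham

section LieOperator

variable {ι K V : Type*} [CommRing K] [Ring V] [Algebra K V] {b : Module.Basis ι K V}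
  {deg : ι → ℤ}

variable (b deg) in
/-- The structure constants with respect to the basis `b` are those of a graded commutative algebra
(with coefficients in even degrees). -/
structure IsGradedComm : Prop where
  even : ∀ k l c, b.repr (b k * b l) c ≠ 0 → Even (deg k + deg l - deg c)
  comm : ∀ k l, b k * b l = (deg k * deg l).negOnePow • (b l * b k)

theorem structureCoeff_apply (k l c : ι) :
    structureCoeff b deg k l c = sgn K (deg k * (deg l + 1)) * b.repr (b k * b l) c := by
  rw [structureCoeff, Finsupp.smul_apply, negOnePow_smul]

theorem structureCoeff_symm (hb : IsGradedComm b deg) (k l c : ι) :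
    structureCoeff b deg l k c = -(sgn K ((1 - deg k) * (1 - deg l)) *
      structureCoeff b deg k l c) := by
  have : b.repr (b l * b k) c = sgn K (deg l * deg k) * b.repr (b k * b l) c := by
    rw [hb.comm l k, Units.smul_def, map_zsmul, Finsupp.smul_apply, zsmul_eq_mul, sgn]
  rw [structureCoeff_apply, structureCoeff_apply, this, ← mul_assoc, ← mul_assoc, ← sgn_add,
    ← sgn_add, ← neg_mul]
  congr 1
  rw [← neg_one_mul, ← sgn_odd (K := K) odd_one, ← sgn_add]
  exact sgn_congr ⟨deg l - 1, by ring⟩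

theorem even_of_structureCoeff (hb : IsGradedComm b deg) {k l c : ι}
    (h : structureCoeff b deg k l c ≠ 0) : Even (deg k + deg l - deg c) := by
  rw [structureCoeff_apply] at h
  exact hb.even k l c (right_ne_zero_of_mul h)

theorem linearCombination_structureCoeff (k l : ι) (φ : ι → K) :
    Finsupp.linearCombination K φ (structureCoeff b deg k l) =
      sgn K (deg k * (deg l + 1)) * Finsupp.linearCombination K φ (b.repr (b k * b l)) := by
  have : structureCoeff b deg k l = sgn K (deg k * (deg l + 1)) • b.repr (b k * b l) := by
    ext c; rw [structureCoeff_apply]; rfl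
  rw [this, map_smul]; rfl

/-- The associativity of `V`: the vector field `m` squares to zero on `t c`. -/
theorem structureCoeff_assoc (hb : IsGradedComm b deg) (k l m c : ι) :
    sgn K (1 - deg k) * Finsupp.linearCombination K (fun e => structureCoeff b deg k e c)
        (structureCoeff b deg l m) +
      Finsupp.linearCombination K (fun e => structureCoeff b deg e m c)
        (structureCoeff b deg k l) = 0 := by
  have hlin (v w : V) (φ : ι → K) (s : K) (f : V →ₗ[K] K)
      (h : ∀ e, b.repr v e ≠ 0 → φ e = s * f (b e)) :
      Finsupp.linearCombination K φ (b.repr v) = s * f v := by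
    rw [Finsupp.linearCombination_apply, Finsupp.sum]
    conv_rhs => rw [← b.linearCombination_repr v, Finsupp.linearCombination_apply, Finsupp.sum,
      map_sum, Finset.mul_sum]
    refine Finset.sum_congr rfl fun e he => ?_
    rw [h e (Finsupp.mem_support_iff.1 he), map_smul, smul_eq_mul, smul_eq_mul]; ring
  have h1 := hlin (b l * b m) (b l * b m) (fun e => structureCoeff b deg k e c)
    (sgn K (deg k * (deg l + deg m + 1)))
    ((Finsupp.lapply c ∘ₗ (b.repr : V →ₗ[K] ι →₀ K)) ∘ₗ LinearMap.mulLeft K (b k)) (fun e he => by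
      rw [structureCoeff_apply]
      congr 1
      refine sgn_congr ?_
      have := hb.even l m e he
      rw [← mul_sub]
      refine Even.mul_left ?_ _
      obtain ⟨z, hz⟩ := this
      exact ⟨-z, by linarith⟩)
  have h2 := hlin (b k * b l) (b k * b l) (fun e => structureCoeff b deg e m c)
    (sgn K ((deg k + deg l) * (deg m + 1)))
    ((Finsupp.lapply c ∘ₗ (b.repr : V →ₗ[K] ι →₀ K)) ∘ₗ LinearMap.mulRight K (b m)) (fun e he => by
      rw [structureCoeff_apply]
      congr 1
      refine sgn_congr ?_
      have := hb.even k l e he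
      rw [← sub_mul]
      refine Even.mul_right ?_ _
      obtain ⟨z, hz⟩ := this
      exact ⟨-z, by linarith⟩)
  rw [linearCombination_structureCoeff, linearCombination_structureCoeff, h1, h2]
  simp only [LinearMap.comp_apply, LinearMap.mulLeft_apply, LinearMap.mulRight_apply, ← mul_assoc,
    ← sgn_add]
  rw [← add_mul]
  have : sgn K (1 - deg k + (deg l * (deg m + 1) + deg k * (deg l + deg m + 1))) =
      -sgn K (deg k * (deg l + 1) + (deg k + deg l) * (deg m + 1)) := by
    rw [← neg_one_mul, ← sgn_odd (K := K) odd_one, ← sgn_add]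
    exact sgn_congr ⟨-deg k, by ring⟩
  rw [this]; simp

theorem lieOpCoeff_ff_false (k l c : ι) :
    lieOpCoeff b deg [(k, false), (l, false)] (c, false) = structureCoeff b deg k l c :=
  Finsupp.mapDomain_apply (fun _ _ h => (Prod.ext_iff.1 h).1) _ _

theorem lieOpCoeff_ff_true (k l c : ι) :
    lieOpCoeff b deg [(k, false), (l, false)] (c, true) = 0 :=
  Finsupp.mapDomain_of_notMem_range _ _ (by simp)

theorem lieOpCoeff_tf_true (k l c : ι) :
    lieOpCoeff b deg [(k, true), (l, false)] (c, true) = -structureCoeff b deg k l c :=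
  congrArg Neg.neg (Finsupp.mapDomain_apply (fun _ _ h => (Prod.ext_iff.1 h).1) _ _)

theorem lieOpCoeff_tf_false (k l c : ι) :
    lieOpCoeff b deg [(k, true), (l, false)] (c, false) = 0 := by
  have : _ = (0 : K) := Finsupp.mapDomain_of_notMem_range (f := fun c : ι => (c, true))
    (structureCoeff b deg k l) (c, false) (by simp)
  simp [lieOpCoeff, this]

theorem lieOpCoeff_ft_true (k l c : ι) :
    lieOpCoeff b deg [(k, false), (l, true)] (c, true) =
      -(sgn K (1 - deg k) * structureCoeff b deg k l c) := by
  have := Finsupp.mapDomain_apply (f := fun c : ι => (c, true))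
    (fun _ _ h => (Prod.ext_iff.1 h).1) (structureCoeff b deg k l) c
  simp only [lieOpCoeff, Finsupp.neg_apply, Finsupp.smul_apply, negOnePow_smul, this]

theorem lieOpCoeff_ft_false (k l c : ι) :
    lieOpCoeff b deg [(k, false), (l, true)] (c, false) = 0 := by
  have : _ = (0 : K) := Finsupp.mapDomain_of_notMem_range (f := fun c : ι => (c, true))
    (structureCoeff b deg k l) (c, false) (by simp)
  simp [lieOpCoeff, this]

theorem lieOpCoeff_tt (k l : ι) : lieOpCoeff b deg [(k, true), (l, true)] = 0 := rfl

theorem quad_lieOpCoeff : Quad (lieOpCoeff b deg) := by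
  intro x hx
  match x with
  | [] => rfl
  | [(_, true)] => rfl
  | [(_, false)] => rfl
  | [_, _] => simp at hx
  | (_, true) :: (_, true) :: _ :: _ => rfl
  | (_, true) :: (_, false) :: _ :: _ => rfl
  | (_, false) :: (_, true) :: _ :: _ => rfl
  | (_, false) :: (_, false) :: _ :: _ => rfl

/-- The coefficients of the Lie operator are graded antisymmetric. -/
theorem lieOpCoeff_symm (hb : IsGradedComm b deg) (a c x : Letter ι) :
    lieOpCoeff b deg [c, a] x =
      -(sgn K (totalDeg deg [a] * totalDeg deg [c]) * lieOpCoeff b deg [a, c] x) := by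
  obtain ⟨k, p⟩ := a
  obtain ⟨l, q⟩ := c
  obtain ⟨c, r⟩ := x
  have hs := structureCoeff_symm hb k l c
  cases p <;> cases q <;> cases r <;> simp only [lieOpCoeff_ff_false, lieOpCoeff_ff_true,
    lieOpCoeff_tf_true, lieOpCoeff_tf_false, lieOpCoeff_ft_true, lieOpCoeff_ft_false,
    lieOpCoeff_tt, Finsupp.coe_zero, Pi.zero_apply, mul_zero, neg_zero, totalDeg_true,
    totalDeg_false, hs, neg_neg]
  · rw [mul_neg, neg_neg, ← mul_assoc, ← sgn_add]
    congr 1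
    refine sgn_congr ?_
    simp only [Int.even_sub, Int.even_add, Int.even_mul]
    simp only [Int.not_even_one]; tauto
  · rw [mul_neg, neg_neg, mul_neg, neg_neg, ← mul_assoc, ← sgn_add]
    congr 1
    refine sgn_congr ?_
    simp only [Int.even_sub, Int.even_add, Int.even_mul]
    simp only [Int.not_even_one]; tauto

/-- The shape of the coefficients of the Lie operator. -/
theorem lieOpCoeff_ne_zero {x : List (Letter ι)} {a} (h : lieOpCoeff b deg x a ≠ 0) :
    ∃ k l p q, x = [(k, p), (l, q)] ∧ structureCoeff b deg k l a.1 ≠ 0 ∧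
      formDeg x = formDeg [a] := by
  have hx : x.length = 2 := by
    by_contra h'; simp [quad_lieOpCoeff x h'] at h
  obtain ⟨⟨k, p⟩, ⟨l, q⟩, rfl⟩ := List.length_eq_two.1 hx
  refine ⟨k, l, p, q, rfl, ?_⟩
  obtain ⟨c, r⟩ := a
  cases p <;> cases q <;> cases r <;> simp only [lieOpCoeff_ff_false, lieOpCoeff_ff_true,
    lieOpCoeff_tf_true, lieOpCoeff_tf_false, lieOpCoeff_ft_true, lieOpCoeff_ft_false,
    lieOpCoeff_tt, Finsupp.coe_zero, Pi.zero_apply, ne_eq, not_true] at h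
  · exact ⟨h, by simp [formDeg]⟩
  · refine ⟨fun h' => h (by simp [h']), by simp [formDeg]⟩
  · refine ⟨fun h' => h (by simp [h']), by simp [formDeg]⟩

variable [Algebra ℚ K] [TopologicalSpace K] [DiscreteTopology K]

theorem isLieDer_lieOp (hb : IsGradedComm b deg) : IsLieDer deg (lieOpCoeff b deg) where
  linQuad := quad_lieOpCoeff.linQuad
  odd x a h := by
    obtain ⟨k, l, p, q, rfl, h1, h2⟩ := lieOpCoeff_ne_zero h
    have := even_of_structureCoeff hb h1
    rw [totalDeg, totalDeg, h2]
    simp only [internalDeg, List.map_cons, List.map_nil, List.sum_cons, List.sum_nil]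
    obtain ⟨z, hz⟩ := this
    exact ⟨-z, by linarith⟩
  mem a := mem_lieForms_of_antisymm (fun w hw => by simp [quad_lieOpCoeff w hw])
    fun c e => lieOpCoeff_symm hb c e a

end LieOperator

/-! ### The differential on normal forms -/

section Admissible

variable {ι K : Type*} [CommRing K] {deg : ι → ℤ}

/-- The coefficient of each word `w` lies in `S w`. With suitable `S` this expresses that a series is
homogeneous for the various gradings. -/
def Adm (S : List (Letter ι) → AddSubgroup K) (f : Series ι K) : Prop := ∀ w, f w ∈ S w

/-- A condition on words that depends on their letters only. -/
def PermInv (S : List (Letter ι) → AddSubgroup K) : Prop := ∀ w w', w.Perm w' → S w = S w'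

theorem sgn_mul_mem (S : AddSubgroup K) (n : ℤ) {x : K} (hx : x ∈ S) : sgn K n * x ∈ S := by
  rcases sgn_eq_or (K := K) n with h | h <;> rw [h]
  · simpa using hx
  · simpa using S.neg_mem hx

theorem Adm.sub {S : List (Letter ι) → AddSubgroup K} {f g : Series ι K} (hf : Adm S f)
    (hg : Adm S g) : Adm S (f - g) := fun w => (S w).sub_mem (hf w) (hg w)

theorem Adm.add {S : List (Letter ι) → AddSubgroup K} {f g : Series ι K} (hf : Adm S f)
    (hg : Adm S g) : Adm S (f + g) := fun w => (S w).add_mem (hf w) (hg w)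

theorem Adm.neg {S : List (Letter ι) → AddSubgroup K} {f : Series ι K} (hf : Adm S f) :
    Adm S (-f) := fun w => (S w).neg_mem (hf w)

theorem Adm.rot {S : List (Letter ι) → AddSubgroup K} (hS : PermInv S) {f : Series ι K}
    (hf : Adm S f) : Adm S (rot deg f) := by
  intro w
  induction w using List.reverseRecOn with
  | nil => rw [rot_nil]; exact hf _
  | append_singleton u c _ =>
    rw [rot_append]
    exact sgn_mul_mem _ _ (hS _ _ (List.perm_append_singleton c u).symm ▸ hf (c :: u))

theorem Adm.rot_pow {S : List (Letter ι) → AddSubgroup K} (hS : PermInv S) {f : Series ι K}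
    (hf : Adm S f) (r : ℕ) : Adm S ((Harrison.rot deg ^ r) f) := by
  induction r with
  | zero => exact hf
  | succ r ih => rw [pow_succ', Module.End.mul_apply]; exact ih.rot hS

theorem Adm.cyc {S : List (Letter ι) → AddSubgroup K} (hS : PermInv S) {f : Series ι K}
    (hf : Adm S f) : Adm S (cyc deg f) := by
  intro w
  rw [cyc_apply]
  exact (S w).sum_mem fun r _ => hf.rot_pow hS r w

theorem adm_mult {S : List (Letter ι) → AddSubgroup K} {F : Series₂ ι K}
    (hF : ∀ u v, F (u, v) ∈ S (u ++ v)) : Adm S (mult F) := by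
  intro w
  rw [mult_apply]
  exact (S w).sum_mem fun k _ => by simpa using hF (w.take k) (w.drop k)

theorem Adm.oddDer {S S' : List (Letter ι) → AddSubgroup K}
    {ξ : List (Letter ι) → Letter ι →₀ K}
    (h : ∀ u x v a, ξ x a ≠ 0 → ∀ c ∈ S (u ++ a :: v), ξ x a * c ∈ S' (u ++ x ++ v))
    {f : Series ι K} (hf : Adm S f) : Adm S' (oddDer deg ξ f) := fun _ =>
  oddDer_apply_mem _ fun u x v a hw hx => hw ▸ h u x v a hx _ (hf _)

variable (ι K) in
/-- The condition satisfied by the pure series. -/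
def pureCond (w : List (Letter ι)) : AddSubgroup K := if w ≠ [] ∧ formDeg w = 0 then ⊤ else ⊥

theorem permInv_pureCond : PermInv (pureCond ι K) := by
  intro w w' h
  have h1 : formDeg w = formDeg w' := h.countP_eq _
  have h2 : w = [] ↔ w' = [] := by rw [← List.length_eq_zero_iff, h.length_eq,
    List.length_eq_zero_iff]
  simp [pureCond, h1, h2]

theorem pure_iff {f : Series ι K} : Pure f ↔ Adm (pureCond ι K) f := by
  constructor
  · intro h w
    rw [pureCond]
    split_ifs with hw
    · trivial
    · rw [AddSubgroup.mem_bot]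
      by_contra h'
      refine hw ⟨?_, h.formDeg w h'⟩
      rintro rfl
      exact h' h.nil
  · intro h
    have this (w) (hw : f w ≠ 0) : w ≠ [] ∧ formDeg w = 0 := by
      have := h w
      rw [pureCond] at this
      split_ifs at this with h'
      · exact h'
      · exact absurd this hw
    exact ⟨by by_contra h'; exact (this _ h').1 rfl, fun w hw => (this w hw).2⟩

end Admissible

section Quadratic

variable {ι K : Type*} [CommRing K] {deg : ι → ℤ} {ξ : List (Letter ι) → Letter ι →₀ K}

variable (ξ) in
/-- The part of a quadratic derivation that produces the first two letters of a word. -/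
def mergeFirst : Series ι K →ₗ[K] Series ι K :=
  LinearMap.pi fun w => match w with
    | a :: c :: v => LinearMap.proj v ∘ₗ contr ξ [a, c]
    | _ => 0

@[simp] theorem mergeFirst_nil (f : Series ι K) : mergeFirst ξ f [] = 0 := rfl
@[simp] theorem mergeFirst_singleton (f : Series ι K) (a) : mergeFirst ξ f [a] = 0 := rfl
@[simp] theorem mergeFirst_cons (f : Series ι K) (a c v) :
    mergeFirst ξ f (a :: c :: v) = contr ξ [a, c] f v := rfl

theorem Adm.mergeFirst {S S' : List (Letter ι) → AddSubgroup K}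
    (h : ∀ u x v a, ξ x a ≠ 0 → ∀ c ∈ S (u ++ a :: v), ξ x a * c ∈ S' (u ++ x ++ v))
    {f : Series ι K} (hf : Adm S f) : Adm S' (mergeFirst ξ f) := by
  intro w
  match w with
  | [] => exact (S' _).zero_mem
  | [_] => exact (S' _).zero_mem
  | a :: c :: v =>
    rw [mergeFirst_cons, contr_apply]
    exact (S' _).sum_mem fun e he => h [] [a, c] v e (Finsupp.mem_support_iff.1 he) _ (hf _)

/-- The recursion for a quadratic derivation from the left. -/
theorem oddDer_quad_cons (h : Quad ξ) (f : Series ι K) (a w) :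
    oddDer deg ξ f (a :: w) =
      sgn K (totalDeg deg [a]) * oddDer deg ξ (slice a f) w + mergeFirst ξ f (a :: w) := by
  cases w with
  | nil =>
    rw [oddDer_singleton deg h.linQuad, oddDer_nil deg h.linQuad, contr_eq_zero ξ (h [a] (by simp))]
    simp
  | cons c w =>
    rw [oddDer_cons_cons deg h.linQuad, contr_eq_zero ξ (h [a] (by simp))]
    simp

/-- The recursion for a quadratic derivation from the right. -/
theorem oddDer_quad_append (h : Quad ξ) (f : Series ι K) (u e c) :
    oddDer deg ξ f (u ++ [e, c]) = oddDer deg ξ (fun w => f (w ++ [c])) (u ++ [e]) +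
      sgn K (totalDeg deg u) *
        Finsupp.linearCombination K (fun x => f (u ++ [x])) (ξ [e, c]) := by
  induction u generalizing f with
  | nil =>
    have h1 (f : Series ι K) (a) : oddDer deg ξ f [a] = 0 := by
      rw [oddDer_singleton deg h.linQuad, contr_eq_zero ξ (h [a] (by simp))]; rfl
    rw [List.nil_append, List.nil_append, oddDer_quad_cons h, h1, h1, mergeFirst_cons, contr_eq]
    simp
  | cons a u ih =>
    rw [List.cons_append, List.cons_append, oddDer_quad_cons h, oddDer_quad_cons h, ih,
      totalDeg_cons deg a u, sgn_add]
    have h2 : mergeFirst ξ f (a :: (u ++ [e, c])) =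
        mergeFirst ξ (fun w => f (w ++ [c])) (a :: (u ++ [e])) := by
      cases u with
      | nil => simp [contr_eq]
      | cons y u => simp [contr_eq]
    rw [h2]
    have : slice a (fun w => f (w ++ [c])) = fun w => slice a f (w ++ [c]) := rfl
    rw [this]
    simp only [slice_apply, List.cons_append]
    ring

variable (deg ξ) in
/-- The Hochschild-type differential: a quadratic derivation together with the term that multiplies
the last letter with the first one. -/
def hoch : Series ι K →ₗ[K] Series ι K :=
  oddDer deg ξ + rot deg ∘ₗ mergeFirst ξ

theorem hoch_apply (f : Series ι K) :
    hoch deg ξ f = oddDer deg ξ f + rot deg (mergeFirst ξ f) := rfl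

/-- `(1 - t) b = b' (1 - t)`, for the rotation `t`. -/
theorem hoch_sub_rot (h : Quad ξ) (hd : OddCoeff deg ξ) (f : Series ι K) :
    hoch deg ξ f - rot deg (hoch deg ξ f) = oddDer deg ξ (f - rot deg f) := by
  rw [map_sub]
  ext w
  induction w using List.reverseRecOn with
  | nil => simp [hoch_apply, oddDer_nil deg h.linQuad]
  | append_singleton u c _ =>
    induction u using List.reverseRecOn with
    | nil =>
      have h1 (f : Series ι K) (a) : oddDer deg ξ f [a] = 0 := by
        rw [oddDer_singleton deg h.linQuad, contr_eq_zero ξ (h [a] (by simp))]; rfl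
      have h2 (f : Series ι K) : rot deg f ([] ++ [c]) = f [c] := by rw [rot_append]; simp
      rw [Pi.sub_apply, Pi.sub_apply, h2]
      simp [h1]
    | append_singleton u e _ =>
      have h1 := oddDer_sgn_mul hd (totalDeg deg [c]) (slice c f) (u ++ [e])
      have h2 : (fun w => rot deg f (w ++ [c])) =
          fun w => sgn K (totalDeg deg [c] * totalDeg deg w) * slice c f w := by
        ext w; rw [rot_append]; rfl
      have h3 := rot_pow_append deg (mergeFirst ξ f) [e, c] u
      rw [show [e, c].length = 2 from rfl, pow_two, Module.End.mul_apply] at h3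
      have h4 : (u ++ [e]) ++ [c] = u ++ [e, c] := by simp
      simp only [hoch_apply, map_add, Pi.sub_apply, Pi.add_apply]
      conv_rhs => rw [h4, oddDer_quad_append h (rot deg f), h2, h1]
      have h5 : rot deg (rot deg (mergeFirst ξ f)) (u ++ [e] ++ [c]) =
          sgn K (totalDeg deg u) *
        Finsupp.linearCombination K (fun x => rot deg f (u ++ [x])) (ξ [e, c]) := by
        rw [h4, h3, List.cons_append, List.cons_append, List.nil_append, mergeFirst_cons, contr_apply,
          Finsupp.linearCombination_apply, Finsupp.sum, Finset.mul_sum, Finset.mul_sum]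
        refine Finset.sum_congr rfl fun x hx => ?_
        have hx := hd _ _ (Finsupp.mem_support_iff.1 hx)
        rw [rot_append, smul_eq_mul]
        have : sgn K (totalDeg deg u * totalDeg deg [e, c]) =
            sgn K (totalDeg deg u) * sgn K (totalDeg deg [x] * totalDeg deg u) := by
          rw [← sgn_add]
          refine sgn_congr ?_
          obtain ⟨z, hz⟩ := hx
          exact ⟨totalDeg deg u * z, by linear_combination totalDeg deg u * hz⟩
        rw [this]; ring
      rw [h5, rot_append deg (oddDer deg ξ f), rot_append deg (mergeFirst ξ f),
        oddDer_quad_cons h f c, mul_add (totalDeg deg [c]), sgn_add, mul_one, h4]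
      ring

end Quadratic

section LieOperator

variable {ι K V : Type*} [CommRing K] [Ring V] [Algebra K V] {b : Module.Basis ι K V}
  {deg : ι → ℤ}

theorem contr_ff (k l : ι) (f : Series ι K) (w) :
    contr (lieOpCoeff b deg) [(k, false), (l, false)] f w =
      Finsupp.linearCombination K (fun c => f ((c, false) :: w)) (structureCoeff b deg k l) := by
  rw [contr_eq, lieOpCoeff, Finsupp.linearCombination_mapDomain]; rfl

theorem contr_tf (k l : ι) (f : Series ι K) (w) :
    contr (lieOpCoeff b deg) [(k, true), (l, false)] f w =
      -Finsupp.linearCombination K (fun c => f ((c, true) :: w)) (structureCoeff b deg k l) := by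
  rw [contr_eq, lieOpCoeff, map_neg, Finsupp.linearCombination_mapDomain]; rfl

theorem contr_ft (k l : ι) (f : Series ι K) (w) :
    contr (lieOpCoeff b deg) [(k, false), (l, true)] f w = -(sgn K (1 - deg k) *
      Finsupp.linearCombination K (fun c => f ((c, true) :: w)) (structureCoeff b deg k l)) := by
  rw [contr_eq, lieOpCoeff, map_neg, Units.smul_def, map_zsmul,
    Finsupp.linearCombination_mapDomain, zsmul_eq_mul]; rfl

theorem contr_tt (k l : ι) (f : Series ι K) (w) :
    contr (lieOpCoeff b deg) [(k, true), (l, true)] f w = 0 := by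
  rw [contr_eq, lieOpCoeff_tt, map_zero]

theorem formDeg_merge {x : List (Letter ι)} {a} (h : lieOpCoeff b deg x a ≠ 0) (u v) :
    formDeg (u ++ x ++ v) = formDeg (u ++ a :: v) := by
  obtain ⟨k, l, p, q, -, -, h2⟩ := lieOpCoeff_ne_zero h
  rw [formDeg_append, formDeg_append, formDeg_append, ← List.singleton_append, formDeg_append, h2]
  ring

theorem length_merge {x : List (Letter ι)} {a} (h : lieOpCoeff b deg x a ≠ 0) (u v) :
    (u ++ x ++ v).length = (u ++ a :: v).length + 1 := by
  obtain ⟨k, l, p, q, rfl, -, -⟩ := lieOpCoeff_ne_zero h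
  simp; ring

theorem pureCond_merge (u x v) (a : Letter ι) (h : lieOpCoeff b deg x a ≠ 0) (c : K)
    (hc : c ∈ pureCond ι K (u ++ a :: v)) :
    lieOpCoeff b deg x a * c ∈ pureCond ι K (u ++ x ++ v) := by
  have h1 : u ++ x ++ v ≠ [] := by
    rw [← List.length_pos_iff, length_merge h]; omega
  have h2 : u ++ a :: v ≠ [] := by simp
  rw [pureCond, formDeg_merge h]
  rw [pureCond] at hc
  simp only [h1, h2, ne_eq, not_false_eq_true, true_and] at hc ⊢
  split_ifs at hc ⊢
  · trivial
  · rw [AddSubgroup.mem_bot] at hc ⊢; rw [hc, mul_zero]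

theorem Pure.hoch {g : Series ι K} (hg : Pure g) : Pure (hoch deg (lieOpCoeff b deg) g) :=
  pure_iff.2 (((pure_iff.1 hg).oddDer pureCond_merge).add
    (((pure_iff.1 hg).mergeFirst pureCond_merge).rot permInv_pureCond))

theorem Pure.apply_true {g : Series ι K} (hg : Pure g) (u k v) : g (u ++ (k, true) :: v) = 0 := by
  by_contra h
  have := hg.formDeg _ h
  rw [formDeg_append, formDeg_cons_true] at this
  omega

theorem Pure.cons_true {g : Series ι K} (hg : Pure g) (k v) : g ((k, true) :: v) = 0 :=
  hg.apply_true [] k v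

/-- On normal forms the Lie operator is, up to sign, the Hochschild differential. -/
theorem normalForm_lieOp_ofNormalForm {g : Series ι K} (hg : Pure g) :
    normalForm deg (lieOp b deg (ofNormalForm g)) = -hoch deg (lieOpCoeff b deg) g := by
  have hq := quad_lieOpCoeff (b := b) (deg := deg)
  ext w
  match w with
  | [] => rw [normalForm, Pi.neg_apply, hg.hoch.nil]; simp
  | (k, true) :: u => rw [normalForm, Pi.neg_apply, hg.hoch.cons_true]; simp
  | (k, false) :: u =>
    rw [normalForm, LinearMap.comp_apply, undiff_false, LinearMap.comp_apply, lieOp,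
      mult_oddDer₂ deg hq.linQuad]
    set f := mult (ofNormalForm g) with hf
    have hft (k u) : f ((k, true) :: u) = g ((k, false) :: u) := mult_ofNormalForm_true g k u
    have hff (k u) : f ((k, false) :: u) = 0 := mult_ofNormalForm_false g k u
    have hst (k) : slice (k, true) f = slice (k, false) g := by ext u; exact hft k u
    have hsf (k) : slice (k, false) f = 0 := by ext u; exact hff k u
    -- `f` is supported on words of form degree one that start with a letter `d(t k)`
    have hsupp (w) (hw : f w ≠ 0) : ∃ k u, w = (k, true) :: u ∧ formDeg u = 0 := by
      match w with
      | [] => exact absurd (by rw [hf, mult_nil]; rfl) hw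
      | (k, false) :: u => exact absurd (hff k u) hw
      | (k, true) :: u =>
        rw [hft] at hw
        exact ⟨k, u, rfl, by rw [← formDeg_cons_false k]; exact hg.formDeg _ hw⟩
    have hzero (u₂ u₁ : List (Letter ι)) (k) (hu : 2 ≤ u₂.length) :
        oddDer deg (lieOpCoeff b deg) f (u₂ ++ (k, true) :: u₁) = 0 := by
      refine oddDer_apply_eq_zero fun p x v a hw hx => ?_
      by_contra hne
      obtain ⟨l, z, hz, hz0⟩ := hsupp _ hne
      have h1 := formDeg_merge hx p v
      rw [← hw, hz, formDeg_cons_true, formDeg_append, formDeg_cons_true, hz0] at h1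
      have h2 : formDeg u₂ = 0 := by omega
      obtain ⟨y₁, y₂, u₃, rfl⟩ : ∃ y₁ y₂ u₃, u₂ = y₁ :: y₂ :: u₃ := by
        match u₂, hu with
        | y₁ :: y₂ :: u₃, _ => exact ⟨_, _, _, rfl⟩
      obtain ⟨k', l', p', q', rfl, -, h3⟩ := lieOpCoeff_ne_zero hx
      cases p with
      | nil =>
        simp only [List.cons_append, List.nil_append, List.cons.injEq] at hw hz
        obtain ⟨rfl, rfl, -⟩ := hw
        rw [hz.1] at h3
        cases p' <;> cases q' <;> simp [formDeg] at h2 h3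
      | cons y p =>
        simp only [List.cons_append, List.cons.injEq] at hw hz
        rw [hw.1, hz.1, formDeg_cons_true] at h2
        omega
    have h1 : oddDer deg (lieOpCoeff b deg) f ((k, true) :: u) =
        -oddDer deg (lieOpCoeff b deg) g ((k, false) :: u) := by
      rw [oddDer_quad_cons hq, oddDer_quad_cons hq, hst, totalDeg_true, totalDeg_false, sgn_add,
        sgn_odd odd_one, neg_add, mul_neg_one, neg_mul]
      congr 1
      match u with
      | [] => simp
      | (l, false) :: u =>
        rw [mergeFirst_cons, mergeFirst_cons, contr_tf, contr_ff]; simp only [hft]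
      | (l, true) :: u =>
        rw [mergeFirst_cons, mergeFirst_cons, contr_tt, contr_ft]; simp only [hg.cons_true]
        simp [Finsupp.linearCombination_apply]
    rw [cyc_cons, h1, Pi.neg_apply, hoch_apply, Pi.add_apply, neg_add]
    congr 1
    induction u using List.reverseRecOn with
    | nil =>
      have := rot_append deg (mergeFirst (lieOpCoeff b deg) g) [] (k, false)
      rw [List.nil_append] at this
      simp [this]
    | append_singleton u c _ =>
      have hlen : (u ++ [c]).length = u.length + 1 := by simp
      rw [hlen, Finset.sum_range_succ', Finset.sum_eq_zero, zero_add]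
      · have h2 : (u ++ [c]).take (u.length + 1 - (0 + 1)) = u := by simp
        have h3 : (u ++ [c]).drop (u.length + 1 - (0 + 1)) = [c] := by simp
        rw [h2, h3, ← List.cons_append, rot_append, List.singleton_append, mergeFirst_cons,
          oddDer_quad_cons hq, mergeFirst_cons, totalDeg_cons deg _ u, totalDeg_cons deg _ u,
          totalDeg_true, totalDeg_false]
        obtain ⟨l, _ | _⟩ := c
        · rw [hsf, map_zero, Pi.zero_apply, mul_zero, zero_add, contr_ft, contr_ff, totalDeg_false]
          simp only [hft]
          rw [mul_neg, ← mul_assoc, ← sgn_add]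
          congr 2
          exact sgn_congr ⟨1 - deg l, by ring⟩
        · have h4 : slice (l, true) f = slice (l, false) g := hst l
          have h5 : oddDer deg (lieOpCoeff b deg) (slice (l, false) g) ((k, true) :: u) = 0 := by
            refine oddDer_apply_eq_zero fun p x v a hw hx => ?_
            by_contra hne
            have h6 := hg.formDeg _ hne
            rw [formDeg_cons_false, ← formDeg_merge hx, ← hw, formDeg_cons_true] at h6
            omega
          rw [h4, h5, contr_tt, contr_tf]
          simp only [hg.cons_true]
          simp [Finsupp.linearCombination_apply]
      · intro r hr
        rw [hzero _ _ _ _, mul_zero]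
        have := Finset.mem_range.1 hr
        simp; omega

theorem oddDer_deRham_cons_true (f : Series ι K) (k w) :
    oddDer deg (deRhamCoeff K) f ((k, true) :: w) =
      sgn K (totalDeg deg [(k, true)]) * oddDer deg (deRhamCoeff K) (slice (k, true) f) w +
        f ((k, false) :: w) := by
  have h1 (w) : contr (deRhamCoeff K) [(k, true)] f w = f ((k, false) :: w) := by
    rw [contr_eq]
    simp [deRhamCoeff]
  cases w with
  | nil => rw [oddDer_singleton _ (isLieDer_deRham deg).linQuad,
      oddDer_nil _ (isLieDer_deRham deg).linQuad, h1]; simp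
  | cons c w =>
    rw [oddDer_cons_cons _ (isLieDer_deRham deg).linQuad, h1,
      contr_eq_zero (deRhamCoeff K) (x := [(k, true), c]) rfl]
    simp

theorem oddDer_deRham_cons_false (f : Series ι K) (k w) :
    oddDer deg (deRhamCoeff K) f ((k, false) :: w) =
      sgn K (totalDeg deg [(k, false)]) *
        oddDer deg (deRhamCoeff K) (slice (k, false) f) w := by
  cases w with
  | nil => rw [oddDer_singleton _ (isLieDer_deRham deg).linQuad,
      oddDer_nil _ (isLieDer_deRham deg).linQuad, contr_eq_zero (deRhamCoeff K) rfl]; simp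
  | cons c w =>
    rw [oddDer_cons_cons _ (isLieDer_deRham deg).linQuad,
      contr_eq_zero (deRhamCoeff K) (x := [(k, false)]) rfl,
      contr_eq_zero (deRhamCoeff K) (x := [(k, false), c]) rfl]
    simp

theorem oddDer_deRham_append {h : Series ι K} (hh : ∀ w, h w ≠ 0 → formDeg w = 0) (u k v) :
    oddDer deg (deRhamCoeff K) h (u ++ (k, true) :: v) =
      sgn K (totalDeg deg u) * h (u ++ (k, false) :: v) := by
  have hs {h : Series ι K} (hh : ∀ w, h w ≠ 0 → formDeg w = 0) (k) : slice (k, true) h = 0 := by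
    ext w
    by_contra h'
    have := hh _ h'
    rw [formDeg_cons_true] at this; omega
  induction u generalizing h with
  | nil => rw [List.nil_append, oddDer_deRham_cons_true, hs hh]; simp
  | cons a u ih =>
    obtain ⟨l, _ | _⟩ := a
    · rw [List.cons_append, oddDer_deRham_cons_false, ih, totalDeg_cons deg _ u, sgn_add]
      · simp [mul_assoc]
      · intro w hw
        rw [← formDeg_cons_false l]; exact hh _ hw
    · rw [List.cons_append, oddDer_deRham_cons_true, hs hh, map_zero]
      have h1 : h ((l, true) :: (u ++ (k, false) :: v)) = 0 := congrFun (hs hh l) _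
      have h2 : h ((l, false) :: (u ++ (k, true) :: v)) = 0 := by
        by_contra h'
        have := hh _ h'
        rw [formDeg_cons_false, formDeg_append, formDeg_cons_true] at this; omega
      rw [List.cons_append, h1, h2]; simp

/-- The normal form of the de Rham differential of a zero-form is its cyclic trace. -/
theorem normalForm_deRham {F : Series₂ ι K}
    (hF : ∀ u v, F (u, v) ≠ 0 → formDeg u + formDeg v = 0) (h0 : F ([], []) = 0) :
    normalForm deg (deRham K deg F) = cyc deg (mult F) := by
  have hp : Pure (mult F) := by
    refine ⟨by simpa using h0, fun w hw => ?_⟩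
    rw [mult_apply] at hw
    obtain ⟨k, -, hk⟩ := Finset.exists_ne_zero_of_sum_ne_zero hw
    rw [← List.take_append_drop k w, formDeg_append, hF _ _ hk]
  have hc : Pure (cyc deg (mult F)) := pure_iff.2 ((pure_iff.1 hp).cyc permInv_pureCond)
  ext w
  match w with
  | [] => simp [normalForm, hc.nil]
  | (k, true) :: u => rw [hc.cons_true]; simp [normalForm]
  | (k, false) :: u =>
    rw [normalForm, LinearMap.comp_apply, undiff_false, LinearMap.comp_apply, deRham,
      mult_oddDer₂ deg (isLieDer_deRham deg).linQuad, cyc_cons, cyc_cons]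
    have := oddDer_deRham_append (deg := deg) hp.formDeg [] k u
    simp only [List.nil_append, totalDeg_nil, sgn_zero, one_mul] at this
    rw [this]
    congr 1
    refine Finset.sum_congr rfl fun r _ => ?_
    rw [oddDer_deRham_append hp.formDeg, ← mul_assoc, ← sgn_add]
    congr 1
    refine sgn_congr ?_
    rw [totalDeg_cons deg (k, true), totalDeg_cons deg (k, false), totalDeg_true, totalDeg_false]
    exact ⟨totalDeg deg (u.drop (u.length - (r + 1))), by ring⟩

theorem lieOp_lieOp_letter_false (hb : IsGradedComm b deg) (c : ι) :
    oddDer deg (lieOpCoeff b deg) (oddDer deg (lieOpCoeff b deg) (letter K (c, false))) = 0 := by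
  have hq := quad_lieOpCoeff (b := b) (deg := deg)
  rw [oddDer_letter hq.linQuad]
  ext w
  by_cases hw : w.length = 3
  · obtain ⟨⟨k, p⟩, ⟨l, q⟩, ⟨m, r⟩, rfl⟩ := List.length_eq_three.1 hw
    have h1 (f : Series ι K) (a) : oddDer deg (lieOpCoeff b deg) f [a] = 0 := by
      rw [oddDer_singleton deg hq.linQuad, contr_eq_zero _ (hq [a] (by simp))]; rfl
    rw [oddDer_quad_cons hq, oddDer_quad_cons hq, h1, mergeFirst_cons, mergeFirst_cons]
    have hass := structureCoeff_assoc hb k l m c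
    have h0 (s : ι →₀ K) : Finsupp.linearCombination K (fun _ : ι => (0 : K)) s = 0 := by
      simp [Finsupp.linearCombination_apply]
    cases p <;> cases q <;> cases r <;> simp only [contr_ff, contr_tf, contr_ft, contr_tt,
      slice_apply, lieOpCoeff_ff_false, lieOpCoeff_tf_false, lieOpCoeff_ft_false,
      lieOpCoeff_tt, Finsupp.coe_zero, Pi.zero_apply, mul_zero, neg_zero, h0, add_zero,
      totalDeg_false, zero_add, hass]
  · refine oddDer_apply_eq_zero fun u x v a hw' hx => ?_
    rw [hq, Finsupp.coe_zero, Pi.zero_apply]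
    rw [hw', length_merge hx] at hw
    omega

theorem lieOp_deRham_letter_false (c : ι) :
    oddDer deg (lieOpCoeff b deg) (letter K (c, true)) +
      oddDer deg (deRhamCoeff K) (oddDer deg (lieOpCoeff b deg) (letter K (c, false))) = 0 := by
  have hq := quad_lieOpCoeff (b := b) (deg := deg)
  rw [oddDer_letter hq.linQuad, oddDer_letter hq.linQuad]
  ext w
  rw [Pi.add_apply, Pi.zero_apply]
  by_cases hw : w.length = 2
  · obtain ⟨⟨k, p⟩, ⟨l, q⟩, rfl⟩ := List.length_eq_two.1 hw
    have h1 (f : Series ι K) : oddDer deg (deRhamCoeff K) f [] = 0 :=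
      oddDer_nil deg (isLieDer_deRham deg).linQuad f
    cases p <;> cases q <;> simp only [lieOpCoeff_ff_false, lieOpCoeff_ff_true,
      lieOpCoeff_tf_true, lieOpCoeff_tf_false, lieOpCoeff_ft_true, lieOpCoeff_ft_false,
      lieOpCoeff_tt, Finsupp.coe_zero, Pi.zero_apply, oddDer_deRham_cons_true,
      oddDer_deRham_cons_false, slice_apply, totalDeg_false, h1, mul_zero, zero_add, add_zero,
      neg_add_cancel]
  · rw [hq w hw, Finsupp.coe_zero, Pi.zero_apply, zero_add]
    refine oddDer_apply_eq_zero fun u x v a hw' hx => ?_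
    obtain ⟨k, rfl, rfl⟩ := deRhamCoeff_ne_zero hx
    rw [hq, Finsupp.coe_zero, Pi.zero_apply]
    rw [hw'] at hw
    simpa using hw

variable [Algebra ℚ K] [TopologicalSpace K] [DiscreteTopology K]

theorem lieOp_deRham_letter_true (c : ι) :
    oddDer deg (deRhamCoeff K) (oddDer deg (lieOpCoeff b deg) (letter K (c, true))) = 0 := by
  have h1 : oddDer deg (lieOpCoeff b deg) (letter K (c, true)) =
      -oddDer deg (deRhamCoeff K) (oddDer deg (lieOpCoeff b deg) (letter K (c, false))) :=
    eq_neg_of_add_eq_zero_left (lieOp_deRham_letter_false c)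
  rw [h1, map_neg, oddDer_deRham_deRham, neg_zero]

/-- The Lie operator anticommutes with the de Rham differential. -/
theorem lieOp_deRham (hb : IsGradedComm b deg) (F : Series₂ ι K) :
    lieOp b deg (deRham K deg F) = -deRham K deg (lieOp b deg F) := by
  have := anti₂_eq (isLieDer_lieOp hb).linQuad (isLieDer_lieOp hb).odd
    (isLieDer_deRham (K := K) deg).linQuad (isLieDer_deRham deg).odd 0 (fun a => ?_) F
  · rw [eq_neg_iff_add_eq_zero]
    refine this.trans ?_
    ext; simp
  · obtain ⟨k, _ | _⟩ := a
    · rw [anti_apply, deRham_letter_false, lieOp_deRham_letter_false]; simp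
    · rw [anti_apply, deRham_letter_true, lieOp_deRham_letter_true]; simp

theorem anti_lieOp_deRham (hb : IsGradedComm b deg) (f : Series ι K) :
    oddDer deg (lieOpCoeff b deg) (oddDer deg (deRhamCoeff K) f) =
      -oddDer deg (deRhamCoeff K) (oddDer deg (lieOpCoeff b deg) f) := by
  have := anti_eq (isLieDer_lieOp hb).linQuad (isLieDer_lieOp hb).odd
    (isLieDer_deRham (K := K) deg).linQuad (isLieDer_deRham deg).odd 0 (fun a => ?_) f
  · rw [eq_neg_iff_add_eq_zero]
    refine this.trans ?_
    ext; simp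
  · obtain ⟨k, _ | _⟩ := a
    · rw [anti_apply, deRham_letter_false, lieOp_deRham_letter_false]; simp
    · rw [anti_apply, deRham_letter_true, lieOp_deRham_letter_true]; simp

/-- The Lie operator is a differential. -/
theorem lieOp_lieOp (hb : IsGradedComm b deg) (F : Series₂ ι K) :
    lieOp b deg (lieOp b deg F) = 0 := by
  have := anti₂_eq (isLieDer_lieOp hb).linQuad (isLieDer_lieOp hb).odd
    (isLieDer_lieOp hb).linQuad (isLieDer_lieOp hb).odd 0 (fun a => ?_) F
  · have h2 : (2 : ℚ) • lieOp b deg (lieOp b deg F) = 0 := by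
      rw [two_smul]
      refine this.trans ?_
      ext; simp
    simpa using congrArg ((2⁻¹ : ℚ) • ·) h2
  · obtain ⟨k, _ | _⟩ := a
    · rw [anti_apply, lieOp_lieOp_letter_false hb]; simp
    · have h1 : oddDer deg (lieOpCoeff b deg) (letter K (k, true)) =
          -oddDer deg (deRhamCoeff K) (oddDer deg (lieOpCoeff b deg) (letter K (k, false))) :=
        eq_neg_of_add_eq_zero_left (lieOp_deRham_letter_false k)
      have h2 : oddDer deg (lieOpCoeff b deg)
          (oddDer deg (lieOpCoeff b deg) (letter K (k, true))) = 0 := by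
        rw [h1, map_neg, anti_lieOp_deRham hb, lieOp_lieOp_letter_false hb]; simp
      rw [anti_apply, h2]; simp

end LieOperator

/-! ### The Dynkin operator -/

section Dynkin

variable {ι K : Type*} [CommRing K] (deg : ι → ℤ)

/-- The operator `a v ↦ a (Φ v)` for letters `a`. -/
def prepend (Φ : Series ι K →ₗ[K] Series ι K) : Series ι K →ₗ[K] Series ι K :=
  LinearMap.pi fun w => match w with
    | [] => 0
    | a :: v => LinearMap.proj v ∘ₗ Φ ∘ₗ slice a

@[simp] theorem prepend_nil (Φ : Series ι K →ₗ[K] Series ι K) (f) : prepend Φ f [] = 0 := rfl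
@[simp] theorem prepend_cons (Φ : Series ι K →ₗ[K] Series ι K) (f a v) :
    prepend Φ f (a :: v) = Φ (slice a f) v := rfl

/-- The projection to words of a given length. -/
def projLength (n : ℕ) : Series ι K →ₗ[K] Series ι K :=
  LinearMap.pi fun w => if w.length = n then LinearMap.proj w else 0

theorem projLength_apply (n : ℕ) (f : Series ι K) (w) :
    projLength n f w = if w.length = n then f w else 0 := by
  simp only [projLength, LinearMap.pi_apply]; split_ifs <;> rfl

theorem continuous_projLength [TopologicalSpace K] [DiscreteTopology K] (n : ℕ) :
    Continuous (projLength n : Series ι K →ₗ[K] Series ι K) := by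
  refine continuous_pi fun w => ?_
  simp only [projLength_apply]
  split_ifs <;> fun_prop

theorem continuous_slice [TopologicalSpace K] [DiscreteTopology K] (a : Letter ι) :
    Continuous (slice a : Series ι K →ₗ[K] Series ι K) :=
  continuous_pi fun w => by simp only [slice_apply]; fun_prop

theorem continuous_prepend [TopologicalSpace K] [DiscreteTopology K]
    {Φ : Series ι K →ₗ[K] Series ι K} (hΦ : Continuous Φ) : Continuous (prepend Φ) := by
  refine continuous_pi fun w => ?_
  cases w with
  | nil => simp only [prepend_nil]; fun_prop
  | cons a v =>
    simp only [prepend_cons]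
    exact (continuous_apply v).comp (hΦ.comp (continuous_slice a))

/-- The Dynkin operator on words of length at most `n`. -/
def dynkinAux : ℕ → Series ι K →ₗ[K] Series ι K
  | 0 => 0
  | n + 1 => projLength 1 + (LinearMap.id - rot deg) ∘ₗ prepend (dynkinAux n)

/-- The Dynkin operator, which sends a word `a₁ ⋯ aₙ` to the iterated bracket
`[a₁, [a₂, …, [aₙ₋₁, aₙ]]]`. -/
def dynkin : Series ι K →ₗ[K] Series ι K :=
  LinearMap.pi fun w => LinearMap.proj w ∘ₗ dynkinAux deg w.length

theorem dynkin_apply (f : Series ι K) (w) : dynkin deg f w = dynkinAux deg w.length f w := rfl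

/-- The Dynkin operator is `1 - t` applied to an explicit series, for the rotation `t`. -/
theorem dynkin_eq (f : Series ι K) :
    dynkin deg f = projLength 1 f +
      (prepend (dynkin deg) f - rot deg (prepend (dynkin deg) f)) := by
  ext w
  induction w using List.reverseRecOn with
  | nil => simp [dynkin_apply, dynkinAux, projLength_apply]
  | append_singleton u c _ =>
    rw [dynkin_apply, List.length_append, List.length_singleton, dynkinAux]
    simp only [LinearMap.add_apply, LinearMap.comp_apply, LinearMap.sub_apply, LinearMap.id_apply,
      Pi.add_apply, Pi.sub_apply, rot_append, prepend_cons, dynkin_apply]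
    congr 2
    cases u with
    | nil => rfl
    | cons a u =>
      simp only [List.cons_append, prepend_cons, dynkin_apply, List.length_append,
        List.length_cons, List.length_nil]

theorem continuous_dynkin [TopologicalSpace K] [DiscreteTopology K] :
    Continuous (dynkin deg : Series ι K →ₗ[K] Series ι K) := by
  have (n : ℕ) : Continuous (dynkinAux deg n : Series ι K →ₗ[K] Series ι K) := by
    induction n with
    | zero => exact continuous_const
    | succ n ih =>
      have h := continuous_prepend ih
      exact (continuous_projLength 1).add (h.sub ((continuous_rot deg).comp h))
  refine continuous_pi fun w => ?_
  simp only [dynkin_apply]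
  exact (continuous_apply w).comp (this w.length)

variable {deg}

theorem Adm.dynkin {S : List (Letter ι) → AddSubgroup K} (hS : PermInv S) {f : Series ι K}
    (hf : Adm S f) : Adm S (dynkin deg f) := by
  have key (n : ℕ) : ∀ {S : List (Letter ι) → AddSubgroup K}, PermInv S → ∀ {f : Series ι K},
      Adm S f → Adm S (dynkinAux deg n f) := by
    induction n with
    | zero => intro S _ f _ w; exact (S w).zero_mem
    | succ n ih =>
      intro S hS f hf
      have h1 : Adm S (prepend (dynkinAux deg n) f) := by
        intro w
        cases w with
        | nil => exact (S _).zero_mem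
        | cons a v =>
          exact ih (S := fun w => S (a :: w)) (fun w w' h => hS _ _ (h.cons a))
            (fun w => hf (a :: w)) v
      have h2 : Adm S (projLength 1 f) := by
        intro w
        rw [projLength_apply]
        split_ifs
        · exact hf w
        · exact (S w).zero_mem
      exact h2.add (h1.sub (h1.rot hS))
  exact fun w => key w.length hS hf w

theorem Adm.prepend_dynkin {S : List (Letter ι) → AddSubgroup K} (hS : PermInv S) {f : Series ι K}
    (hf : Adm S f) : Adm S (prepend (Harrison.dynkin deg) f) := by
  intro w
  cases w with
  | nil => exact (S _).zero_mem
  | cons a v =>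
    exact Adm.dynkin (S := fun w => S (a :: w)) (fun w w' h => hS _ _ (h.cons a))
      (fun w => hf (a :: w)) v

theorem Homog.dynkin {n : ℤ} {f : Series ι K} (hf : Homog deg n f) :
    Homog deg n (dynkin deg f) := by
  let S : List (Letter ι) → AddSubgroup K := fun w => if totalDeg deg w = n then ⊤ else ⊥
  have hS : PermInv S := by
    intro w w' h
    have : totalDeg deg w = totalDeg deg w' := by
      rw [totalDeg, totalDeg, formDeg, formDeg, h.countP_eq, internalDeg, internalDeg,
        (h.map _).sum_eq]
    simp only [S, this]
  have h1 : Adm S f := by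
    intro w
    simp only [S]
    split_ifs with h
    · trivial
    · rw [AddSubgroup.mem_bot]; by_contra h'; exact h (hf w h')
  intro w hw
  have := h1.dynkin (deg := deg) hS w
  simp only [S] at this
  split_ifs at this with h
  · exact h
  · exact absurd this hw

/-- `1 - t` turns the product with a letter into the commutator. -/
theorem rot_letter_conc (a : Letter ι) (f : Series ι K) :
    conc (letter K a) f - rot deg (conc (letter K a) f) = bracket deg (letter K a) f := by
  rw [bracket_eq, map_sub]
  congr 1
  ext w
  induction w using List.reverseRecOn with
  | nil => rw [rot_nil, letter_conc_nil, mult_nil, flipL_apply]; simp [tmul, letter]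
  | append_singleton u c _ =>
    rw [rot_append, letter_conc_cons, mult_apply, Finset.sum_eq_single u.length]
    · rw [flipL_apply]
      have h1 : (u ++ [c]).take u.length = u := by simp
      have h2 : (u ++ [c]).drop u.length = [c] := by simp
      rw [h1, h2]
      by_cases h : c = a
      · subst h; simp [tmul, letter, mul_comm]
      · simp [tmul, letter, h]
    · intro k hk hku
      have h1 : (u ++ [c]).drop k ≠ [a] := by
        intro h
        have := congrArg List.length h
        simp at this
        omega
      rw [flipL_apply]
      simp only [tmul, letter, if_neg h1, zero_mul, mul_zero]
    · intro h; simp at h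

theorem prepend_letter_conc (Φ : Series ι K →ₗ[K] Series ι K) (a : Letter ι) (f : Series ι K) :
    prepend Φ (conc (letter K a) f) = conc (letter K a) (Φ f) := by
  ext w
  cases w with
  | nil => simp [letter]
  | cons c v =>
    rw [prepend_cons, letter_conc_cons]
    have : slice c (conc (letter K a) f) = if c = a then f else 0 := by
      ext w; rw [slice_apply, letter_conc_cons]; split_ifs <;> rfl
    rw [this]
    split_ifs <;> simp

theorem dynkin_letter_conc (a : Letter ι) (f : Series ι K) :
    dynkin deg (conc (letter K a) f) =
      f [] • letter K a + bracket deg (letter K a) (dynkin deg f) := by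
  rw [dynkin_eq, prepend_letter_conc, rot_letter_conc]
  congr 1
  ext w
  rw [projLength_apply]
  split_ifs with h
  · obtain ⟨c, rfl⟩ := List.length_eq_one_iff.1 h
    rw [letter_conc_cons]
    simp [letter]
  · have : w ≠ [a] := by rintro rfl; simp at h
    simp [letter, this]

theorem dynkin_one : dynkin deg (Pi.single [] 1 : Series ι K) = 0 := by
  have h : prepend (dynkin deg) (Pi.single [] 1 : Series ι K) = 0 := by
    ext w
    cases w with
    | nil => rfl
    | cons a v =>
      have : slice a (Pi.single [] 1 : Series ι K) = 0 := by ext; simp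
      rw [prepend_cons, this, map_zero]; rfl
  rw [dynkin_eq, h, map_zero, sub_zero, add_zero]
  ext w
  rw [projLength_apply]
  split_ifs with hw
  · have : w ≠ [] := by rintro rfl; simp at hw
    simp [this]
  · rfl

/-- The Dynkin operator takes values in Lie series. -/
theorem dynkin_mem [TopologicalSpace K] [DiscreteTopology K] (f : Series ι K) :
    dynkin deg f ∈ lieForms K deg := by
  refine map_mem_of_single isClosed_lieForms _ (continuous_dynkin deg) (fun w => ?_) f
  induction w with
  | nil => rw [dynkin_one]; exact Submodule.zero_mem _
  | cons a w ih =>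
    have h1 : (Pi.single (a :: w) 1 : Series ι K) = conc (letter K a) (Pi.single w 1) := by
      rw [letter_eq, conc_single]; rfl
    rw [h1, dynkin_letter_conc]
    exact Submodule.add_mem _ (Submodule.smul_mem _ _ (IsLieMonomial.of a).mem)
      (bracket_mem (IsLieMonomial.of a).mem ih)

theorem IsLieMonomial.apply_nil {f : Series ι K} (hf : IsLieMonomial K deg f) : f [] = 0 := by
  cases hf with
  | of a => simp [letter]
  | bracket _ _ => simp [bracket_eq, flipL_apply]

/-- The graded Jacobi identity. -/
theorem jacobi {f g h : Series ι K} {m n p : ℤ} (hf : Homog deg m f) (hg : Homog deg n g)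
    (hh : Homog deg p h) :
    bracket deg (bracket deg f g) h = bracket deg f (bracket deg g h) -
      sgn K (m * n) • bracket deg g (bracket deg f h) := by
  rw [bracket_of_homog (hf.bracket hg) hh, bracket_of_homog hf (hg.bracket hh),
    bracket_of_homog hg (hf.bracket hh), bracket_of_homog hf hg, bracket_of_homog hg hh,
    bracket_of_homog hf hh]
  simp only [← concL_apply, map_sub, map_smul, LinearMap.sub_apply, LinearMap.smul_apply]
  simp only [concL_apply, conc_assoc, smul_sub, smul_smul, ← sgn_add]
  have h1 : sgn K (m * n + (n * (m + p) + m * p)) = sgn K ((m + n) * p) :=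
    sgn_congr ⟨m * n, by ring⟩
  have h2 : sgn K (m * n + n * (m + p)) = sgn K (n * p) := sgn_congr ⟨m * n, by ring⟩
  have h3 : sgn K (m * n + m * p) = sgn K (m * (n + p)) := sgn_congr ⟨0, by ring⟩
  have h4 : sgn K ((m + n) * p + m * n) = sgn K (m * (n + p) + n * p) := sgn_congr ⟨0, by ring⟩
  rw [h1, h2, h3, h4]
  abel

/-- The left multiplication by a Lie series turns into the adjoint action under the Dynkin
operator. -/
theorem dynkin_conc {x : Series ι K} (hx : IsLieMonomial K deg x) {f : Series ι K} {n : ℤ}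
    (hf : Homog deg n f) (h0 : f [] = 0) :
    dynkin deg (conc x f) = bracket deg x (dynkin deg f) := by
  induction hx generalizing f n with
  | of a => rw [dynkin_letter_conc, h0]; simp
  | @bracket x y hx hy ihx ihy =>
    obtain ⟨p, hp⟩ := hx.homog
    obtain ⟨q, hq⟩ := hy.homog
    have h1 : conc (bracket deg x y) f = conc x (conc y f) - sgn K (p * q) • conc y (conc x f) := by
      rw [bracket_of_homog hp hq, ← concL_apply, map_sub, map_smul]
      simp only [LinearMap.sub_apply, LinearMap.smul_apply, concL_apply, conc_assoc]
    rw [h1, map_sub, map_smul, ihx (hq.conc hf) (by simp [h0]), ihy (hp.conc hf) (by simp [h0]),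
      ihy hf h0, ihx hf h0, jacobi hp hq hf.dynkin]

theorem dynkin_monomial {x : Series ι K} (hx : IsLieMonomial K deg x) :
    dynkin deg x = fun w => (w.length : K) * x w := by
  suffices h : ∃ n : ℕ, (∀ w, x w ≠ 0 → w.length = n) ∧ dynkin deg x = (n : K) • x by
    obtain ⟨n, hn, h⟩ := h
    rw [h]
    ext w
    by_cases hw : x w = 0
    · simp [hw]
    · simp [hn w hw]
  induction hx with
  | of a =>
    refine ⟨1, fun w hw => ?_, ?_⟩
    · have : w = [a] := by by_contra h; simp [letter, h] at hw
      simp [this]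
    · have := dynkin_letter_conc (deg := deg) a (Pi.single [] 1 : Series ι K)
      rw [conc_one, dynkin_one, ← bracketL_apply] at this
      simpa using this
  | @bracket x y hx hy ihx ihy =>
    obtain ⟨p, hp⟩ := hx.homog
    obtain ⟨q, hq⟩ := hy.homog
    obtain ⟨m, hm, h1⟩ := ihx
    obtain ⟨n, hn, h2⟩ := ihy
    refine ⟨m + n, fun w hw => ?_, ?_⟩
    · rw [bracket_of_homog hp hq] at hw
      by_cases h : conc x y w = 0
      · rw [Pi.sub_apply, h, zero_sub, neg_ne_zero] at hw
        have hw := right_ne_zero_of_mul hw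
        rw [conc, mult_apply] at hw
        obtain ⟨k, -, hk⟩ := Finset.exists_ne_zero_of_sum_ne_zero hw
        rw [← List.take_append_drop k w, List.length_append, hn _ (left_ne_zero_of_mul hk),
          hm _ (right_ne_zero_of_mul hk), add_comm]
      · rw [conc, mult_apply] at h
        obtain ⟨k, -, hk⟩ := Finset.exists_ne_zero_of_sum_ne_zero h
        rw [← List.take_append_drop k w, List.length_append, hm _ (left_ne_zero_of_mul hk),
          hn _ (right_ne_zero_of_mul hk)]
    · have h3 : bracket deg y x = -(sgn K (p * q) • bracket deg x y) := by
        rw [bracket_of_homog hp hq, bracket_of_homog hq hp, smul_sub, smul_smul, sgn_mul_self,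
          mul_comm q p]
        module
      have h4 : dynkin deg (bracket deg x y) =
          bracket deg x (dynkin deg y) - sgn K (p * q) • bracket deg y (dynkin deg x) := by
        rw [← dynkin_conc hx hq hy.apply_nil, ← dynkin_conc hy hp hx.apply_nil,
          bracket_of_homog hp hq, map_sub, map_smul]
      rw [h4, h1, h2, ← bracketL_apply, ← bracketL_apply, map_smul, map_smul, bracketL_apply,
        bracketL_apply, h3, smul_neg, smul_neg, smul_smul, smul_smul, mul_comm _ (sgn K _ : K),
        ← mul_assoc, sgn_mul_self, one_mul]
      push_cast
      module

variable [TopologicalSpace K] [DiscreteTopology K]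

/-- The Dynkin–Specht–Wever theorem. -/
theorem dynkin_lie {f : Series ι K} (hf : f ∈ lieForms K deg) :
    dynkin deg f = fun w => (w.length : K) * f w := by
  let Ψ : Series ι K →ₗ[K] Series ι K := LinearMap.pi fun w => (w.length : K) • LinearMap.proj w
  have hΨ : Continuous Ψ := continuous_pi fun w => by
    simp only [Ψ, LinearMap.pi_apply, LinearMap.smul_apply, LinearMap.proj_apply]; fun_prop
  have := lieForms_induction isClosed_bot (dynkin deg - Ψ) ((continuous_dynkin deg).sub hΨ)
    (fun f hf => by
      rw [LinearMap.sub_apply, dynkin_monomial hf]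
      simp only [Submodule.mem_bot]
      ext w; simp [Ψ]) hf
  rw [Submodule.mem_bot, LinearMap.sub_apply, sub_eq_zero] at this
  rw [this]; rfl

/-- Lie series without linear part are commutators `∑ a, [a, X a]` with Lie series `X a`. -/
theorem exists_sub_rot [Algebra ℚ K] {f : Series ι K} (hf : f ∈ lieForms K deg) {n : ℕ}
    (hn : 2 ≤ n) (hl : ∀ w, f w ≠ 0 → w.length = n) :
    ∃ g : Series ι K, (∀ a, slice a g ∈ lieForms K deg) ∧ g - rot deg g = f ∧
      ∀ S : List (Letter ι) → Submodule ℚ K, (PermInv fun w => (S w).toAddSubgroup) →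
        (Adm (fun w => (S w).toAddSubgroup) f) → Adm (fun w => (S w).toAddSubgroup) g := by
  refine ⟨(n : ℚ)⁻¹ • prepend (dynkin deg) f, fun a => ?_, ?_, fun S hS hfS w => ?_⟩
  · have : slice a ((n : ℚ)⁻¹ • prepend (dynkin deg) f) = (n : ℚ)⁻¹ • dynkin deg (slice a f) := rfl
    rw [this]
    exact Submodule.smul_of_tower_mem _ _ (dynkin_mem _)
  · have h1 := dynkin_eq deg f
    have h2 : projLength 1 f = 0 := by
      ext w
      rw [projLength_apply]
      split_ifs with h
      · by_contra h'; have := hl w h'; omega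
      · rfl
    rw [h2, zero_add, dynkin_lie hf] at h1
    have h3 : rot deg ((n : ℚ)⁻¹ • prepend (dynkin deg) f) =
        (n : ℚ)⁻¹ • rot deg (prepend (dynkin deg) f) := map_rat_smul (rot deg) _ _
    rw [h3, ← smul_sub, ← h1]
    ext w
    rw [Pi.smul_apply]
    by_cases h : f w = 0
    · simp [h]
    · rw [hl w h, ← nsmul_eq_mul, ← Nat.cast_smul_eq_nsmul ℚ, smul_smul,
        inv_mul_cancel₀ (by exact_mod_cast (by omega : n ≠ 0)), one_smul]
  · exact (S w).smul_mem _ (hfS.prepend_dynkin hS w)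

end Dynkin

/-! ### The unshuffle coproduct and the Poincaré–Birkhoff–Witt filtration -/

section Unshuffle

variable {ι K : Type*} [CommRing K] (deg : ι → ℤ)

/-- `unsh u v f` is the sum of the coefficients of `f` at the signed shuffles of `u` and `v`. -/
def unsh : List (Letter ι) → List (Letter ι) → (Series ι K →ₗ[K] K)
  | [], v => LinearMap.proj v
  | a :: u, [] => LinearMap.proj (a :: u)
  | a :: u, c :: v => unsh u (c :: v) ∘ₗ slice a +
      sgn K (totalDeg deg [c] * totalDeg deg (a :: u)) • unsh (a :: u) v ∘ₗ slice c
termination_by u v => u.length + v.length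

@[simp] theorem unsh_nil_left (v) (f : Series ι K) : unsh deg [] v f = f v := by
  rw [unsh]; rfl

@[simp] theorem unsh_nil_right (u) (f : Series ι K) : unsh deg u [] f = f u := by
  cases u with
  | nil => simp
  | cons a u => rw [unsh]; rfl

theorem unsh_cons (a u c v) (f : Series ι K) :
    unsh deg (a :: u) (c :: v) f = unsh deg u (c :: v) (slice a f) +
      sgn K (totalDeg deg [c] * totalDeg deg (a :: u)) * unsh deg (a :: u) v (slice c f) := by
  rw [unsh]; rfl

/-- The unshuffle coproduct, for which letters are primitive. -/
def unshuffle : Series ι K →ₗ[K] Series₂ ι K := LinearMap.pi fun p => unsh deg p.1 p.2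

theorem unshuffle_apply (f : Series ι K) (u v) : unshuffle deg f (u, v) = unsh deg u v f := rfl

theorem unsh_mem (u v) : ∀ {S : List (Letter ι) → AddSubgroup K}, PermInv S →
    ∀ {f : Series ι K}, Adm S f → unsh deg u v f ∈ S (u ++ v) := by
  induction u generalizing v with
  | nil => intro S _ f hf; simpa using hf v
  | cons a u ihu =>
    induction v with
    | nil => intro S _ f hf; simpa using hf (a :: u)
    | cons c v ihv =>
      intro S hS f hf
      rw [unsh_cons]
      refine (S _).add_mem ?_ (sgn_mul_mem _ _ ?_)
      · exact ihu (c :: v) (S := fun w => S (a :: w)) (fun w w' h => hS _ _ (h.cons a))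
          (fun w => hf (a :: w))
      · have := ihv (S := fun w => S (c :: w)) (fun w w' h => hS _ _ (h.cons c))
          (f := slice c f) (fun w => hf (c :: w))
        rwa [hS _ _ (List.perm_middle (a := c) (l₁ := a :: u) (l₂ := v))]

theorem continuous_unshuffle [TopologicalSpace K] [DiscreteTopology K] :
    Continuous (unshuffle deg : Series ι K →ₗ[K] Series₂ ι K) := by
  refine continuous_pi fun ⟨u, v⟩ => ?_
  simp only [unshuffle_apply]
  induction u generalizing v with
  | nil => simp only [unsh_nil_left]; fun_prop
  | cons a u ihu =>
    induction v with
    | nil => simp only [unsh_nil_right]; fun_prop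
    | cons c v ihv =>
      simp only [unsh_cons]
      exact ((ihu (c :: v)).comp (continuous_slice a)).add
        (continuous_const.mul (ihv.comp (continuous_slice c)))

variable {deg} {ξ : List (Letter ι) → Letter ι →₀ K}

theorem mergeFirst_sgn_mul (hd : OddCoeff deg ξ) (m : ℤ) (f : Series ι K) (w) :
    mergeFirst ξ (fun w => sgn K (m * totalDeg deg w) * f w) w =
      sgn K (m * (totalDeg deg w + 1)) * mergeFirst ξ f w := by
  match w with
  | [] => simp
  | [_] => simp
  | a :: c :: v =>
    rw [mergeFirst_cons, mergeFirst_cons, contr_apply, contr_apply, Finset.mul_sum]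
    refine Finset.sum_congr rfl fun x hx => ?_
    obtain ⟨z, hz⟩ := hd _ _ (Finsupp.mem_support_iff.1 hx)
    have : sgn K (m * totalDeg deg (x :: v)) = sgn K (m * (totalDeg deg (a :: c :: v) + 1)) := by
      refine sgn_congr ⟨-m * (z + 1), ?_⟩
      have h1 : totalDeg deg (a :: c :: v) = totalDeg deg [a, c] + totalDeg deg v := by
        rw [← totalDeg_append]; rfl
      rw [h1, totalDeg_cons deg x v]
      linear_combination (-m) * hz
    rw [this]; ring

theorem contr_eq_smul_sum (x : List (Letter ι)) (Φ : Series ι K →ₗ[K] K) (f : Series ι K) :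
    Φ (contr ξ x f) = ∑ a ∈ (ξ x).support, ξ x a * Φ (slice a f) := by
  simp [contr]

/-- The part of `unsh (a :: u) v` of a contraction that merges the first two letters of the left
word. -/
def unshMergeLeft (deg : ι → ℤ) (ξ : List (Letter ι) → Letter ι →₀ K) (a : Letter ι) :
    List (Letter ι) → List (Letter ι) → Series ι K → K
  | [], _, _ => 0
  | e :: u, v, f => unsh deg u v (contr ξ [a, e] f)

/-- The part of `unsh u (c :: v)` of a contraction that merges the first two letters of the right
word. -/
def unshMergeRight (deg : ι → ℤ) (ξ : List (Letter ι) → Letter ι →₀ K) (u : List (Letter ι))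
    (c : Letter ι) : List (Letter ι) → Series ι K → K
  | [], _ => 0
  | e :: v, f => sgn K (totalDeg deg [e] * totalDeg deg u) * unsh deg u v (contr ξ [c, e] f)

theorem slice_slice_mergeFirst (a e) (f : Series ι K) :
    slice e (slice a (mergeFirst ξ f)) = contr ξ [a, e] f := rfl

theorem mergeFirst_unsh_left (hd : OddCoeff deg ξ) (a u c v) (f : Series ι K) :
    mergeFirst ξ (fun u' => unsh deg u' (c :: v) f) (a :: u) =
      unshMergeLeft deg ξ a u (c :: v) f +
      sgn K (totalDeg deg [c] * (totalDeg deg (a :: u) + 1)) *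
        mergeFirst ξ (fun u' => unsh deg u' v (slice c f)) (a :: u) := by
  rw [← mergeFirst_sgn_mul hd]
  cases u with
  | nil => simp [unshMergeLeft]
  | cons e u =>
    simp only [mergeFirst_cons, contr_apply, contr_eq_smul_sum, unsh_cons,
      mul_add, Finset.sum_add_distrib, unshMergeLeft]

theorem mergeFirst_unsh_right (hd : OddCoeff deg ξ) (a u c v) (f : Series ι K) :
    mergeFirst ξ (fun v' => unsh deg (a :: u) v' f) (c :: v) =
      mergeFirst ξ (fun v' => unsh deg u v' (slice a f)) (c :: v) +
      sgn K ((totalDeg deg [c] + 1) * totalDeg deg (a :: u)) *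
        unshMergeRight deg ξ (a :: u) c v f := by
  cases v with
  | nil => simp [unshMergeRight]
  | cons e v =>
    simp only [mergeFirst_cons, contr_apply, contr_eq_smul_sum, unsh_cons,
      mul_add, Finset.sum_add_distrib, Finset.mul_sum, unshMergeRight]
    congr 1
    refine Finset.sum_congr rfl fun x hx => ?_
    obtain ⟨z, hz⟩ := hd _ _ (Finsupp.mem_support_iff.1 hx)
    have : sgn K (totalDeg deg [x] * totalDeg deg (a :: u)) =
        sgn K ((totalDeg deg [c] + 1) * totalDeg deg (a :: u)) *
          sgn K (totalDeg deg [e] * totalDeg deg (a :: u)) := by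
      rw [← sgn_add]
      refine sgn_congr ⟨-(z + 1) * totalDeg deg (a :: u), ?_⟩
      rw [totalDeg_cons deg c [e]] at hz
      linear_combination (-totalDeg deg (a :: u)) * hz
    rw [this]; ring

theorem unsh_mergeFirst_left (a u c v) (f : Series ι K) :
    unsh deg u (c :: v) (slice a (mergeFirst ξ f)) = unshMergeLeft deg ξ a u (c :: v) f +
      sgn K (totalDeg deg [c] * totalDeg deg u) * unsh deg u v (contr ξ [a, c] f) := by
  cases u with
  | nil =>
    rw [unsh_nil_left, unsh_nil_left]
    simp [unshMergeLeft, totalDeg_nil]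
  | cons e u =>
    rw [unsh_cons, slice_slice_mergeFirst, slice_slice_mergeFirst, unshMergeLeft]

theorem unsh_mergeFirst_right (a u c v) (f : Series ι K) :
    unsh deg (a :: u) v (slice c (mergeFirst ξ f)) =
      unsh deg u v (contr ξ [c, a] f) + unshMergeRight deg ξ (a :: u) c v f := by
  cases v with
  | nil =>
    rw [unsh_nil_right, unsh_nil_right]
    simp [unshMergeRight]
  | cons e v =>
    rw [unsh_cons, slice_slice_mergeFirst, slice_slice_mergeFirst, unshMergeRight]

theorem contr_swap (hs : ∀ a c x, ξ [c, a] x =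
      -(sgn K (totalDeg deg [a] * totalDeg deg [c]) * ξ [a, c] x)) (a c) (f : Series ι K) :
    contr ξ [c, a] f =
      -(sgn K (totalDeg deg [a] * totalDeg deg [c]) • contr ξ [a, c] f) := by
  ext w
  have h1 : ξ [c, a] = -(sgn K (totalDeg deg [a] * totalDeg deg [c]) • ξ [a, c]) := by
    ext x; rw [hs]; rfl
  rw [contr_eq, h1, map_neg, map_smul, Pi.neg_apply, Pi.smul_apply, contr_eq]

/-- A quadratic derivation with graded antisymmetric coefficients is a coderivation of the
unshuffle coproduct: the terms that merge a letter of the left word with a letter of the right word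
cancel. -/
theorem unshuffle_oddDer (hq : Quad ξ) (hd : OddCoeff deg ξ)
    (hs : ∀ a c x, ξ [c, a] x = -(sgn K (totalDeg deg [a] * totalDeg deg [c]) * ξ [a, c] x))
    (f : Series ι K) : unshuffle deg (oddDer deg ξ f) = oddDer₂ deg ξ (unshuffle deg f) := by
  have hslice (a) (f : Series ι K) : slice a (oddDer deg ξ f) =
      sgn K (totalDeg deg [a]) • oddDer deg ξ (slice a f) + slice a (mergeFirst ξ f) := by
    ext w; rw [slice_apply, oddDer_quad_cons hq]; rfl
  suffices h : ∀ N u v (f : Series ι K), u.length + v.length = N → unsh deg u v (oddDer deg ξ f) =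
      oddDer deg ξ (fun u' => unsh deg u' v f) u +
        sgn K (totalDeg deg u) * oddDer deg ξ (fun v' => unsh deg u v' f) v by
    ext ⟨u, v⟩
    rw [unshuffle_apply, oddDer₂_apply]
    exact h _ u v f rfl
  intro N
  induction N using Nat.strong_induction_on with
  | _ N ih =>
  intro u v f hN
  match u, v with
  | [], v =>
    rw [unsh_nil_left, oddDer_nil deg hq.linQuad]
    simp
  | a :: u, [] =>
    rw [unsh_nil_right, oddDer_nil deg hq.linQuad]
    simp
  | a :: u, c :: v =>
    simp only [List.length_cons] at hN
    have ih1 := ih (u.length + (v.length + 1)) (by omega) u (c :: v) (slice a f) rfl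
    have ih2 := ih ((u.length + 1) + v.length) (by omega) (a :: u) v (slice c f) rfl
    rw [unsh_cons, hslice, hslice, map_add, map_add, map_smul, map_smul, ih1, ih2,
      unsh_mergeFirst_left, unsh_mergeFirst_right, contr_swap hs a c, map_neg, map_smul]
    simp only [smul_eq_mul]
    have e1 : slice a (fun u' => unsh deg u' (c :: v) f) =
        (fun u' => unsh deg u' (c :: v) (slice a f)) +
        sgn K (totalDeg deg [c] * totalDeg deg [a]) •
          (fun u' => sgn K (totalDeg deg [c] * totalDeg deg u') *
            unsh deg (a :: u') v (slice c f)) := by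
      ext u'
      simp only [slice_apply, unsh_cons, Pi.add_apply, Pi.smul_apply, smul_eq_mul,
        totalDeg_cons deg a u', mul_add, sgn_add, mul_assoc]
    have e2 : slice c (fun v' => unsh deg (a :: u) v' f) =
        (fun v' => unsh deg u (c :: v') (slice a f)) +
        sgn K (totalDeg deg [c] * totalDeg deg (a :: u)) •
          (fun v' => unsh deg (a :: u) v' (slice c f)) := by
      ext v'
      simp only [slice_apply, unsh_cons, Pi.add_apply, Pi.smul_apply, smul_eq_mul]
    have e3 : slice c (fun v' => unsh deg u v' (slice a f)) =
        fun v' => unsh deg u (c :: v') (slice a f) := rfl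
    have e4 : slice a (fun u' => unsh deg u' v (slice c f)) =
        fun u' => unsh deg (a :: u') v (slice c f) := rfl
    rw [oddDer_quad_cons hq _ a u, oddDer_quad_cons hq _ c v, oddDer_quad_cons hq _ a u,
      oddDer_quad_cons hq _ c v, e1, e2, e3, e4, mergeFirst_unsh_left hd,
      mergeFirst_unsh_right hd, map_add, map_add, map_smul, map_smul]
    simp only [Pi.add_apply, Pi.smul_apply, smul_eq_mul]
    rw [oddDer_sgn_mul hd]
    generalize unshMergeLeft deg ξ a u (c :: v) f = X
    generalize unshMergeRight deg ξ (a :: u) c v f = Y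
    generalize oddDer deg ξ _ _ = Z1
    generalize oddDer deg ξ _ _ = Z2
    generalize oddDer deg ξ _ _ = Z3
    generalize oddDer deg ξ _ _ = Z4
    generalize mergeFirst ξ _ _ = Z5
    generalize mergeFirst ξ _ _ = Z6
    rw [totalDeg_cons deg a u]
    generalize totalDeg deg [a] = A
    generalize totalDeg deg [c] = C
    generalize totalDeg deg u = U
    simp only [mul_add, add_mul, sgn_add, mul_one, one_mul]
    have hAC : sgn K (A * C) = sgn K (C * A) := by rw [mul_comm]
    rw [hAC]
    have h1 := sgn_mul_self (K := K) (C * A)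
    have h3 := sgn_mul_self (K := K) A
    have h4 := sgn_mul_self (K := K) U
    generalize unsh deg u v (contr ξ [a, c] f) = W
    linear_combination -(W * sgn K (C * U)) * h1 -
      sgn K (C * A) * sgn K (C * U) * Y * (sgn K U * sgn K U * h3 + h4)

end Unshuffle

section LieProducts

variable {ι K : Type*} [CommRing K] {deg : ι → ℤ}

/-- The operator `u ⊗ v ↦ x u ⊗ v`. -/
def concLeft (x : Series ι K) : Series₂ ι K →ₗ[K] Series₂ ι K :=
  LinearMap.pi fun p => LinearMap.proj p.1 ∘ₗ concL x ∘ₗ LinearMap.funLeft K K fun u => (u, p.2)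

theorem concLeft_apply (x : Series ι K) (F : Series₂ ι K) (u v) :
    concLeft x F (u, v) = conc x (fun u => F (u, v)) u := rfl

variable (deg) in
/-- The operator `u ⊗ v ↦ (-1)^(m |u|) u ⊗ x v`, for `x` of degree `m`. -/
def concRight (m : ℤ) (x : Series ι K) : Series₂ ι K →ₗ[K] Series₂ ι K :=
  LinearMap.pi fun p => sgn K (m * totalDeg deg p.1) •
    (LinearMap.proj p.2 ∘ₗ concL x ∘ₗ LinearMap.funLeft K K fun v => (p.1, v))

theorem concRight_apply (m : ℤ) (x : Series ι K) (F : Series₂ ι K) (u v) :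
    concRight deg m x F (u, v) = sgn K (m * totalDeg deg u) * conc x (fun v => F (u, v)) v := rfl

theorem concLeft_tmul (x f g : Series ι K) : concLeft x (tmul f g) = tmul (conc x f) g := by
  ext ⟨u, v⟩
  have : (fun u => tmul f g (u, v)) = g v • f := by ext; simp [tmul, mul_comm]
  rw [concLeft_apply, this, ← concL_apply, map_smul]
  simp [tmul, mul_comm, concL_apply]

theorem concRight_tmul {m n : ℤ} (x : Series ι K) {f : Series ι K} (hf : Homog deg n f)
    (g : Series ι K) :
    concRight deg m x (tmul f g) = sgn K (m * n) • tmul f (conc x g) := by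
  ext ⟨u, v⟩
  have : (fun v => tmul f g (u, v)) = f u • g := by ext; simp [tmul]
  rw [concRight_apply, this, ← concL_apply, map_smul]
  by_cases h : f u = 0
  · simp [tmul, h]
  · simp [tmul, concL_apply, hf u h]

theorem mult_concLeft (x : Series ι K) (F : Series₂ ι K) :
    mult (concLeft x F) = conc x (mult F) := by
  ext w
  induction w generalizing x F with
  | nil => simp [concLeft_apply]
  | cons a w ih =>
    have h : slice₂ a (concLeft x F) = x [] • slice₂ a F + concLeft (slice a x) F := by
      ext ⟨u, v⟩
      simp only [slice₂_apply, concLeft_apply, conc_cons, Pi.add_apply, Pi.smul_apply, smul_eq_mul]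
    rw [mult_cons, h, map_add, map_smul, Pi.add_apply, ih, conc_cons, mult_cons, concLeft_apply,
      conc_nil, Pi.smul_apply, smul_eq_mul]
    ring

theorem continuous_concLeft [TopologicalSpace K] [DiscreteTopology K] (x : Series ι K) :
    Continuous (concLeft x : Series₂ ι K →ₗ[K] Series₂ ι K) := by
  refine continuous_pi fun ⟨u, v⟩ => ?_
  simp only [concLeft_apply]
  exact (continuous_apply u).comp ((continuous_conc_right x).comp (by fun_prop))

theorem continuous_concRight [TopologicalSpace K] [DiscreteTopology K] (m : ℤ) (x : Series ι K) :
    Continuous (concRight deg m x : Series₂ ι K →ₗ[K] Series₂ ι K) := by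
  refine continuous_pi fun ⟨u, v⟩ => ?_
  simp only [concRight_apply]
  exact continuous_const.mul
    ((continuous_apply v).comp ((continuous_conc_right x).comp (by fun_prop)))

theorem concLeft_bracket {m n : ℤ} {x y : Series ι K} (hx : Homog deg m x) (hy : Homog deg n y)
    (F : Series₂ ι K) : concLeft (bracket deg x y) F =
      concLeft x (concLeft y F) - sgn K (m * n) • concLeft y (concLeft x F) := by
  ext ⟨u, v⟩
  simp only [Pi.sub_apply, Pi.smul_apply, concLeft_apply, ← conc_assoc, bracket_of_homog hx hy]
  rw [← concL_apply, map_sub, map_smul]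
  rfl

theorem concRight_bracket {m n : ℤ} {x y : Series ι K} (hx : Homog deg m x) (hy : Homog deg n y)
    (F : Series₂ ι K) : concRight deg (m + n) (bracket deg x y) F =
      concRight deg m x (concRight deg n y F) -
        sgn K (m * n) • concRight deg n y (concRight deg m x F) := by
  have key (m n : ℤ) (x y : Series ι K) (u v) : concRight deg m x (concRight deg n y F) (u, v) =
      sgn K ((m + n) * totalDeg deg u) * conc (conc x y) (fun v => F (u, v)) v := by
    rw [concRight_apply, conc_assoc, add_mul, sgn_add, mul_assoc]
    congr 1
    have : (fun v => concRight deg n y F (u, v)) =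
        sgn K (n * totalDeg deg u) • conc y (fun v => F (u, v)) := rfl
    rw [this, ← concL_apply, map_smul]; rfl
  ext ⟨u, v⟩
  rw [Pi.sub_apply, Pi.smul_apply, key, key, concRight_apply, bracket_of_homog hx hy,
    ← concL_apply, map_sub, map_smul, add_comm n m]
  simp only [LinearMap.sub_apply, LinearMap.smul_apply, Pi.sub_apply, Pi.smul_apply, smul_eq_mul,
    concL_apply]
  ring

theorem homog_single (w : List (Letter ι)) :
    Homog deg (totalDeg deg w) (Pi.single w 1 : Series ι K) := by
  intro w' h
  have : w' = w := by by_contra h'; simp [h'] at h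
  rw [this]

/-- The operations on the two tensor factors commute in the graded sense. -/
theorem concLeft_concRight [TopologicalSpace K] [DiscreteTopology K] {m n : ℤ} {x : Series ι K}
    (hx : Homog deg m x) (y : Series ι K) (F : Series₂ ι K) :
    concRight deg n y (concLeft x F) = sgn K (m * n) • concLeft x (concRight deg n y F) := by
  refine eq_of_single (concRight deg n y ∘ₗ concLeft x)
    (sgn K (m * n) • concLeft x ∘ₗ concRight deg n y)
    ((continuous_concRight n y).comp (continuous_concLeft x))
    (((continuous_concLeft x).comp (continuous_concRight n y)).const_smul (sgn K (m * n)))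
    (fun ⟨u, v⟩ => ?_) F
  simp only [LinearMap.comp_apply, LinearMap.smul_apply]
  rw [← tmul_single, concLeft_tmul, concRight_tmul y (homog_single u),
    concRight_tmul y (hx.conc (homog_single u)), map_smul, concLeft_tmul, smul_smul, ← sgn_add]
  congr 2
  ring

theorem slice_letter_conc (a c : Letter ι) (f : Series ι K) :
    slice c (conc (letter K a) f) = if c = a then f else 0 := by
  ext w
  rw [slice_apply, letter_conc_cons]
  split_ifs <;> rfl

/-- Lie series are primitive for the unshuffle coproduct. -/
theorem unshuffle_conc [TopologicalSpace K] [DiscreteTopology K] {x : Series ι K}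
    (hx : IsLieMonomial K deg x) {m : ℤ} (hm : Homog deg m x) (f : Series ι K) :
    unshuffle deg (conc x f) =
      concLeft x (unshuffle deg f) + concRight deg m x (unshuffle deg f) := by
  suffices h : ∃ m, Homog deg m x ∧ ∀ f, unshuffle deg (conc x f) =
      concLeft x (unshuffle deg f) + concRight deg m x (unshuffle deg f) by
    obtain ⟨n, hn, h⟩ := h
    by_cases h0 : x = 0
    · subst h0
      rw [h]
      congr 1
      ext ⟨u, v⟩
      rw [concRight_apply, concRight_apply, ← concL_apply]; simp
    · obtain ⟨w, hw⟩ := Function.ne_iff.1 h0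
      rw [← hm w hw, hn w hw, h]
  clear hm m f
  induction hx with
  | of a =>
    refine ⟨_, homog_letter a, fun f => ?_⟩
    ext ⟨u, v⟩
    rw [Pi.add_apply, concLeft_apply, concRight_apply]
    simp only [unshuffle_apply]
    match u, v with
    | [], v => simp [letter]
    | e :: u, [] => simp [letter]
    | e :: u, c :: v =>
      rw [unsh_cons, slice_letter_conc, slice_letter_conc, letter_conc_cons, letter_conc_cons]
      by_cases h1 : e = a <;> by_cases h2 : c = a <;> simp [h1, h2]
  | @bracket x y hx hy ihx ihy =>
    obtain ⟨m, hm, h1⟩ := ihx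
    obtain ⟨n, hn, h2⟩ := ihy
    refine ⟨m + n, hm.bracket hn, fun f => ?_⟩
    have h3 : conc (bracket deg x y) f = conc x (conc y f) - sgn K (m * n) • conc y (conc x f) := by
      rw [bracket_of_homog hm hn, ← concL_apply, map_sub, map_smul]
      simp only [LinearMap.sub_apply, LinearMap.smul_apply, concL_apply, conc_assoc]
    rw [h3, map_sub, map_smul, h1, h2, h2, h1, concLeft_bracket hm hn, concRight_bracket hm hn]
    simp only [map_add]
    rw [concLeft_concRight hm, concLeft_concRight hn, mul_comm n m]
    simp only [smul_add, smul_smul, sgn_mul_self, one_smul]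
    abel

variable (K deg) in
/-- Products of `q` Lie monomials. -/
inductive LieProd : ℕ → Series ι K → Prop
  | one : LieProd 0 (Pi.single [] 1)
  | mul {q : ℕ} {x p : Series ι K} (hx : IsLieMonomial K deg x) (hp : LieProd q p) :
      LieProd (q + 1) (conc x p)

theorem LieProd.homog {q : ℕ} {p : Series ι K} (hp : LieProd K deg q p) : ∃ n, Homog deg n p := by
  induction hp with
  | one => exact ⟨_, homog_single []⟩
  | mul hx _ ih =>
    obtain ⟨m, hm⟩ := hx.homog
    obtain ⟨n, hn⟩ := ih
    exact ⟨_, hm.conc hn⟩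

theorem LieProd.conc {a c : ℕ} {p q : Series ι K} (hp : LieProd K deg a p)
    (hq : LieProd K deg c q) : LieProd K deg (a + c) (conc p q) := by
  induction hp with
  | one => rwa [one_conc, zero_add]
  | mul hx _ ih => rw [conc_assoc, add_right_comm]; exact .mul hx ih

variable (K deg) in
/-- The Poincaré–Birkhoff–Witt filtration: the closed span of the products of at most `q` Lie
monomials (and at least one). -/
def pbw (q : ℕ) : Submodule K (Series ι K) :=
  closedSpan {p | ∃ r, 1 ≤ r ∧ r ≤ q ∧ LieProd K deg r p}

theorem pbw_mono {q r : ℕ} (h : q ≤ r) : pbw K deg q ≤ pbw K deg r := by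
  intro f hf s
  obtain ⟨g, hg, hgs⟩ := hf s
  refine ⟨g, Submodule.span_mono ?_ hg, hgs⟩
  rintro p ⟨t, h1, h2, h3⟩
  exact ⟨t, h1, h2.trans h, h3⟩

variable [TopologicalSpace K] [DiscreteTopology K]

theorem isClosed_pbw (q : ℕ) : IsClosed (pbw K deg q : Set (Series ι K)) := isClosed_closedSpan _

theorem pbw_zero : pbw K deg 0 = (⊥ : Submodule K (Series ι K)) := by
  refine eq_bot_iff.2 (closedSpan_le isClosed_bot ?_)
  rintro p ⟨r, h1, h2, -⟩
  omega

theorem pbw_one : pbw K deg 1 = lieForms K deg := by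
  refine le_antisymm (closedSpan_le isClosed_lieForms ?_) (closedSpan_le (isClosed_pbw 1) ?_)
  · rintro p ⟨r, h1, h2, hp⟩
    obtain rfl : r = 1 := by omega
    cases hp with
    | mul hx hp => cases hp; rw [conc_one]; exact hx.mem
  · intro x hx
    have := LieProd.mul hx .one
    rw [conc_one] at this
    exact subset_closedSpan _ ⟨1, le_rfl, le_rfl, this⟩

theorem conc_mem_pbw {q : ℕ} {x p : Series ι K} (hx : IsLieMonomial K deg x)
    (hp : p ∈ pbw K deg q) : conc x p ∈ pbw K deg (q + 1) := by
  refine map_mem_of_mem_closedSpan (isClosed_pbw _) (concL x) (continuous_conc_right x) ?_ hp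
  rintro p ⟨r, h1, h2, hp⟩
  exact subset_closedSpan _ ⟨r + 1, by omega, by omega, .mul hx hp⟩

theorem mem_pbw_conc {q c : ℕ} {p p' : Series ι K} (hp : p ∈ pbw K deg q)
    (hp' : LieProd K deg c p') : conc p p' ∈ pbw K deg (q + c) := by
  refine map_mem_of_mem_closedSpan (isClosed_pbw _) (concL.flip p') (continuous_conc_left p') ?_ hp
  rintro p ⟨r, h1, h2, hp⟩
  exact subset_closedSpan _ ⟨r + c, by omega, by omega, hp.conc hp'⟩

/-- The commutator of a Lie monomial with a product of `a` Lie monomials is a sum of products of `a`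
Lie monomials. -/
theorem commutator_mem_pbw {a : ℕ} {x p : Series ι K} (hx : IsLieMonomial K deg x)
    (hp : LieProd K deg a p) {m n : ℤ} (hm : Homog deg m x) (hn : Homog deg n p) :
    conc x p - sgn K (m * n) • conc p x ∈ pbw K deg a := by
  suffices h : ∃ n, Homog deg n p ∧ conc x p - sgn K (m * n) • conc p x ∈ pbw K deg a by
    obtain ⟨k, hk, h⟩ := h
    by_cases h0 : p = 0
    · subst h0; rw [← concL_apply, ← concL_apply]; simp
    · obtain ⟨w, hw⟩ := Function.ne_iff.1 h0
      rwa [← hn w hw, hk w hw]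
  clear hn n
  induction hp with
  | one =>
    refine ⟨_, homog_single [], ?_⟩
    rw [conc_one, one_conc]; simp
  | @mul q y p hy hp ih =>
    obtain ⟨n, hn, h⟩ := ih
    obtain ⟨k, hk⟩ := hy.homog
    refine ⟨k + n, hk.conc hn, ?_⟩
    have h1 : conc (bracket deg x y) p ∈ pbw K deg (q + 1) :=
      subset_closedSpan _ ⟨q + 1, by omega, le_rfl, .mul (.bracket hx hy) hp⟩
    have h2 := conc_mem_pbw hy h
    convert Submodule.add_mem _ h1 (Submodule.smul_mem _ (sgn K (m * k)) h2) using 1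
    rw [bracket_of_homog hm hk]
    simp only [← concL_apply, map_sub, map_smul, LinearMap.sub_apply, LinearMap.smul_apply]
    simp only [concL_apply, conc_assoc, smul_sub, smul_smul, ← sgn_add, mul_add]
    abel

variable (K deg) in
/-- The span of the tensors of products of Lie monomials with `q` factors altogether. -/
def lieTens (q : ℕ) : Submodule K (Series₂ ι K) :=
  Submodule.span K {F | ∃ a c p p', LieProd K deg a p ∧ LieProd K deg c p' ∧ a + c = q ∧
    F = tmul p p'}

theorem unshuffle_one {K : Type*} [CommRing K] : unshuffle deg (Pi.single [] 1 : Series ι K) =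
    tmul (Pi.single [] 1) (Pi.single [] 1) := by
  rw [tmul_single]
  ext ⟨u, v⟩
  rw [unshuffle_apply]
  match u, v with
  | [], v => simp [Pi.single_apply]
  | a :: u, [] => simp
  | a :: u, c :: v =>
    have h (a) : slice a (Pi.single [] 1 : Series ι K) = 0 := by ext; simp
    rw [unsh_cons, h, h]
    simp

theorem unshuffle_mem_lieTens {q : ℕ} {p : Series ι K} (hp : LieProd K deg q p) :
    unshuffle deg p ∈ lieTens K deg q := by
  induction hp with
  | one => exact Submodule.subset_span ⟨0, 0, _, _, .one, .one, rfl, unshuffle_one⟩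
  | @mul q x p hx hp ih =>
    obtain ⟨m, hm⟩ := hx.homog
    rw [unshuffle_conc hx hm]
    refine Submodule.add_mem _ ?_ ?_
    · refine (Submodule.span_le (p := (lieTens K deg (q + 1)).comap (concLeft x))).2 ?_ ih
      rintro _ ⟨a, c, p, p', h1, h2, h3, rfl⟩
      simp only [Submodule.comap_coe, Set.mem_preimage, concLeft_tmul]
      exact Submodule.subset_span ⟨a + 1, c, _, _, .mul hx h1, h2, by omega, rfl⟩
    · refine (Submodule.span_le (p := (lieTens K deg (q + 1)).comap (concRight deg m x))).2 ?_ ih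
      rintro _ ⟨a, c, p, p', h1, h2, h3, rfl⟩
      obtain ⟨n, hn⟩ := h1.homog
      simp only [Submodule.comap_coe, Set.mem_preimage, concRight_tmul x hn]
      exact Submodule.smul_mem _ _
        (Submodule.subset_span ⟨a, c + 1, _, _, h1, .mul hx h2, by omega, rfl⟩)

/-- Modulo shorter products a Lie monomial may be moved past the left tensor factor. -/
theorem mult_concRight_sub_mem {q : ℕ} {x : Series ι K} (hx : IsLieMonomial K deg x) {m : ℤ}
    (hm : Homog deg m x) {F : Series₂ ι K} (hF : F ∈ lieTens K deg q) :
    mult (concRight deg m x F) - conc x (mult F) ∈ pbw K deg q := by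
  refine (Submodule.span_le
    (p := (pbw K deg q).comap (mult ∘ₗ concRight deg m x - concL x ∘ₗ mult))).2 ?_ hF
  rintro _ ⟨a, c, p, p', h1, h2, rfl, rfl⟩
  obtain ⟨n, hn⟩ := h1.homog
  have h3 := mem_pbw_conc (Submodule.neg_mem _ (commutator_mem_pbw hx h1 hm hn)) h2
  simp only [Submodule.comap_coe, Set.mem_preimage, LinearMap.sub_apply, LinearMap.comp_apply,
    concRight_tmul x hn, map_smul]
  convert h3 using 1
  rw [neg_sub, ← concL_apply (_ - _), map_sub, map_smul, LinearMap.sub_apply, LinearMap.smul_apply]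
  simp only [concL_apply, conc_assoc]
  rfl

variable (K deg) in
/-- The second Adams operation of the tensor algebra: the unshuffle coproduct followed by the
product. -/
def adams : Series ι K →ₗ[K] Series ι K := mult ∘ₗ unshuffle deg

theorem continuous_adams : Continuous (adams K deg : Series ι K →ₗ[K] Series ι K) :=
  continuous_mult.comp (continuous_unshuffle deg)

/-- Modulo shorter products the Adams operation multiplies a product of `q` Lie monomials by `2 ^ q`. -/
theorem adams_lieProd {q : ℕ} {p : Series ι K} (hp : LieProd K deg q p) :
    adams K deg p - (2 : K) ^ q • p ∈ pbw K deg (q - 1) := by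
  induction hp with
  | one =>
    have : adams K deg (Pi.single [] 1) = (Pi.single [] 1 : Series ι K) := by
      rw [adams, LinearMap.comp_apply, unshuffle_one]
      exact one_conc _
    rw [this]; simp
  | @mul q x p hx hp ih =>
    obtain ⟨m, hm⟩ := hx.homog
    have h1 := mult_concRight_sub_mem hx hm (unshuffle_mem_lieTens hp)
    have h2 : conc x (adams K deg p - (2 : K) ^ q • p) ∈ pbw K deg q := by
      cases q with
      | zero =>
        rw [Nat.zero_sub, pbw_zero, Submodule.mem_bot] at ih
        rw [ih, ← concL_apply, map_zero]
        exact Submodule.zero_mem _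
      | succ q => exact conc_mem_pbw hx ih
    rw [Nat.add_sub_cancel]
    convert Submodule.add_mem _ h1 (Submodule.smul_mem _ (2 : K) h2) using 1
    rw [adams, LinearMap.comp_apply, unshuffle_conc hx hm, map_add, mult_concLeft, pow_succ,
      ← concL_apply x (_ - _), map_sub, map_smul]
    simp only [concL_apply, LinearMap.comp_apply]
    module

theorem adams_pbw {q : ℕ} {f : Series ι K} (hf : f ∈ pbw K deg (q + 1)) :
    adams K deg f - (2 : K) ^ (q + 1) • f ∈ pbw K deg q := by
  refine map_mem_of_mem_closedSpan (isClosed_pbw _) (adams K deg - (2 : K) ^ (q + 1) • LinearMap.id)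
    (continuous_adams.sub (continuous_id.const_smul _)) ?_ hf
  rintro p ⟨r, h1, h2, hp⟩
  have h3 := adams_lieProd hp
  simp only [LinearMap.sub_apply, LinearMap.smul_apply, LinearMap.id_apply]
  rcases h2.eq_or_lt with rfl | h2
  · exact h3
  · have h4 : p ∈ pbw K deg q := subset_closedSpan _ ⟨r, h1, by omega, hp⟩
    have h5 := pbw_mono (by omega : r - 1 ≤ q) h3
    have : adams K deg p - (2 : K) ^ (q + 1) • p =
        (adams K deg p - (2 : K) ^ r • p) + ((2 : K) ^ r - (2 : K) ^ (q + 1)) • p := by module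
    rw [this]
    exact Submodule.add_mem _ h5 (Submodule.smul_mem _ _ h4)

theorem adams_lie {f : Series ι K} (hf : f ∈ lieForms K deg) :
    adams K deg f = (2 : K) • f := by
  rw [← pbw_one] at hf
  have := adams_pbw hf
  rw [pbw_zero, Submodule.mem_bot, sub_eq_zero] at this
  simpa using this

theorem mem_pbw_of_length {n : ℕ} (hn : 1 ≤ n) {f : Series ι K}
    (hf : ∀ w, f w ≠ 0 → w.length = n) : f ∈ pbw K deg n := by
  have hf' : f = projLength n f := by
    ext w
    rw [projLength_apply]
    split_ifs with h
    · rfl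
    · by_contra h'; exact h (hf w h')
  rw [hf']
  refine map_mem_of_single (isClosed_pbw n) _ (continuous_projLength n) (fun w => ?_) f
  by_cases hw : w.length = n
  · have h1 : projLength n (Pi.single w 1 : Series ι K) = Pi.single w 1 := by
      ext v
      rw [projLength_apply]
      split_ifs with h
      · rfl
      · have : v ≠ w := by rintro rfl; exact h hw
        simp [this]
    rw [h1]
    refine subset_closedSpan _ ⟨n, hn, le_rfl, ?_⟩
    subst hw
    clear hf hf' hn h1
    induction w with
    | nil => exact .one
    | cons a w ih =>
      have : (Pi.single (a :: w) 1 : Series ι K) = conc (letter K a) (Pi.single w 1) := by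
        rw [letter_eq, conc_single]; rfl
      rw [this]
      exact .mul (.of a) ih
  · convert Submodule.zero_mem _
    ext v
    rw [projLength_apply]
    split_ifs with h
    · have : v ≠ w := by rintro rfl; exact hw h
      simp [this]
    · rfl

end LieProducts

/-! ### Acyclicity on Lie series -/

section Acyclic

variable {ι K V : Type*} [CommRing K] [Ring V] [Algebra K V] {b : Module.Basis ι K V}
  {deg : ι → ℤ}

variable (b) in
/-- The contraction with the unit of `V`. -/
def unitContr (f : Series ι K) : Series ι K := fun w =>
  Finsupp.linearCombination K (fun k => f ((k, false) :: w)) (b.repr 1)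

/-- The contraction with the unit is a contracting homotopy for the Lie operator on pure series. -/
theorem oddDer_unitContr (h1 : ∀ k, b.repr 1 k ≠ 0 → Even (deg k)) {f : Series ι K} (hf : Pure f)
    (h0 : oddDer deg (lieOpCoeff b deg) f = 0) :
    oddDer deg (lieOpCoeff b deg) (unitContr b f) = f := by
  have hq := quad_lieOpCoeff (b := b) (deg := deg)
  have hsum : unitContr b f = ∑ k ∈ (b.repr 1).support,
      b.repr 1 k • slice (k, false) f := by
    ext w
    rw [unitContr, Finsupp.linearCombination_apply, Finsupp.sum, Finset.sum_apply]
    rfl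
  ext w
  match w with
  | [] => rw [oddDer_nil deg hq.linQuad, hf.nil]
  | (l, true) :: v =>
    rw [hf.cons_true]
    refine oddDer_apply_eq_zero fun u x v' a hw hx => ?_
    rw [unitContr, Finsupp.linearCombination_apply]
    refine Finset.sum_eq_zero fun k _ => ?_
    have : f ((k, false) :: (u ++ a :: v')) = 0 := by
      by_contra h
      have := hf.formDeg _ h
      rw [formDeg_cons_false, ← formDeg_merge hx, ← hw, formDeg_cons_true] at this
      omega
    simp [this]
  | (l, false) :: v =>
    rw [hsum, map_sum, Finset.sum_apply]
    have h2 (k) (hk : b.repr 1 k ≠ 0) :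
        oddDer deg (lieOpCoeff b deg) (slice (k, false) f) ((l, false) :: v) =
        Finsupp.linearCombination K (fun c => f ((c, false) :: v)) (b.repr (b k * b l)) := by
      have h3 := congrFun h0 ((k, false) :: (l, false) :: v)
      rw [oddDer_quad_cons hq, mergeFirst_cons, contr_ff, linearCombination_structureCoeff,
        totalDeg_false, sgn_odd (by
          obtain ⟨z, hz⟩ := h1 k hk
          exact ⟨-z, by rw [hz]; ring⟩), sgn_even ((h1 k hk).mul_right _)] at h3
      have h4 : (0 : Series ι K) ((k, false) :: (l, false) :: v) = 0 := rfl
      rw [h4] at h3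
      linear_combination -h3
    have h5 : ∀ k ∈ (b.repr 1).support,
        oddDer deg (lieOpCoeff b deg) (b.repr 1 k • slice (k, false) f) ((l, false) :: v) =
        Finsupp.linearCombination K (fun c => f ((c, false) :: v))
          (b.repr ((b.repr 1 k • b k) * b l)) := by
      intro k hk
      rw [map_smul, Pi.smul_apply, h2 k (Finsupp.mem_support_iff.1 hk), smul_mul_assoc, map_smul,
        map_smul]
    rw [Finset.sum_congr rfl h5, ← map_sum, ← map_sum, ← Finset.sum_mul]
    have h6 : ∑ k ∈ (b.repr 1).support, b.repr 1 k • b k = 1 := b.linearCombination_repr 1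
    rw [h6, one_mul, b.repr_self]
    simp

theorem Adm.adams {S : List (Letter ι) → AddSubgroup K} (hS : PermInv S) {f : Series ι K}
    (hf : Adm S f) : Adm S (adams K deg f) :=
  adm_mult fun u v => unsh_mem deg u v hS hf

variable [Algebra ℚ K] [TopologicalSpace K] [DiscreteTopology K]

/-- The Adams operation commutes with the Lie operator. -/
theorem adams_lieOp (hb : IsGradedComm b deg) (f : Series ι K) :
    adams K deg (oddDer deg (lieOpCoeff b deg) f) =
      oddDer deg (lieOpCoeff b deg) (adams K deg f) := by
  rw [adams, LinearMap.comp_apply, LinearMap.comp_apply,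
    unshuffle_oddDer quad_lieOpCoeff (isLieDer_lieOp hb).odd (lieOpCoeff_symm hb),
    mult_oddDer₂ deg quad_lieOpCoeff.linQuad]

/-- A primitive of a Lie series can be replaced by a Lie series, removing one by one the eigenspaces
of the Adams operation other than the first. -/
theorem exists_lie_primitive (hb : IsGradedComm b deg) {y : Series ι K} (hy : y ∈ lieForms K deg)
    (q : ℕ) : ∀ u ∈ pbw K deg (q + 1), oddDer deg (lieOpCoeff b deg) u = y →
      ∃ y' ∈ lieForms K deg, oddDer deg (lieOpCoeff b deg) y' = y ∧
        ∀ S : List (Letter ι) → Submodule ℚ K, (PermInv fun w => (S w).toAddSubgroup) →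
          (Adm (fun w => (S w).toAddSubgroup) u) → Adm (fun w => (S w).toAddSubgroup) y' := by
  induction q with
  | zero => exact fun u hu huy => ⟨u, pbw_one (K := K) (deg := deg) ▸ hu, huy, fun S _ h => h⟩
  | succ q ih =>
    intro u hu huy
    have h2 : (2 : ℚ) - 2 ^ (q + 2) ≠ 0 := by
      have : (1 : ℚ) ≤ 2 ^ q := one_le_pow₀ (by norm_num)
      rw [pow_add]; intro h; linarith
    have h3 : (2 : K) ^ (q + 1 + 1) • u = ((2 : ℚ) ^ (q + 2)) • u := by
      rw [← algebraMap_smul K ((2 : ℚ) ^ (q + 2)) u, map_pow, map_ofNat]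
    have h4 : (2 : K) • y = (2 : ℚ) • y := by rw [two_smul, two_smul]
    have h1 := adams_pbw hu
    rw [h3] at h1
    obtain ⟨y', hy', hD, hA⟩ := ih (((2 : ℚ) - 2 ^ (q + 2))⁻¹ •
        (adams K deg u - ((2 : ℚ) ^ (q + 2)) • u)) (Submodule.smul_of_tower_mem _ _ h1) (by
      have := map_rat_smul (oddDer deg (lieOpCoeff b deg)) (((2 : ℚ) - 2 ^ (q + 2))⁻¹)
        (adams K deg u - ((2 : ℚ) ^ (q + 2)) • u)
      rw [this, map_sub, map_rat_smul (oddDer deg (lieOpCoeff b deg)), ← adams_lieOp hb, huy,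
        adams_lie hy, h4, ← sub_smul, smul_smul, inv_mul_cancel₀ h2, one_smul])
    refine ⟨y', hy', hD, fun S hS hu => hA S hS fun w => ?_⟩
    exact (S w).smul_mem _ ((S w).sub_mem (hu.adams hS w) ((S w).smul_mem _ (hu w)))

/-- The Lie operator is acyclic on Lie series in the letters `t k`, in length at least two. -/
theorem exists_lie_oddDer_eq (hb : IsGradedComm b deg) (h1 : ∀ k, b.repr 1 k ≠ 0 → Even (deg k))
    {y : Series ι K} (hy : y ∈ lieForms K deg) (hp : Pure y) {n : ℕ} (hn : 2 ≤ n)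
    (hl : ∀ w, y w ≠ 0 → w.length = n) (h0 : oddDer deg (lieOpCoeff b deg) y = 0) :
    ∃ y' ∈ lieForms K deg, oddDer deg (lieOpCoeff b deg) y' = y ∧
      ∀ S : List (Letter ι) → Submodule ℚ K, (PermInv fun w => (S w).toAddSubgroup) →
        (∀ k w, b.repr 1 k * y ((k, false) :: w) ∈ S w) →
        Adm (fun w => (S w).toAddSubgroup) y' := by
  obtain ⟨m, rfl⟩ : ∃ m, n = m + 2 := ⟨n - 2, by omega⟩
  have hu : unitContr b y ∈ pbw K deg (m + 1) := by
    refine mem_pbw_of_length (by omega) fun w hw => ?_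
    rw [unitContr, Finsupp.linearCombination_apply] at hw
    obtain ⟨k, -, hk⟩ := Finset.exists_ne_zero_of_sum_ne_zero hw
    have := hl _ (right_ne_zero_of_mul hk)
    simpa using this
  obtain ⟨y', hy', hD, hA⟩ := exists_lie_primitive hb hy m _ hu (oddDer_unitContr h1 hp h0)
  refine ⟨y', hy', hD, fun S hS h => hA S hS fun w => ?_⟩
  rw [unitContr, Finsupp.linearCombination_apply]
  exact (S w).sum_mem fun k _ => h k w

end Acyclic

/-! ### Gradings -/

section Grading

variable {K V ι : Type*} [CommRing K] [Algebra ℚ K] {𝒦 : ℤ → Submodule ℚ K} [GradedAlgebra 𝒦]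

/-- The homogeneous components of `r • v` come from those of `r` if `v` is homogeneous. -/
theorem proj_smul [Ring V] [Algebra K V] {𝒱 : ℤ → AddSubgroup V} [GradedRing 𝒱]
    (hsmul : ∀ p q, ∀ a ∈ 𝒦 p, ∀ v ∈ 𝒱 q, a • v ∈ 𝒱 (p + q)) (r : K) {d : ℤ} {v : V}
    (hv : v ∈ 𝒱 d) (q : ℤ) :
    GradedRing.proj 𝒱 q (r • v) = GradedRing.proj 𝒦 (q - d) r • v := by
  induction r using DirectSum.Decomposition.inductionOn 𝒦 with
  | zero => simp
  | @homogeneous p m =>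
    have h := hsmul p d m m.2 v hv
    rw [GradedRing.proj_apply, GradedRing.proj_apply]
    by_cases hp : p + d = q
    · obtain rfl : p = q - d := by omega
      rw [DirectSum.decompose_of_mem_same _ m.2]
      exact DirectSum.decompose_of_mem_same _ (by rwa [hp] at h)
    · rw [DirectSum.decompose_of_mem_ne _ h hp, DirectSum.decompose_of_mem_ne _ m.2 (by omega),
        zero_smul]
  | add m m' h h' => rw [add_smul, map_add, map_add, h, h', add_smul]

/-- The coordinates of a homogeneous vector are homogeneous. -/
theorem repr_mem [Ring V] [Algebra K V] {𝒱 : ℤ → AddSubgroup V} [GradedRing 𝒱]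
    (hsmul : ∀ p q, ∀ a ∈ 𝒦 p, ∀ v ∈ 𝒱 q, a • v ∈ 𝒱 (p + q)) (b : Module.Basis ι K V)
    {deg : ι → ℤ} (hb : ∀ k, b k ∈ 𝒱 (deg k)) {q : ℤ} {v : V} (hv : v ∈ 𝒱 q) (c : ι) :
    b.repr v c ∈ 𝒦 (q - deg c) := by
  have h1 : ∑ k ∈ (b.repr v).support, GradedRing.proj 𝒦 (q - deg k) (b.repr v k) • b k = v := by
    have h2 : GradedRing.proj 𝒱 q v = v := DirectSum.decompose_of_mem_same _ hv
    conv_rhs => rw [← h2, ← b.linearCombination_repr v, Finsupp.linearCombination_apply,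
      Finsupp.sum, map_sum]
    exact Finset.sum_congr rfl fun k _ => (proj_smul hsmul _ (hb k) q).symm
  have h3 : b.repr v c = GradedRing.proj 𝒦 (q - deg c) (b.repr v c) := by
    conv_lhs => rw [← h1]
    rw [map_sum, Finsupp.finsetSum_apply]
    simp only [map_smul, b.repr_self, Finsupp.smul_apply, Finsupp.single_apply, smul_eq_mul,
      mul_ite, mul_one, mul_zero, Finset.sum_ite_eq', Finsupp.mem_support_iff, ne_eq, ite_not]
    split_ifs with h
    · rw [h, map_zero]
    · rfl
  rw [h3, GradedRing.proj_apply]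
  exact SetLike.coe_mem _

variable [Ring V] [Algebra K V]

variable (𝒦) in
/-- The structure constants and the coordinates of the unit are homogeneous. -/
structure IsHomogBasis (b : Module.Basis ι K V) (deg : ι → ℤ) : Prop extends
    IsGradedComm b deg where
  mul_mem : ∀ k l c, b.repr (b k * b l) c ∈ 𝒦 (deg k + deg l - deg c)
  one_mem : ∀ k, b.repr 1 k ∈ 𝒦 (-deg k)
  one_even : ∀ k, b.repr 1 k ≠ 0 → Even (deg k)

/-- Since `K` is concentrated in even degrees, nonzero coefficients have even degree, which provides
the parity conditions. -/
theorem isHomogBasis (hK : ∀ n, Odd n → 𝒦 n = ⊥) (𝒱 : ℤ → AddSubgroup V) [GradedRing 𝒱]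
    (hsmul : ∀ p q, ∀ a ∈ 𝒦 p, ∀ v ∈ 𝒱 q, a • v ∈ 𝒱 (p + q))
    (hcomm : ∀ p q, ∀ x ∈ 𝒱 p, ∀ y ∈ 𝒱 q, x * y = (p * q).negOnePow • (y * x))
    (b : Module.Basis ι K V) (deg : ι → ℤ) (hb : ∀ k, b k ∈ 𝒱 (deg k)) :
    IsHomogBasis 𝒦 b deg := by
  have heven {n : ℤ} {r : K} (hr : r ∈ 𝒦 n) (h0 : r ≠ 0) : Even n := by
    by_contra h
    rw [hK n (Int.not_even_iff_odd.1 h)] at hr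
    exact h0 hr
  have h1 (k l c) : b.repr (b k * b l) c ∈ 𝒦 (deg k + deg l - deg c) :=
    repr_mem hsmul b hb (SetLike.mul_mem_graded (hb k) (hb l)) c
  have h2 (k) : b.repr 1 k ∈ 𝒦 (-deg k) := by
    have := repr_mem hsmul b hb (SetLike.one_mem_graded 𝒱) k
    rwa [zero_sub] at this
  exact ⟨⟨fun k l c h => heven (h1 k l c) h, fun k l => hcomm _ _ _ (hb k) _ (hb l)⟩, h1, h2,
    fun k h => by simpa using heven (h2 k) h⟩

end Grading

section GradeCond

variable {K V ι : Type*} [CommRing K] [Algebra ℚ K] {𝒦 : ℤ → Submodule ℚ K} [Ring V] [Algebra K V]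
  {deg : ι → ℤ}

theorem internalDeg_append (u v : List (Letter ι)) :
    internalDeg deg (u ++ v) = internalDeg deg u + internalDeg deg v := by
  simp [internalDeg]

theorem internalDeg_cons (a : Letter ι) (v) :
    internalDeg deg (a :: v) = 1 - deg a.1 + internalDeg deg v := by
  simp [internalDeg]

theorem lieOpCoeff_mem {b : Module.Basis ι K V} (hb : IsHomogBasis 𝒦 b deg) (x : List (Letter ι))
    (a : Letter ι) :
    lieOpCoeff b deg x a ∈ 𝒦 (internalDeg deg [a] - internalDeg deg x + 1) := by
  by_cases h : lieOpCoeff b deg x a = 0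
  · rw [h]; exact Submodule.zero_mem _
  obtain ⟨k, l, p, q, rfl, -, -⟩ := lieOpCoeff_ne_zero h
  obtain ⟨c, r⟩ := a
  have h1 : structureCoeff b deg k l c ∈ 𝒦 (internalDeg deg [(c, r)] -
      internalDeg deg [(k, p), (l, q)] + 1) := by
    rw [structureCoeff_apply]
    refine sgn_mul_mem (𝒦 _).toAddSubgroup _ ?_
    have : internalDeg deg [(c, r)] - internalDeg deg [(k, p), (l, q)] + 1 =
        deg k + deg l - deg c := by
      simp only [internalDeg, List.map_cons, List.map_nil, List.sum_cons, List.sum_nil]; ring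
    rw [this]
    exact hb.mul_mem k l c
  cases p <;> cases q <;> cases r <;> simp only [lieOpCoeff_ff_false, lieOpCoeff_ff_true,
    lieOpCoeff_tf_true, lieOpCoeff_tf_false, lieOpCoeff_ft_true, lieOpCoeff_ft_false,
    lieOpCoeff_tt, Finsupp.coe_zero, Pi.zero_apply] <;>
    first
    | exact h1
    | exact Submodule.zero_mem _
    | exact Submodule.neg_mem _ h1
    | exact Submodule.neg_mem _ (sgn_mul_mem (𝒦 _).toAddSubgroup _ h1)

variable (𝒦 deg) in
/-- The condition for the coefficient of a word in a series of form degree `p`, with words of length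
`n`, and of internal degree `m`. -/
def gradeCond (p : ℕ) (n m : ℤ) (w : List (Letter ι)) : Submodule ℚ K :=
  if (w.length : ℤ) = n ∧ formDeg w = p then 𝒦 (m - internalDeg deg w) else ⊥

theorem mem_gradeCond {p : ℕ} {n m : ℤ} {w : List (Letter ι)} {r : K} :
    r ∈ gradeCond 𝒦 deg p n m w ↔
      (r ≠ 0 → (w.length : ℤ) = n ∧ formDeg w = p) ∧ r ∈ 𝒦 (m - internalDeg deg w) := by
  rw [gradeCond]
  split_ifs with h
  · simp [h]
  · rw [Submodule.mem_bot]
    constructor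
    · rintro rfl; simp
    · intro h1; by_contra h2; exact h (h1.1 h2)

theorem internalDeg_perm {w w' : List (Letter ι)} (h : w.Perm w') :
    internalDeg deg w = internalDeg deg w' := (h.map _).sum_eq

theorem permInv_gradeCond (p : ℕ) (n m : ℤ) :
    PermInv fun w => (gradeCond 𝒦 deg p n m w).toAddSubgroup := by
  intro w w' h
  have h1 : formDeg w = formDeg w' := h.countP_eq _
  simp only [gradeCond, h1, h.length_eq, internalDeg_perm h]

theorem gradeCond_cons_true (p : ℕ) (n m : ℤ) (k : ι) (u v) :
    gradeCond 𝒦 deg (p + 1) n m (u ++ (k, true) :: v) =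
      gradeCond 𝒦 deg p n m (u ++ (k, false) :: v) := by
  simp only [gradeCond, formDeg_append, formDeg_cons_true, formDeg_cons_false, internalDeg_append,
    internalDeg_cons, List.length_append, List.length_cons, ← add_assoc, Nat.add_right_cancel_iff]

theorem mem_forms_iff {p : ℕ} {i j : ℤ} {F : Series₂ ι K} : F ∈ forms 𝒦 deg p i j ↔
    F ∈ lieForms₂ K deg ∧ ∀ u v, F (u, v) ∈ gradeCond 𝒦 deg p (i + p) (j + 1) (u ++ v) := by
  simp only [mem_gradeCond, formDeg_append, internalDeg_append, List.length_append, Nat.cast_add]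
  constructor
  · rintro ⟨h1, h2, h3⟩
    exact ⟨h1, fun u v => ⟨fun h => (h2 u v h).symm, h3 u v⟩⟩
  · rintro ⟨h1, h2⟩
    exact ⟨h1, fun u v h => ((h2 u v).1 h).symm, fun u v => (h2 u v).2⟩

theorem oddDer₂_adm {K : Type*} [CommRing K] {S S' : List (Letter ι) → AddSubgroup K}
    {ξ : List (Letter ι) → Letter ι →₀ K}
    (h : ∀ u x v a, ξ x a ≠ 0 → ∀ c ∈ S (u ++ a :: v), ξ x a * c ∈ S' (u ++ x ++ v))
    {F : Series₂ ι K} (hF : ∀ u v, F (u, v) ∈ S (u ++ v)) (u v) :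
    oddDer₂ deg ξ F (u, v) ∈ S' (u ++ v) := by
  rw [oddDer₂_apply]
  refine (S' _).add_mem ?_ (sgn_mul_mem _ _ ?_)
  · refine Adm.oddDer (S := fun u => S (u ++ v)) (S' := fun u => S' (u ++ v)) ?_
      (f := fun u => F (u, v)) (fun u => hF u v) u
    intro u x w a hx c hc
    have := h u x (w ++ v) a hx c (by simpa using hc)
    simpa using this
  · refine Adm.oddDer (S := fun v => S (u ++ v)) (S' := fun v => S' (u ++ v)) ?_
      (f := fun v => F (u, v)) (fun v => hF u v) v
    intro w x v a hx c hc
    have := h (u ++ w) x v a hx c (by simpa using hc)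
    simpa using this

theorem deRham_mem_forms [TopologicalSpace K] [DiscreteTopology K] {i j : ℤ} {F : Series₂ ι K}
    (hF : F ∈ forms 𝒦 deg 0 (i + 1) j) : deRham K deg F ∈ forms 𝒦 deg 1 i j := by
  rw [mem_forms_iff] at hF ⊢
  refine ⟨oddDer₂_mem (isLieDer_deRham deg) hF.1, oddDer₂_adm
    (S := fun w => (gradeCond 𝒦 deg 0 (i + 1 + (0 : ℕ)) (j + 1) w).toAddSubgroup)
    (S' := fun w => (gradeCond 𝒦 deg 1 (i + (1 : ℕ)) (j + 1) w).toAddSubgroup) ?_ hF.2⟩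
  intro u x v a hx c hc
  obtain ⟨k, rfl, rfl⟩ := deRhamCoeff_ne_zero hx
  have h1 : deRhamCoeff K [(k, true)] (k, false) = 1 := by simp [deRhamCoeff]
  have h2 : u ++ [(k, true)] ++ v = u ++ (k, true) :: v := by simp
  rw [h1, one_mul, h2]
  have h3 : i + 1 + (0 : ℕ) = i + (1 : ℕ) := by simp
  rw [h3] at hc
  exact (gradeCond_cons_true (𝒦 := 𝒦) (deg := deg) 0 (i + (1 : ℕ)) (j + 1) k u v).symm ▸ hc

end GradeCond

section LieOperator

variable {K V ι : Type*} [CommRing K] [Algebra ℚ K] {𝒦 : ℤ → Submodule ℚ K} [GradedAlgebra 𝒦]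
  [Ring V] [Algebra K V] {b : Module.Basis ι K V} {deg : ι → ℤ}

theorem gradeCond_merge (hb : IsHomogBasis 𝒦 b deg) (p : ℕ) (n m : ℤ) (u x v) (a : Letter ι)
    (hx : lieOpCoeff b deg x a ≠ 0) (c : K)
    (hc : c ∈ (gradeCond 𝒦 deg p n m (u ++ a :: v)).toAddSubgroup) :
    lieOpCoeff b deg x a * c ∈
      (gradeCond 𝒦 deg p (n + 1) (m + 1) (u ++ x ++ v)).toAddSubgroup := by
  rw [Submodule.mem_toAddSubgroup, mem_gradeCond] at hc ⊢
  refine ⟨fun h => ?_, ?_⟩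
  · obtain ⟨h1, h2⟩ := hc.1 (right_ne_zero_of_mul h)
    rw [length_merge hx, formDeg_merge hx]
    exact ⟨by push_cast; omega, h2⟩
  · have := SetLike.mul_mem_graded (lieOpCoeff_mem hb x a) hc.2
    have h1 : internalDeg deg [a] - internalDeg deg x + 1 + (m - internalDeg deg (u ++ a :: v)) =
        m + 1 - internalDeg deg (u ++ x ++ v) := by
      simp only [internalDeg_append, internalDeg_cons a v, internalDeg_cons a []]
      simp [internalDeg]; ring
    rwa [h1] at this

variable [TopologicalSpace K] [DiscreteTopology K]

theorem lieOp_mem_forms (hb : IsHomogBasis 𝒦 b deg) {p : ℕ} {i j : ℤ} {F : Series₂ ι K}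
    (hF : F ∈ forms 𝒦 deg p i j) : lieOp b deg F ∈ forms 𝒦 deg p (i + 1) (j + 1) := by
  rw [mem_forms_iff] at hF ⊢
  refine ⟨oddDer₂_mem (isLieDer_lieOp hb.toIsGradedComm) hF.1, ?_⟩
  rw [add_right_comm i 1]
  exact oddDer₂_adm (S := fun w => (gradeCond 𝒦 deg p (i + p) (j + 1) w).toAddSubgroup)
    (S' := fun w => (gradeCond 𝒦 deg p (i + p + 1) (j + 1 + 1) w).toAddSubgroup)
    (gradeCond_merge hb p (i + p) (j + 1)) hF.2

end LieOperator

/-! ### Comparison of the two complexes -/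

section Words

variable {ι K : Type*} [CommRing K] {deg : ι → ℤ}

/-- The commutator `∑ a, [a, X a]` of Lie series `X a` is a Lie series. -/
theorem sub_rot_mem [TopologicalSpace K] [DiscreteTopology K] {g : Series ι K} (h0 : g [] = 0)
    (hg : ∀ a, slice a g ∈ lieForms K deg) : g - rot deg g ∈ lieForms K deg := by
  intro s
  let A : Finset (Letter ι) := s.biUnion fun w => w.toFinset
  have hmem : ∑ a ∈ A, bracket deg (letter K a) (slice a g) ∈ lieForms K deg :=
    Submodule.sum_mem _ fun a _ => bracket_mem (IsLieMonomial.of a).mem (hg a)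
  obtain ⟨h, hh, hhs⟩ := hmem s
  refine ⟨h, hh, fun w hw => ?_⟩
  rw [hhs w hw]
  simp only [← rot_letter_conc]
  have hA (a) (ha : a ∈ w) : a ∈ A := Finset.mem_biUnion.2 ⟨w, hw, by simpa using ha⟩
  have hval (a v) (ha : a ∈ A) : ∑ e ∈ A, conc (letter K e) (slice e g) (a :: v) = g (a :: v) := by
    simp only [letter_conc_cons]
    rw [Finset.sum_ite_eq]
    simp [ha]
  rw [Finset.sum_sub_distrib, Pi.sub_apply, Pi.sub_apply, Finset.sum_apply, Finset.sum_apply]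
  congr 1
  · cases w with
    | nil => simp [h0, letter]
    | cons a v => exact hval a v (hA a (by simp))
  · induction w using List.reverseRecOn with
    | nil => simp [h0, letter]
    | append_singleton u c _ =>
      simp only [rot_append]
      rw [← Finset.mul_sum, hval c u (hA c (by simp))]

/-- The tensor `∑ a, a ⊗ slice a g`. -/
def ofLetters : Series ι K →ₗ[K] Series₂ ι K :=
  LinearMap.pi fun p => match p.1 with
    | [a] => LinearMap.proj (a :: p.2)
    | _ => 0

theorem ofLetters_apply (g : Series ι K) (a v) : ofLetters g ([a], v) = g (a :: v) := rfl

theorem ofLetters_eq_zero (g : Series ι K) {u : List (Letter ι)} (hu : u.length ≠ 1) (v) :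
    ofLetters g (u, v) = 0 := by
  match u with
  | [] => rfl
  | [_] => simp at hu
  | _ :: _ :: _ => rfl

theorem mult_ofLetters {g : Series ι K} (h0 : g [] = 0) : mult (ofLetters g) = g := by
  ext w
  cases w with
  | nil => rw [mult_nil, h0]; rfl
  | cons a v =>
    rw [mult_cons, ofLetters_eq_zero _ (by simp), zero_add, mult_of_left_nil]
    · rfl
    · intro u v hu
      exact ofLetters_eq_zero _ (u := a :: u) (by simpa using hu) _

end Words

section Main

variable {K V ι : Type*} [CommRing K] [Algebra ℚ K] {𝒦 : ℤ → Submodule ℚ K} {deg : ι → ℤ}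

variable (𝒦 deg) in
/-- Normal forms of homogeneous one-forms with `n` letters: series `∑ k, (t k) (X k)` with Lie series
`X k` in the letters `t k`. -/
structure IsNormalForm (n m : ℤ) (g : Series ι K) : Prop where
  nil : g [] = 0
  slice_mem : ∀ a, slice a g ∈ lieForms K deg
  adm : Adm (fun w => (gradeCond 𝒦 deg 0 n m w).toAddSubgroup) g

theorem IsNormalForm.length {n m : ℤ} {g : Series ι K} (hg : IsNormalForm 𝒦 deg n m g) (w)
    (hw : g w ≠ 0) : (w.length : ℤ) = n := ((mem_gradeCond.1 (hg.adm w)).1 hw).1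

theorem IsNormalForm.pure {n m : ℤ} {g : Series ι K} (hg : IsNormalForm 𝒦 deg n m g) : Pure g :=
  ⟨hg.nil, fun w hw => ((mem_gradeCond.1 (hg.adm w)).1 hw).2⟩

theorem IsNormalForm.sub {n m : ℤ} {g h : Series ι K} (hg : IsNormalForm 𝒦 deg n m g)
    (hh : IsNormalForm 𝒦 deg n m h) : IsNormalForm 𝒦 deg n m (g - h) :=
  ⟨by simp [hg.nil, hh.nil], fun a => by
    rw [map_sub]; exact Submodule.sub_mem _ (hg.slice_mem a) (hh.slice_mem a), hg.adm.sub hh.adm⟩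

theorem formDeg_of_mem_forms {p : ℕ} {i j : ℤ} {F : Series₂ ι K} (hF : F ∈ forms 𝒦 deg p i j) :
    ∀ u v, F (u, v) ≠ 0 → formDeg u + formDeg v = p := fun u v h => (hF.2.1 u v h).1

theorem ofNormalForm_mem_forms {n m : ℤ} {g : Series ι K} (hg : IsNormalForm 𝒦 deg n m g) :
    ofNormalForm g ∈ forms 𝒦 deg 1 (n - 1) (m - 1) := by
  rw [mem_forms_iff]
  constructor
  · refine mem_lieForms₂_of_letters (fun u v hu => ofNormalForm_eq_zero g ?_ v) fun a => ?_
    · rintro k rfl; simp at hu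
    · obtain ⟨k, _ | _⟩ := a
      · have : (fun v => ofNormalForm g ([(k, false)], v)) = 0 := by
          ext v; exact ofNormalForm_eq_zero g (by simp) v
        rw [this]; exact Submodule.zero_mem _
      · exact hg.slice_mem (k, false)
  · intro u v
    by_cases h : ∃ k, u = [(k, true)]
    · obtain ⟨k, rfl⟩ := h
      have h1 := hg.adm ((k, false) :: v)
      have h2 := gradeCond_cons_true (𝒦 := 𝒦) (deg := deg) 0 n m k [] v
      simp only [List.nil_append, zero_add] at h2
      rw [ofNormalForm_true, Nat.cast_one, sub_add_cancel, sub_add_cancel, List.singleton_append, h2]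
      exact h1
    · push Not at h
      rw [ofNormalForm_eq_zero g h]
      exact Submodule.zero_mem _

/-- A rotation invariant normal form is the normal form of an exact one-form. -/
theorem exists_normalForm_deRham_eq {n : ℕ} (hn : n ≠ 0) {m : ℤ} {g : Series ι K}
    (hg : IsNormalForm 𝒦 deg n m g) (hr : rot deg g = g) :
    ∃ F ∈ forms 𝒦 deg 0 n (m - 1), normalForm deg (deRham K deg F) = g := by
  have hn' : (n : ℚ) ≠ 0 := by exact_mod_cast hn
  refine ⟨(n : ℚ)⁻¹ • ofLetters g, Submodule.smul_mem _ _ ?_, ?_⟩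
  · rw [mem_forms_iff]
    refine ⟨mem_lieForms₂_of_letters (fun u v hu => ofLetters_eq_zero g hu v) hg.slice_mem,
      fun u v => ?_⟩
    by_cases hu : u.length = 1
    · obtain ⟨a, rfl⟩ := List.length_eq_one_iff.1 hu
      have := hg.adm (a :: v)
      simpa [ofLetters_apply] using this
    · rw [ofLetters_eq_zero g hu]; exact Submodule.zero_mem _
  · have h1 : deRham K deg ((n : ℚ)⁻¹ • ofLetters g) = (n : ℚ)⁻¹ • deRham K deg (ofLetters g) :=
      map_rat_smul (deRham K deg) _ _
    rw [h1, map_rat_smul (normalForm deg), normalForm_deRham _ rfl, mult_ofLetters hg.nil]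
    · ext w
      rw [Pi.smul_apply, cyc_of_rot_eq deg hr]
      by_cases hw : g w = 0
      · simp [hw]
      · have h2 : w.length = n := by exact_mod_cast hg.length w hw
        rw [h2, ← nsmul_eq_mul, ← Nat.cast_smul_eq_nsmul ℚ, smul_smul, inv_mul_cancel₀ hn',
          one_smul]
    · intro u v h
      by_cases hu : u.length = 1
      · obtain ⟨a, rfl⟩ := List.length_eq_one_iff.1 hu
        rw [ofLetters_apply] at h
        rw [← formDeg_append]
        exact hg.pure.formDeg _ h
      · exact absurd (ofLetters_eq_zero g hu v) h

variable [TopologicalSpace K] [DiscreteTopology K]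

/-- There are no forms with fewer than two letters, since each tensor factor is a Lie series. -/
theorem forms_eq_zero {p : ℕ} {i j : ℤ} (hi : i + p ≤ 1) {F : Series₂ ι K}
    (hF : F ∈ forms 𝒦 deg p i j) : F = 0 := by
  ext ⟨u, v⟩
  by_contra h
  have h1 := (hF.2.1 u v h).2
  have h2 : u = [] ∨ v = [] := by
    by_contra! h'
    have := List.length_pos_iff.2 h'.1
    have := List.length_pos_iff.2 h'.2
    omega
  rcases h2 with rfl | rfl
  · exact h (lieForms_apply_nil (slice_left_mem hF.1 v))
  · exact h (lieForms_apply_nil (slice_right_mem hF.1 u))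

/-- A homogeneous zero-form whose de Rham differential vanishes in `DR_Lie` vanishes there. -/
theorem mem_relations_of_deRham_mem {i j : ℤ} {F : Series₂ ι K} (hF : F ∈ forms 𝒦 deg 0 i j)
    (h : deRham K deg F ∈ relations K deg) : F ∈ relations K deg := by
  by_cases hi : i ≤ 1
  · rw [forms_eq_zero (by simpa using hi) hF]; exact Submodule.zero_mem _
  · refine mem_relations_of_deRham (n := i.toNat) (by omega) (fun u v huv => ?_) h
    have := hF.2.1 u v huv
    exact ⟨this.1, by omega⟩

theorem isNormalForm_normalForm {i j : ℤ} {F : Series₂ ι K} (hF : F ∈ forms 𝒦 deg 1 i j) :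
    IsNormalForm 𝒦 deg (i + 1) (j + 1) (normalForm deg F) where
  nil := by simp [normalForm]
  slice_mem := (normalForm_spec hF.1 (formDeg_of_mem_forms hF)).1
  adm := by
    have h1 : Adm (fun w => (gradeCond 𝒦 deg 1 (i + (1 : ℕ)) (j + 1) w).toAddSubgroup)
        (cyc deg (mult F)) :=
      (adm_mult (S := fun w => (gradeCond 𝒦 deg 1 (i + (1 : ℕ)) (j + 1) w).toAddSubgroup)
        (mem_forms_iff.1 hF).2).cyc (permInv_gradeCond _ _ _)
    intro w
    rw [normalForm, LinearMap.comp_apply, LinearMap.comp_apply]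
    match w with
    | [] => exact AddSubgroup.zero_mem _
    | (k, true) :: u => exact AddSubgroup.zero_mem _
    | (k, false) :: u =>
      rw [undiff_false]
      have := h1 ((k, true) :: u)
      have h2 := gradeCond_cons_true (𝒦 := 𝒦) (deg := deg) 0 (i + (1 : ℕ)) (j + 1) k [] u
      simp only [List.nil_append, zero_add, Nat.cast_one] at h2 this
      rwa [h2] at this

variable [Ring V] [Algebra K V] {b : Module.Basis ι K V}

/-- The normal form of `L_m F` is determined by the normal form of `F`. -/
theorem normalForm_lieOp (hb : IsGradedComm b deg) {i j : ℤ} {F : Series₂ ι K}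
    (hF : F ∈ forms 𝒦 deg 1 i j) :
    normalForm deg (lieOp b deg F) = -hoch deg (lieOpCoeff b deg) (normalForm deg F) := by
  have h1 := (normalForm_spec hF.1 (formDeg_of_mem_forms hF)).2
  have h2 := normalForm_relations (oddDer₂_mem_relations (isLieDer_lieOp hb) h1)
  rw [map_sub, map_sub, sub_eq_zero] at h2
  rw [lieOp, h2]
  exact normalForm_lieOp_ofNormalForm (isNormalForm_normalForm hF).pure

variable [GradedAlgebra 𝒦]

theorem isNormalForm_hoch (hb : IsHomogBasis 𝒦 b deg) {n m : ℤ} {g : Series ι K}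
    (hg : IsNormalForm 𝒦 deg n m g) :
    IsNormalForm 𝒦 deg (n + 1) (m + 1) (hoch deg (lieOpCoeff b deg) g) := by
  have h1 := isNormalForm_normalForm (lieOp_mem_forms hb (ofNormalForm_mem_forms hg))
  rw [normalForm_lieOp_ofNormalForm hg.pure] at h1
  have h2 : n - 1 + 1 + 1 = n + 1 := by ring
  have h3 : m - 1 + 1 + 1 = m + 1 := by ring
  rw [h2, h3] at h1
  refine ⟨by simpa using h1.nil, fun a => ?_, ?_⟩
  · have := Submodule.neg_mem _ (h1.slice_mem a)
    rwa [← map_neg, neg_neg] at this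
  · have := h1.adm.neg
    rwa [neg_neg] at this

/-- A normal form whose differential is rotation invariant is rotation invariant up to a
coboundary. -/
theorem exists_rot_invariant (hb : IsHomogBasis 𝒦 b deg) {n : ℕ} (hn : 3 ≤ n) {m : ℤ}
    {g : Series ι K} (hg : IsNormalForm 𝒦 deg n m g)
    (hr : rot deg (hoch deg (lieOpCoeff b deg) g) = hoch deg (lieOpCoeff b deg) g) :
    ∃ g', IsNormalForm 𝒦 deg (n - 1) (m - 1) g' ∧
      rot deg (g - hoch deg (lieOpCoeff b deg) g') = g - hoch deg (lieOpCoeff b deg) g' := by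
  have hd := (isLieDer_lieOp hb.toIsGradedComm).odd
  have hq := quad_lieOpCoeff (b := b) (deg := deg)
  have h1 := hoch_sub_rot hq hd g
  rw [hr, sub_self] at h1
  have hadm : Adm (fun w => (gradeCond 𝒦 deg 0 n m w).toAddSubgroup) (g - rot deg g) :=
    hg.adm.sub (hg.adm.rot (permInv_gradeCond _ _ _))
  have hcond (w) (hw : (g - rot deg g) w ≠ 0) := (mem_gradeCond.1 (hadm w)).1 hw
  obtain ⟨y, hy, hDy, hAy⟩ := exists_lie_oddDer_eq hb.toIsGradedComm hb.one_even
    (sub_rot_mem hg.nil hg.slice_mem) ⟨by simp, fun w hw => (hcond w hw).2⟩ (by omega : 2 ≤ n)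
    (fun w hw => by exact_mod_cast (hcond w hw).1) h1.symm
  have hAdm := hAy (gradeCond 𝒦 deg 0 (n - 1) (m - 1)) (permInv_gradeCond _ _ _) (fun k w => by
    have h2 := mem_gradeCond.1 (hadm ((k, false) :: w))
    rw [mem_gradeCond]
    refine ⟨fun h => ?_, ?_⟩
    · have := h2.1 (right_ne_zero_of_mul h)
      rw [formDeg_cons_false, List.length_cons] at this
      exact ⟨by push_cast at this; omega, this.2⟩
    · have h3 := SetLike.mul_mem_graded (hb.one_mem k) h2.2
      rw [internalDeg_cons] at h3
      have h4 : -deg k + (m - (1 - deg k + internalDeg deg w)) = m - 1 - internalDeg deg w := by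
        ring
      rwa [h4] at h3)
  obtain ⟨g', hs, hrot, hA⟩ := exists_sub_rot hy (n := n - 1) (by omega) (fun w hw => by
    have := ((mem_gradeCond.1 (hAdm w)).1 hw).1
    omega)
  have hadm' := hA _ (permInv_gradeCond _ _ _) hAdm
  refine ⟨g', ⟨?_, hs, hadm'⟩, ?_⟩
  · by_contra h
    have := ((mem_gradeCond.1 (hadm' [])).1 h).1
    simp at this
    omega
  · have h3 := hoch_sub_rot hq hd g'
    rw [hrot, hDy] at h3
    rw [map_sub]
    have h4 : hoch deg (lieOpCoeff b deg) g' - rot deg (hoch deg (lieOpCoeff b deg) g') =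
      g - rot deg g := h3
    rw [sub_eq_sub_iff_add_eq_add] at h4
    rw [sub_eq_sub_iff_add_eq_add]
    rw [add_comm, h4, add_comm]

/-- A one-form of order at least two whose differential has a rotation invariant normal form is exact
modulo the image of the Lie operator. -/
theorem exists_deRham_sub_mem (hb : IsHomogBasis 𝒦 b deg) {i j : ℤ} (hi : 2 ≤ i)
    {z : Series₂ ι K} (hz : z ∈ forms 𝒦 deg 1 i j)
    (hr : rot deg (normalForm deg (lieOp b deg z)) = normalForm deg (lieOp b deg z)) :
    ∃ F ∈ forms 𝒦 deg 0 (i + 1) j, ∃ H ∈ forms 𝒦 deg 1 (i - 1) (j - 1),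
      deRham K deg F - z - lieOp b deg H ∈ relations K deg := by
  obtain ⟨n, hn⟩ : ∃ n : ℕ, (n : ℤ) = i + 1 := ⟨(i + 1).toNat, by omega⟩
  have hg := isNormalForm_normalForm hz
  rw [← hn] at hg
  rw [normalForm_lieOp hb.toIsGradedComm hz, map_neg, neg_inj] at hr
  obtain ⟨g', hg', hr'⟩ := exists_rot_invariant hb (by omega) hg hr
  have hh := isNormalForm_hoch hb hg'
  rw [sub_add_cancel, sub_add_cancel] at hh
  obtain ⟨F, hF, hFn⟩ := exists_normalForm_deRham_eq (by omega) (hg.sub hh) hr'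
  have hH := ofNormalForm_mem_forms hg'
  rw [hn, add_sub_cancel_right] at hF
  have h1 : (n : ℤ) - 1 - 1 = i - 1 := by omega
  have h2 : j + 1 - 1 - 1 = j - 1 := by omega
  rw [h1, h2] at hH
  refine ⟨F, hF, ofNormalForm g', hH, ?_⟩
  have hsub : deRham K deg F - z - lieOp b deg (ofNormalForm g') ∈ forms 𝒦 deg 1 i j := by
    refine Submodule.sub_mem _ (Submodule.sub_mem _ (deRham_mem_forms hF) hz) ?_
    have := lieOp_mem_forms hb hH
    rwa [sub_add_cancel, sub_add_cancel] at this
  have h3 := (normalForm_spec hsub.1 (formDeg_of_mem_forms hsub)).2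
  have h4 : normalForm deg (deRham K deg F - z - lieOp b deg (ofNormalForm g')) = 0 := by
    rw [map_sub, map_sub, hFn, normalForm_lieOp_ofNormalForm hg'.pure]
    abel
  rwa [h4, map_zero, sub_zero] at h3

end Main

section Comparison

variable {K V ι : Type*} [CommRing K] [Algebra ℚ K] {𝒦 : ℤ → Submodule ℚ K} {deg : ι → ℤ}
  [Ring V] [Algebra K V] {b : Module.Basis ι K V}

theorem mem_cocycles {p : ℕ} {i j : ℤ} {F : Series₂ ι K} : F ∈ cocycles 𝒦 b deg p i j ↔
    F ∈ forms 𝒦 deg p i j ∧ lieOp b deg F ∈ relations K deg := Iff.rfl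

theorem mem_coboundaries {p : ℕ} {i j : ℤ} {F : Series₂ ι K} : F ∈ coboundaries 𝒦 b deg p i j ↔
    F ∈ forms 𝒦 deg p i j ∧
      ∃ G ∈ forms 𝒦 deg p (i - 1) (j - 1), F - lieOp b deg G ∈ relations K deg := by
  rw [coboundaries, Submodule.mem_inf, Submodule.mem_sup]
  refine and_congr_right fun _ => ⟨?_, ?_⟩
  · rintro ⟨r, hr, _, ⟨G, hG, rfl⟩, rfl⟩
    exact ⟨G, hG, by simpa using hr⟩
  · rintro ⟨G, hG, h⟩
    exact ⟨_, h, _, ⟨G, hG, rfl⟩, by simp⟩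

variable [TopologicalSpace K] [DiscreteTopology K]

theorem lieOp_mem_relations (hb : IsGradedComm b deg) {F : Series₂ ι K}
    (hF : F ∈ relations K deg) : lieOp b deg F ∈ relations K deg :=
  oddDer₂_mem_relations (isLieDer_lieOp hb) hF

theorem deRham_mem_cocycles (hb : IsHomogBasis 𝒦 b deg) {i j : ℤ} {F : Series₂ ι K}
    (hF : F ∈ cocycles 𝒦 b deg 0 (i + 1) j) : deRham K deg F ∈ cocycles 𝒦 b deg 1 i j := by
  rw [mem_cocycles] at hF ⊢
  refine ⟨deRham_mem_forms hF.1, ?_⟩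
  rw [lieOp_deRham hb.toIsGradedComm]
  exact Submodule.neg_mem _ (deRham_mem_relations hF.2)

theorem deRham_mem_coboundaries (hb : IsHomogBasis 𝒦 b deg) {i j : ℤ} {F : Series₂ ι K}
    (hF : F ∈ coboundaries 𝒦 b deg 0 (i + 1) j) :
    deRham K deg F ∈ coboundaries 𝒦 b deg 1 i j := by
  rw [mem_coboundaries] at hF ⊢
  obtain ⟨h1, G, hG, h2⟩ := hF
  refine ⟨deRham_mem_forms h1, -deRham K deg G, Submodule.neg_mem _ (deRham_mem_forms ?_), ?_⟩
  · rwa [sub_add_cancel, ← add_sub_cancel_right i 1]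
  · rw [map_neg, lieOp_deRham hb.toIsGradedComm, neg_neg, ← map_sub]
    exact deRham_mem_relations h2

variable [GradedAlgebra 𝒦]

/-- A zero-form in order `i + 1`, for `i = 1` or `i ≥ 3`, is a coboundary if its differential is one. -/
theorem mem_coboundaries_of_deRham (hb : IsHomogBasis 𝒦 b deg) {i j : ℤ} (hi : i = 1 ∨ 3 ≤ i)
    {F : Series₂ ι K} (hF : F ∈ forms 𝒦 deg 0 (i + 1) j)
    (h : deRham K deg F ∈ coboundaries 𝒦 b deg 1 i j) :
    F ∈ coboundaries 𝒦 b deg 0 (i + 1) j := by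
  obtain ⟨-, G, hG, h1⟩ := mem_coboundaries.1 h
  rw [mem_coboundaries]
  refine ⟨hF, ?_⟩
  rcases hi with rfl | hi
  · rw [forms_eq_zero (by simp) hG, map_zero, sub_zero] at h1
    exact ⟨0, Submodule.zero_mem _, by
      rw [map_zero, sub_zero]; exact mem_relations_of_deRham_mem hF h1⟩
  have hr : rot deg (normalForm deg (lieOp b deg G)) = normalForm deg (lieOp b deg G) := by
    have h2 := normalForm_relations h1
    rw [map_sub, sub_eq_zero] at h2
    have h0 : F ([], []) = 0 := by
      by_contra h'
      have := (hF.2.1 _ _ h').2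
      simp at this
      omega
    rw [← h2, normalForm_deRham (formDeg_of_mem_forms hF) h0, rot_cyc]
  obtain ⟨E, hE, H, -, hEH⟩ := exists_deRham_sub_mem hb (by omega) hG hr
  rw [sub_add_cancel, ← add_sub_cancel_right i 1] at hE
  refine ⟨-E, Submodule.neg_mem _ hE, ?_⟩
  have hf : F - lieOp b deg (-E) ∈ forms 𝒦 deg 0 (i + 1) j := by
    have := lieOp_mem_forms hb (Submodule.neg_mem _ hE)
    rw [sub_add_cancel, sub_add_cancel] at this
    exact Submodule.sub_mem _ hF this
  refine mem_relations_of_deRham_mem hf ?_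
  have h3 := lieOp_mem_relations hb.toIsGradedComm hEH
  rw [map_sub, map_sub, lieOp_lieOp hb.toIsGradedComm, lieOp_deRham hb.toIsGradedComm] at h3
  have h4 : deRham K deg (F - lieOp b deg (-E)) = (deRham K deg F - lieOp b deg G) -
      (-deRham K deg (lieOp b deg E) - lieOp b deg G - 0) := by
    rw [map_sub, map_neg, map_neg]; abel
  rw [h4]
  exact Submodule.sub_mem _ h1 h3

/-- In order at least two every cocycle of one-forms is cohomologous to the differential of a
cocycle. -/
theorem exists_cocycle_deRham_sub_mem (hb : IsHomogBasis 𝒦 b deg) {i j : ℤ} (hi : 2 ≤ i)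
    {z : Series₂ ι K} (hz : z ∈ cocycles 𝒦 b deg 1 i j) :
    ∃ F ∈ cocycles 𝒦 b deg 0 (i + 1) j, deRham K deg F - z ∈ coboundaries 𝒦 b deg 1 i j := by
  rw [mem_cocycles] at hz
  have hb' := hb.toIsGradedComm
  obtain ⟨F, hF, H, hH, h⟩ := exists_deRham_sub_mem hb hi hz.1
    (by rw [normalForm_relations hz.2, map_zero])
  refine ⟨F, mem_cocycles.2 ⟨hF, ?_⟩, mem_coboundaries.2
    ⟨Submodule.sub_mem _ (deRham_mem_forms hF) hz.1, H, hH, h⟩⟩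
  refine mem_relations_of_deRham_mem (lieOp_mem_forms hb hF) ?_
  have h1 := Submodule.add_mem _ (lieOp_mem_relations hb' h) hz.2
  rw [map_sub, map_sub, lieOp_lieOp hb', lieOp_deRham hb', sub_zero, sub_add_cancel] at h1
  simpa using Submodule.neg_mem _ h1

end Comparison

end Harrison

end

theorem mainTheorem9 {K V ι : Type*} [CommRing K] [Algebra ℚ K]
    (𝒦 : ℤ → Submodule ℚ K) [GradedAlgebra 𝒦] (hK : ∀ n, Odd n → 𝒦 n = ⊥)
    [Ring V] [Algebra K V] (𝒱 : ℤ → AddSubgroup V) [GradedRing 𝒱]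
    (hsmul : ∀ p q, ∀ a ∈ 𝒦 p, ∀ v ∈ 𝒱 q, a • v ∈ 𝒱 (p + q))
    (hcomm : ∀ p q, ∀ x ∈ 𝒱 p, ∀ y ∈ 𝒱 q, x * y = (p * q).negOnePow • (y * x))
    (b : Module.Basis ι K V) (deg : ι → ℤ) (hb : ∀ k, b k ∈ 𝒱 (deg k)) (i j : ℤ) :
    ∃ I : Harrison.HCHarr 𝒦 b deg (i + 1) j →ₗ[ℚ] Harrison.HHarr 𝒦 b deg i j,
      (∀ z : Harrison.cocycles 𝒦 b deg 0 (i + 1) j,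
        ∃ z' : Harrison.cocycles 𝒦 b deg 1 i j,
          (z' : Harrison.Series₂ ι K) = Harrison.deRham K deg z ∧
          I (Harrison.classOf 𝒦 b deg z) = Harrison.classOf 𝒦 b deg z') ∧
      (i = 1 → Function.Injective I) ∧
      (i = 2 → Function.Surjective I) ∧
      (3 ≤ i → Function.Bijective I) := by
  -- with the discrete topology on `K`, closed spans are closures for coefficientwise convergence
  let _ : TopologicalSpace K := ⊥
  have _ : DiscreteTopology K := ⟨rfl⟩
  have hB := Harrison.isHomogBasis hK 𝒱 hsmul hcomm b deg hb
  let D : Harrison.cocycles 𝒦 b deg 0 (i + 1) j →ₗ[ℚ] Harrison.cocycles 𝒦 b deg 1 i j :=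
    ((Harrison.deRham K deg).restrictScalars ℚ).restrict
      fun z hz => Harrison.deRham_mem_cocycles hB hz
  let I : Harrison.HCHarr 𝒦 b deg (i + 1) j →ₗ[ℚ] Harrison.HHarr 𝒦 b deg i j :=
    Submodule.mapQ _ _ D fun z hz => Harrison.deRham_mem_coboundaries hB hz
  have hinj (hi : i = 1 ∨ 3 ≤ i) : Function.Injective I := by
    rw [injective_iff_map_eq_zero]
    intro x hx
    obtain ⟨z, rfl⟩ := Submodule.Quotient.mk_surjective _ x
    have h1 : D z ∈ (Harrison.coboundaries 𝒦 b deg 1 i j).submoduleOf _ :=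
      (Submodule.Quotient.mk_eq_zero _).1 hx
    exact (Submodule.Quotient.mk_eq_zero _).2
      (Harrison.mem_coboundaries_of_deRham hB hi z.2.1 h1)
  have hsurj (hi : 2 ≤ i) : Function.Surjective I := by
    intro x
    obtain ⟨z, rfl⟩ := Submodule.Quotient.mk_surjective _ x
    obtain ⟨F, hF, h⟩ := Harrison.exists_cocycle_deRham_sub_mem hB hi z.2
    exact ⟨Harrison.classOf 𝒦 b deg ⟨F, hF⟩, (Submodule.Quotient.eq _).2 h⟩
  exact ⟨I, fun z => ⟨D z, rfl, rfl⟩, fun hi => hinj (Or.inl hi), fun hi => hsurj hi.ge,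
    fun hi => ⟨hinj (Or.inr hi), hsurj (by omega)⟩⟩
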